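/- **Model.** There are $m\ge 1$ agents, each with $n\ge 1$ actions, and an inspection budget $B\in\mathbb Z^{+}$. Agent $\ell$ has expected rewards $R^\ell_i\ge 0$ and costs $c^\ell_i\ge 0$ ($i\in[n]$), a cost of safety compliance $\kappa_S^\ell\ge 0$, an inspection cost $\kappa_I^\ell\ge 0$ (borne by the principal) and a side-effect probability $\alpha^\ell\in(0,1]$. Under a linear contract $(\gamma,\beta)\in[0,1]^2$ (share $\gamma$ of the reward, inspection with probability $\beta$) the agent's utility is $\gamma R_i^\ell-c_i^\ell-\kappa_S^\ell$ for the safe action $(i,1)$ and $(1-\beta)(1-\alpha^\ell)\gamma R_i^\ell-c_i^\ell$ for the unsafe action $(i,0)$. The contract implements an action if this action maximizes the agent's utility over all safe and unsafe actions and gives non-negative utility. If $(\gamma,\beta)$ implements $(i,1)$, then the principal's utility is $(1-\gamma)R_i^\ell-\beta\kappa_I^\ell$. Let $\beta^\ell_{\min}$ be the least $\beta$ among linear contracts implementing some safe action of agent $\ell$. For $\bar\beta\ge\beta^\ell_{\min}$ let $U_p^\ell(\bar\beta)$ be the largest utility of the principal over linear contracts with $\beta\le\bar\beta$ that implement some safe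 action of agent $\ell$. The budget allocation problem is $$\mathrm{OPT}=\max\Big\{\sum_{\ell=1}^m U_p^\ell(\bar\beta^\ell)\;:\;\beta^\ell_{\min}\le\bar\beta^\ell\le 1,\ \sum_{\ell=1}^m\bar\beta^\ell\le B\Big\}.$$ **Assumptions.** (1) $c_1^\ell<\dots<c_n^\ell$ and $R_1^\ell<\dots<R_n^\ell$ for every $\ell$. (2) $\max_i(R_i^\ell-c_i^\ell)>\kappa_S^\ell$ for every $\ell$. (3) $\sum_{\ell}\beta^\ell_{\min}\le B$. Put $\Lambda=\max_\ell (R_n^\ell)^2/\kappa_S^\ell$, where agents with $\kappa_S^\ell=0$ contribute $0$, and read $\log n$ as $\log 2$ when $n=1$. **Theorem.** There are an absolute constant $C$ and two fixed programs for a real random access machine, one for each part below, such that the following holds for every instance satisfying Assumptions (1)–(3). The machine has unit-cost operations: addition, truncated subtraction, halving and comparison of integers; $+,-,\times,\div,\sqrt{\ }$ and comparison of reals; conversion of an integer to a real; memory access; and no rounding of reals. 1. (Absolute accuracy.) For every $\varepsilon>0$, the first program, given the instance and $\varepsilon$, halts with a feasible allocation of value at least $\mathrm{OPT}-\varepsilon$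 after at most $$C\Big(mn+\Lambda^2\,\frac{m^3B}{\varepsilon^2}\Big)\log n$$ steps. 2. (Relative accuracy.) If $\mathrm{OPT}>0$, then for every $\varepsilon\in(0,1]$ the second program, given the instance and $\varepsilon$, halts with a feasible allocation of value at least $(1-\varepsilon)\,\mathrm{OPT}$ after at most $$C\Big(mn+\Big(\frac{\Lambda}{\mathrm{OPT}}\Big)^2\frac{m^3B}{\varepsilon^2}\Big)\log n$$ steps. In particular, when $\Lambda$ (respectively $\Lambda/\mathrm{OPT}$) is treated as a constant, an $\varepsilon$-approximate solution is found in time $O\big((mn+m^3B/\varepsilon^2)\log n\big)$. -/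

import Mathlib

/-! ## The contract model -/

namespace Inspection

/-- The data of one agent with `n` actions: `R i` is the expected reward and `c i` the cost of the
`i`-th action, `κS` the agent's cost of complying with the safety measures, `κI` the principal's
cost of an inspection, `α` the probability of a negative side effect of an unsafe action. -/
structure Agent (n : ℕ) where
  R : Fin n → ℝ
  c : Fin n → ℝ
  κS : ℝ
  κI : ℝ
  α : ℝ

/-- The ranges of the data, as the model prescribes them. -/
structure Agent.Valid {n : ℕ} (a : Agent n) : Prop where
  R_nonneg : ∀ i, 0 ≤ a.R i
  c_nonneg : ∀ i, 0 ≤ a.c i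
  κS_nonneg : 0 ≤ a.κS
  κI_nonneg : 0 ≤ a.κI
  α_pos : 0 < a.α
  α_le_one : a.α ≤ 1

/-- No two actions have the same cost, and a higher cost comes with a higher expected reward;
the actions are listed by increasing cost. -/
def Agent.NoDominated {n : ℕ} (a : Agent n) : Prop :=
  StrictMono a.c ∧ StrictMono a.R

/-- `max_i (R_i - c_i) > κS`. -/
def Agent.SafetyFeasible {n : ℕ} (a : Agent n) : Prop :=
  ∃ i, a.κS < a.R i - a.c i

/-- The agent's expected utility from the action `(i, s)` (`s = true` means safe) under the linear
contract that pays the share `γ` of the reward and inspects with probability `β`. -/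
noncomputable def Agent.agentUtility {n : ℕ} (a : Agent n) (γ β : ℝ) (i : Fin n) : Bool → ℝ
  | true => γ * a.R i - a.c i - a.κS
  | false => (1 - β) * (1 - a.α) * (γ * a.R i) - a.c i

/-- The linear contract `(γ, β)` implements the action `(i, s)`: incentive compatibility and
individual rationality. -/
structure Agent.Implements {n : ℕ} (a : Agent n) (γ β : ℝ) (i : Fin n) (s : Bool) : Prop where
  share_mem : γ ∈ Set.Icc (0 : ℝ) 1
  prob_mem : β ∈ Set.Icc (0 : ℝ) 1
  ic : ∀ (j : Fin n) (s' : Bool), a.agentUtility γ β j s' ≤ a.agentUtility γ β i s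
  ir : 0 ≤ a.agentUtility γ β i s

/-- The principal's expected utility when the agent takes the safe action `(i, 1)` under the
linear contract `(γ, β)`. -/
noncomputable def Agent.principalUtility {n : ℕ} (a : Agent n) (γ β : ℝ) (i : Fin n) : ℝ :=
  a.R i - γ * a.R i - β * a.κI

/-- The least probability of inspection among the linear contracts that implement a safe action. -/
noncomputable def Agent.betaMin {n : ℕ} (a : Agent n) : ℝ :=
  sInf {β : ℝ | ∃ γ i, a.Implements γ β i true}

/-- The largest utility that the principal can obtain from the agent with a linear contract that
implements a safe action and inspects with probability at most `b`. The set is non-empty for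
`a.betaMin ≤ b`, the only values at which the function is used, and bounded above. -/
noncomputable def Agent.bestUtility {n : ℕ} (a : Agent n) (b : ℝ) : ℝ :=
  sSup {u : ℝ | ∃ γ β i, a.Implements γ β i true ∧ β ≤ b ∧ u = a.principalUtility γ β i}

/-- The allocations `b` of the budget `B` that leave a contract to choose for every agent. -/
def Feasible {m n : ℕ} (A : Fin m → Agent n) (B : ℕ) (b : Fin m → ℝ) : Prop :=
  (∀ l, b l ∈ Set.Icc (A l).betaMin 1) ∧ ∑ l, b l ≤ (B : ℝ)

/-- The objective of the budget allocation problem. -/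
noncomputable def total {m n : ℕ} (A : Fin m → Agent n) (b : Fin m → ℝ) : ℝ :=
  ∑ l, (A l).bestUtility (b l)

/-- The optimal value of the budget allocation problem. -/
noncomputable def opt {m n : ℕ} (A : Fin m → Agent n) (B : ℕ) : ℝ :=
  sSup {v : ℝ | ∃ b, Feasible A B b ∧ v = total A b}

/-- `max_l (R_n^l)² / κS^l`. An agent with `κS = 0` needs no inspection and contributes `0`. -/
noncomputable def lipBound {m n : ℕ} (A : Fin m → Agent n) : ℝ :=
  ⨆ l, (⨆ i, (A l).R i) ^ 2 / (A l).κS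

/-! ## The machine model

A real random access machine, programmed in a structured language. It has integer and real
variables and arrays with two integer indices. On integers it can add, subtract (truncated) and
halve; on reals it has the four operations, the square root, comparison, and the conversion of an
integer to a real, but no rounding. Every operation, memory access and comparison costs one. -/

/-- The memory: variables and arrays, each with a number as its name. -/
structure Memory where
  ivar : ℕ → ℕ
  rvar : ℕ → ℝ
  iarr : ℕ → ℕ → ℕ → ℕ
  rarr : ℕ → ℕ → ℕ → ℝ

inductive IExp where
  | lit (k : ℕ)
  | var (x : ℕ)
  | arr (a : ℕ) (i j : IExp)
  | add (e f : IExp)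
  | sub (e f : IExp)
  | half (e : IExp)

def IExp.eval (σ : Memory) : IExp → ℕ
  | .lit k => k
  | .var x => σ.ivar x
  | .arr a i j => σ.iarr a (i.eval σ) (j.eval σ)
  | .add e f => e.eval σ + f.eval σ
  | .sub e f => e.eval σ - f.eval σ
  | .half e => e.eval σ / 2

def IExp.cost : IExp → ℕ
  | .lit _ => 1
  | .var _ => 1
  | .arr _ i j => i.cost + j.cost + 1
  | .add e f => e.cost + f.cost + 1
  | .sub e f => e.cost + f.cost + 1
  | .half e => e.cost + 1

inductive RExp where
  | ofInt (e : IExp)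
  | var (x : ℕ)
  | arr (a : ℕ) (i j : IExp)
  | add (e f : RExp)
  | sub (e f : RExp)
  | mul (e f : RExp)
  | div (e f : RExp)
  | sqrt (e : RExp)

noncomputable def RExp.eval (σ : Memory) : RExp → ℝ
  | .ofInt e => (e.eval σ : ℝ)
  | .var x => σ.rvar x
  | .arr a i j => σ.rarr a (i.eval σ) (j.eval σ)
  | .add e f => e.eval σ + f.eval σ
  | .sub e f => e.eval σ - f.eval σ
  | .mul e f => e.eval σ * f.eval σ
  | .div e f => e.eval σ / f.eval σ
  | .sqrt e => Real.sqrt (e.eval σ)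

def RExp.cost : RExp → ℕ
  | .ofInt e => e.cost + 1
  | .var _ => 1
  | .arr _ i j => i.cost + j.cost + 1
  | .add e f => e.cost + f.cost + 1
  | .sub e f => e.cost + f.cost + 1
  | .mul e f => e.cost + f.cost + 1
  | .div e f => e.cost + f.cost + 1
  | .sqrt e => e.cost + 1

inductive Test where
  | ilt (e f : IExp)
  | rlt (e f : RExp)
  | not (t : Test)
  | and (t u : Test)

def Test.Holds (σ : Memory) : Test → Prop
  | .ilt e f => e.eval σ < f.eval σ
  | .rlt e f => e.eval σ < f.eval σ
  | .not t => ¬ t.Holds σ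
  | .and t u => t.Holds σ ∧ u.Holds σ

def Test.cost : Test → ℕ
  | .ilt e f => e.cost + f.cost + 1
  | .rlt e f => e.cost + f.cost + 1
  | .not t => t.cost + 1
  | .and t u => t.cost + u.cost + 1

inductive Program where
  | skip
  | iset (x : ℕ) (e : IExp)
  | rset (x : ℕ) (e : RExp)
  | istore (a : ℕ) (i j : IExp) (e : IExp)
  | rstore (a : ℕ) (i j : IExp) (e : RExp)
  | seq (p q : Program)
  | cond (t : Test) (p q : Program)
  | loop (t : Test) (p : Program)

def Memory.setI (σ : Memory) (x v : ℕ) : Memory :=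
  { σ with ivar := Function.update σ.ivar x v }

noncomputable def Memory.setR (σ : Memory) (x : ℕ) (v : ℝ) : Memory :=
  { σ with rvar := Function.update σ.rvar x v }

def Memory.storeI (σ : Memory) (a i j v : ℕ) : Memory :=
  { σ with iarr := fun a' i' j' => if a' = a ∧ i' = i ∧ j' = j then v else σ.iarr a' i' j' }

noncomputable def Memory.storeR (σ : Memory) (a i j : ℕ) (v : ℝ) : Memory :=
  { σ with rarr := fun a' i' j' => if a' = a ∧ i' = i ∧ j' = j then v else σ.rarr a' i' j' }

/-- `Exec p σ τ t`: started in memory `σ`, the program `p` halts after `t` steps in memory `τ`. -/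
inductive Exec : Program → Memory → Memory → ℕ → Prop where
  | skip (σ : Memory) : Exec .skip σ σ 1
  | iset (σ : Memory) (x : ℕ) (e : IExp) : Exec (.iset x e) σ (σ.setI x (e.eval σ)) (e.cost + 1)
  | rset (σ : Memory) (x : ℕ) (e : RExp) : Exec (.rset x e) σ (σ.setR x (e.eval σ)) (e.cost + 1)
  | istore (σ : Memory) (a : ℕ) (i j e : IExp) :
      Exec (.istore a i j e) σ (σ.storeI a (i.eval σ) (j.eval σ) (e.eval σ))
        (i.cost + j.cost + e.cost + 1)
  | rstore (σ : Memory) (a : ℕ) (i j : IExp) (e : RExp) :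
      Exec (.rstore a i j e) σ (σ.storeR a (i.eval σ) (j.eval σ) (e.eval σ))
        (i.cost + j.cost + e.cost + 1)
  | seq {p q : Program} {σ τ υ : Memory} {t u : ℕ} (hp : Exec p σ τ t) (hq : Exec q τ υ u) :
      Exec (.seq p q) σ υ (t + u)
  | cond_true {b : Test} {p q : Program} {σ τ : Memory} {t : ℕ} (hb : b.Holds σ)
      (hp : Exec p σ τ t) : Exec (.cond b p q) σ τ (b.cost + t + 1)
  | cond_false {b : Test} {p q : Program} {σ τ : Memory} {t : ℕ} (hb : ¬ b.Holds σ)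
      (hq : Exec q σ τ t) : Exec (.cond b p q) σ τ (b.cost + t + 1)
  | loop_stop {b : Test} {p : Program} {σ : Memory} (hb : ¬ b.Holds σ) :
      Exec (.loop b p) σ σ (b.cost + 1)
  | loop_step {b : Test} {p : Program} {σ τ υ : Memory} {t u : ℕ} (hb : b.Holds σ)
      (hp : Exec p σ τ t) (hl : Exec (.loop b p) τ υ u) :
      Exec (.loop b p) σ υ (b.cost + t + 1 + u)

/-- The machine is deterministic: final memory and running time are functions of the input. -/
theorem Exec.deterministic {p : Program} {σ τ : Memory} {t : ℕ} (h : Exec p σ τ t) :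
    ∀ {τ' : Memory} {t' : ℕ}, Exec p σ τ' t' → τ = τ' ∧ t = t' := by
  induction h with
  | skip | iset | rset | istore | rstore => intro _ _ h'; cases h'; exact ⟨rfl, rfl⟩
  | seq _ _ ih₁ ih₂ =>
    intro _ _ h'
    cases h' with
    | seq hp hq =>
      obtain ⟨rfl, rfl⟩ := ih₁ hp
      obtain ⟨rfl, rfl⟩ := ih₂ hq
      exact ⟨rfl, rfl⟩
  | cond_true hb _ ih =>
    intro _ _ h'
    cases h' with
    | cond_true _ hp => obtain ⟨rfl, rfl⟩ := ih hp; exact ⟨rfl, rfl⟩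
    | cond_false hb' _ => exact absurd hb hb'
  | cond_false hb _ ih =>
    intro _ _ h'
    cases h' with
    | cond_true hb' _ => exact absurd hb' hb
    | cond_false _ hp => obtain ⟨rfl, rfl⟩ := ih hp; exact ⟨rfl, rfl⟩
  | loop_stop hb =>
    intro _ _ h'
    cases h' with
    | loop_stop _ => exact ⟨rfl, rfl⟩
    | loop_step hb' _ _ => exact absurd hb' hb
  | loop_step hb _ _ ih₁ ih₂ =>
    intro _ _ h'
    cases h' with
    | loop_stop hb' => exact absurd hb hb'
    | loop_step _ hp hl =>
      obtain ⟨rfl, rfl⟩ := ih₁ hp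
      obtain ⟨rfl, rfl⟩ := ih₂ hl
      exact ⟨rfl, rfl⟩

/-- The memory that holds the input: the numbers `m`, `n`, `B` in the integer variables 0, 1, 2,
the accuracy `ε` in the real variable 0, the tables `R`, `c` in the real arrays 0, 1, the lists
`κS`, `κI`, `α` in the first columns of the real arrays 2, 3, 4, and zero elsewhere. -/
noncomputable def inputMemory {m n : ℕ} (A : Fin m → Agent n) (B : ℕ) (ε : ℝ) : Memory where
  ivar x := if x = 0 then m else if x = 1 then n else if x = 2 then B else 0
  rvar x := if x = 0 then ε else 0
  iarr _ _ _ := 0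
  rarr a l i :=
    if hl : l < m then
      if a = 0 then (if hi : i < n then (A ⟨l, hl⟩).R ⟨i, hi⟩ else 0)
      else if a = 1 then (if hi : i < n then (A ⟨l, hl⟩).c ⟨i, hi⟩ else 0)
      else if i = 0 then
        if a = 2 then (A ⟨l, hl⟩).κS
        else if a = 3 then (A ⟨l, hl⟩).κI
        else if a = 4 then (A ⟨l, hl⟩).α
        else 0
      else 0
    else 0

/-- On the given input the program `p` halts after at most `T` steps, with the vector `b` in the
first column of the real array 5. -/
def Outputs {m n : ℕ} (p : Program) (A : Fin m → Agent n) (B : ℕ) (ε : ℝ) (b : Fin m → ℝ)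
    (T : ℝ) : Prop :=
  ∃ (τ : Memory) (t : ℕ), Exec p (inputMemory A B ε) τ t ∧ (t : ℝ) ≤ T ∧
    ∀ l : Fin m, τ.rarr 5 l 0 = b l

end Inspection

/-!
The agent's utility from a safe action under the share `γ` is, up to the cost `κS`, a line in `γ`,
and the upper envelope `env` of these lines describes all contracts: `(γ, β)` implements the safe
action `i` if and only if `i` is best at `γ`, `κS ≤ env γ`, and
`env ((1 - β) * (1 - α) * γ) + κS ≤ env γ` (`Agent.implements_iff`). As `env` is convex, a safe
action that is implementable with `β` remains so with the share `1`, which gives an explicit formula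
for `betaMin` (`Agent.Admissible.betaMin_isLeast`).

**Discretization.** Contracts are rounded to shares `j / N` and to inspection probabilities
`betaMin + k / N`. Rounding `β` down makes the unsafe actions more attractive by at most
`topReward / N`. Incentive compatibility forces a gap of at least `κS / topReward` between the
share and the share that an unsafe agent keeps, so by convexity an increase of the agent's share
that costs the principal `O(lip / N)`, `lip = topReward ^ 2 / κS`, restores it
(`Agent.Admissible.exists_grid`). An agent with `κS = 0` needs no inspection and is solved exactly
from the vertices of the envelope (`Agent.Admissible.principalUtility_le_of_hull`).

**The program.** For one agent, the envelope is computed by a stack in time `O(n)` (`HullStack`),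
its values on the grid in time `O(n + N)`, and the best utilities for all `k ≤ N` by two pointers
in time `O(N ^ 2)`; the machine cannot round reals, and the moving pointers compute the required
ceilings. Then a knapsack dynamic program over the agents distributes the at most `B * N` steps of
size `1 / N` that the budget leaves, in time `O(m * B * N ^ 2)`. Rounding every budget down to a
step keeps the sum within the budget, so the result is optimal up to `4 * m * lipBound / N`
(`isSolution_of_bellman`, `runs_solve`).

**Choice of the fineness.** A real cannot be rounded to the fineness that the accuracy requires,
nor is the optimum known that the relative accuracy refers to. Therefore `N` is doubled until the
error bound is at most `ε`, or at most `ε` times the value found. The costs `m * B * N ^ 2` form a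
geometric series. The `O(m * n)` for the envelopes is spent in each of the rounds, of which there
are about `k = log N`; it is covered because `n * k ≤ n * log n + 4 ^ k` (`runs_refine`,
`exists_rounds`).
-/

namespace Inspection

/-! ### Reasoning about programs -/

/-- Whether the program contains an assignment to the integer variable `x`. -/
def Program.writesI : Program → ℕ → Bool
  | .iset y _, x => y == x
  | .seq p q, x => p.writesI x || q.writesI x
  | .cond _ p q, x => p.writesI x || q.writesI x
  | .loop _ p, x => p.writesI x
  | _, _ => false

/-- Whether the program contains an assignment to the real variable `x`. -/
def Program.writesR : Program → ℕ → Bool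
  | .rset y _, x => y == x
  | .seq p q, x => p.writesR x || q.writesR x
  | .cond _ p q, x => p.writesR x || q.writesR x
  | .loop _ p, x => p.writesR x
  | _, _ => false

/-- Whether the program contains an assignment to the integer array `a`. -/
def Program.writesIArr : Program → ℕ → Bool
  | .istore b _ _ _, a => b == a
  | .seq p q, a => p.writesIArr a || q.writesIArr a
  | .cond _ p q, a => p.writesIArr a || q.writesIArr a
  | .loop _ p, a => p.writesIArr a
  | _, _ => false

/-- Whether the program contains an assignment to the real array `a`. -/
def Program.writesRArr : Program → ℕ → Bool
  | .rstore b _ _ _, a => b == a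
  | .seq p q, a => p.writesRArr a || q.writesRArr a
  | .cond _ p q, a => p.writesRArr a || q.writesRArr a
  | .loop _ p, a => p.writesRArr a
  | _, _ => false

/-- The memories agree on every variable and array that the program does not mention on the left
of an assignment. -/
structure Agree (p : Program) (σ τ : Memory) : Prop where
  ivar : ∀ x, p.writesI x = false → τ.ivar x = σ.ivar x
  rvar : ∀ x, p.writesR x = false → τ.rvar x = σ.rvar x
  iarr : ∀ a, p.writesIArr a = false → τ.iarr a = σ.iarr a
  rarr : ∀ a, p.writesRArr a = false → τ.rarr a = σ.rarr a

theorem Agree.refl (p : Program) (σ : Memory) : Agree p σ σ :=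
  ⟨fun _ _ => rfl, fun _ _ => rfl, fun _ _ => rfl, fun _ _ => rfl⟩

theorem Agree.trans {p : Program} {σ τ υ : Memory} (h : Agree p σ τ) (h' : Agree p τ υ) :
    Agree p σ υ :=
  ⟨fun x hx => (h'.ivar x hx).trans (h.ivar x hx), fun x hx => (h'.rvar x hx).trans (h.rvar x hx),
    fun x hx => (h'.iarr x hx).trans (h.iarr x hx), fun x hx => (h'.rarr x hx).trans (h.rarr x hx)⟩

/-- A program changes only what it assigns to: this supplies the frame conditions of all
correctness proofs below. -/
theorem Exec.agree {p : Program} {σ τ : Memory} {t : ℕ} (h : Exec p σ τ t) : Agree p σ τ := by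
  induction h with
  | skip σ => exact Agree.refl _ _
  | iset σ x e =>
    refine ⟨fun y hy => ?_, fun _ _ => rfl, fun _ _ => rfl, fun _ _ => rfl⟩
    have : y ≠ x := by rintro rfl; simp [Program.writesI] at hy
    simp [Memory.setI, this]
  | rset σ x e =>
    refine ⟨fun _ _ => rfl, fun y hy => ?_, fun _ _ => rfl, fun _ _ => rfl⟩
    have : y ≠ x := by rintro rfl; simp [Program.writesR] at hy
    simp [Memory.setR, this]
  | istore σ a i j e =>
    refine ⟨fun _ _ => rfl, fun _ _ => rfl, fun b hb => ?_, fun _ _ => rfl⟩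
    have : b ≠ a := by rintro rfl; simp [Program.writesIArr] at hb
    funext i' j'
    simp [Memory.storeI, this]
  | rstore σ a i j e =>
    refine ⟨fun _ _ => rfl, fun _ _ => rfl, fun _ _ => rfl, fun b hb => ?_⟩
    have : b ≠ a := by rintro rfl; simp [Program.writesRArr] at hb
    funext i' j'
    simp [Memory.storeR, this]
  | @seq p q σ τ υ t u _ _ ih₁ ih₂ =>
    have h₁ : Agree (.seq p q) σ τ :=
      ⟨fun x hx => ih₁.ivar x (by simp_all [Program.writesI]),
        fun x hx => ih₁.rvar x (by simp_all [Program.writesR]),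
        fun x hx => ih₁.iarr x (by simp_all [Program.writesIArr]),
        fun x hx => ih₁.rarr x (by simp_all [Program.writesRArr])⟩
    exact h₁.trans
      ⟨fun x hx => ih₂.ivar x (by simp_all [Program.writesI]),
        fun x hx => ih₂.rvar x (by simp_all [Program.writesR]),
        fun x hx => ih₂.iarr x (by simp_all [Program.writesIArr]),
        fun x hx => ih₂.rarr x (by simp_all [Program.writesRArr])⟩
  | cond_true _ _ ih | cond_false _ _ ih =>
    exact ⟨fun x hx => ih.ivar x (by simp_all [Program.writesI]),
        fun x hx => ih.rvar x (by simp_all [Program.writesR]),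
        fun x hx => ih.iarr x (by simp_all [Program.writesIArr]),
        fun x hx => ih.rarr x (by simp_all [Program.writesRArr])⟩
  | loop_step _ _ _ ih₁ ih₂ =>
    exact Agree.trans ⟨ih₁.ivar, ih₁.rvar, ih₁.iarr, ih₁.rarr⟩ ih₂
  | _ => exact Agree.refl _ _

/-- Total correctness with a time bound: started in `σ`, the program halts after at most `T` steps
in a memory that satisfies `Q`. -/
def Runs (p : Program) (σ : Memory) (T : ℕ) (Q : Memory → Prop) : Prop :=
  ∃ (τ : Memory) (t : ℕ), Exec p σ τ t ∧ t ≤ T ∧ Q τ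

theorem Exec.of_not_holds {b : Test} {p : Program} {σ : Memory} (hb : ¬ b.Holds σ) :
    Exec (.loop b p) σ σ (b.cost + 1) := by
  constructor
  exact hb

theorem Runs.mono {p : Program} {σ : Memory} {T T' : ℕ} {Q Q' : Memory → Prop}
    (h : Runs p σ T Q) (hT : T ≤ T') (hQ : ∀ τ, Agree p σ τ → Q τ → Q' τ) : Runs p σ T' Q' := by
  obtain ⟨τ, t, he, ht, hq⟩ := h
  exact ⟨τ, t, he, ht.trans hT, hQ τ he.agree hq⟩

theorem Runs.seq {p q : Program} {σ : Memory} {T U : ℕ} {Q Q' : Memory → Prop}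
    (hp : Runs p σ T Q) (hq : ∀ τ, Agree p σ τ → Q τ → Runs q τ U Q') :
    Runs (.seq p q) σ (T + U) Q' := by
  obtain ⟨τ, t, he, ht, h⟩ := hp
  obtain ⟨υ, u, he', hu, h'⟩ := hq τ he.agree h
  exact ⟨υ, t + u, .seq he he', by omega, h'⟩

/-- The rule for loops whose iterations all cost at most `c` and decrease the measure `μ`. -/
theorem Runs.loop {b : Test} {p : Program} {σ : Memory} {c : ℕ} (k : ℕ)
    (μ : Memory → ℕ) (I : Memory → Prop) (h₀ : I σ) (hk : μ σ ≤ k)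
    (hs : ∀ τ, Agree p σ τ → I τ → b.Holds τ → Runs p τ c (fun υ => I υ ∧ μ υ < μ τ)) :
    Runs (.loop b p) σ (k * (b.cost + c + 1) + (b.cost + 1))
      (fun υ => I υ ∧ ¬ b.Holds υ) := by
  suffices h : ∀ k τ, μ τ ≤ k → Agree p σ τ → I τ →
      Runs (.loop b p) τ (k * (b.cost + c + 1) + (b.cost + 1)) (fun υ => I υ ∧ ¬ b.Holds υ) from
    h k σ hk (Agree.refl _ _) h₀
  clear hk k
  intro k
  induction k with
  | zero =>
    intro τ hk ha hI
    by_cases hb : b.Holds τ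
    · obtain ⟨υ, t, _, _, _, hlt⟩ := hs τ ha hI hb
      omega
    · exact ⟨τ, _, .of_not_holds hb, by omega, hI, hb⟩
  | succ k ih =>
    intro τ hk ha hI
    by_cases hb : b.Holds τ
    · obtain ⟨υ, t, he, ht, hI', hlt⟩ := hs τ ha hI hb
      obtain ⟨φ, u, he', hu, hφ⟩ := ih υ (by omega) (ha.trans he.agree) hI'
      refine ⟨φ, _, .loop_step hb he he', ?_, hφ⟩
      rw [Nat.succ_mul]
      omega
    · refine ⟨τ, _, .of_not_holds hb, ?_, hI, hb⟩
      exact Nat.le_add_left _ _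

/-- The rule for loops whose iterations have different costs: the invariant is indexed by the
number of iterations, of which there are at most `r`. -/
theorem Runs.loop_indexed {b : Test} {p : Program} {σ : Memory} {r : ℕ} {T : ℕ → ℕ}
    (I : ℕ → Memory → Prop) (h₀ : I 0 σ)
    (hs : ∀ s τ, I s τ → b.Holds τ → s < r ∧ Runs p τ (T s) (I (s + 1))) :
    Runs (.loop b p) σ ((∑ s ∈ Finset.range r, (b.cost + T s + 1)) + (b.cost + 1))
      (fun υ => (∃ s, I s υ) ∧ ¬ b.Holds υ) := by
  suffices h : ∀ k s τ, s + k = r → I s τ →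
      Runs (.loop b p) τ ((∑ i ∈ Finset.range k, (b.cost + T (s + i) + 1)) + (b.cost + 1))
        (fun υ => (∃ s, I s υ) ∧ ¬ b.Holds υ) by
    simpa using h r 0 σ (by omega) h₀
  intro k
  induction k with
  | zero =>
    intro s τ hk hI
    by_cases hb : b.Holds τ
    · have := (hs s τ hI hb).1
      omega
    · exact ⟨τ, _, .of_not_holds hb, by simp, ⟨s, hI⟩, hb⟩
  | succ k ih =>
    intro s τ hk hI
    by_cases hb : b.Holds τ
    · obtain ⟨υ, t, he, ht, hI'⟩ := (hs s τ hI hb).2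
      obtain ⟨φ, u, he', hu, hφ⟩ := ih (s + 1) υ (by omega) hI'
      refine ⟨φ, _, .loop_step hb he he', ?_, hφ⟩
      rw [Finset.sum_range_succ']
      simp only [add_zero, add_assoc, add_comm 1] at hu ⊢
      omega
    · exact ⟨τ, _, .of_not_holds hb, Nat.le_add_left _ _, ⟨s, hI⟩, hb⟩

/-- The weakest precondition of a program without loops. -/
def Program.wp : Program → (Memory → Prop) → Memory → Prop
  | .skip, Q, σ => Q σ
  | .iset x e, Q, σ => Q (σ.setI x (e.eval σ))
  | .rset x e, Q, σ => Q (σ.setR x (e.eval σ))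
  | .istore a i j e, Q, σ => Q (σ.storeI a (i.eval σ) (j.eval σ) (e.eval σ))
  | .rstore a i j e, Q, σ => Q (σ.storeR a (i.eval σ) (j.eval σ) (e.eval σ))
  | .seq p q, Q, σ => p.wp (q.wp Q) σ
  | .cond b p q, Q, σ => (b.Holds σ → p.wp Q σ) ∧ (¬ b.Holds σ → q.wp Q σ)
  | .loop _ _, _, _ => False

/-- An upper bound on the running time of a program without loops. -/
def Program.maxCost : Program → ℕ
  | .skip => 1
  | .iset _ e => e.cost + 1
  | .rset _ e => e.cost + 1
  | .istore _ i j e => i.cost + j.cost + e.cost + 1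
  | .rstore _ i j e => i.cost + j.cost + e.cost + 1
  | .seq p q => p.maxCost + q.maxCost
  | .cond b p q => b.cost + max p.maxCost q.maxCost + 1
  | .loop _ _ => 0

theorem Runs.of_wp {p : Program} {Q : Memory → Prop} {σ : Memory} (h : p.wp Q σ) :
    Runs p σ p.maxCost Q := by
  induction p generalizing Q σ with
  | skip => exact ⟨_, _, .skip σ, le_rfl, h⟩
  | iset x e => exact ⟨_, _, .iset σ x e, le_rfl, h⟩
  | rset x e => exact ⟨_, _, .rset σ x e, le_rfl, h⟩
  | istore a i j e => exact ⟨_, _, .istore σ a i j e, le_rfl, h⟩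
  | rstore a i j e => exact ⟨_, _, .rstore σ a i j e, le_rfl, h⟩
  | seq p q ihp ihq => exact (ihp h).seq fun τ _ hτ => ihq hτ
  | cond b p q ihp ihq =>
    by_cases hb : b.Holds σ
    · obtain ⟨τ, t, he, ht, hQ⟩ := ihp (h.1 hb)
      exact ⟨τ, _, .cond_true hb he, by simp only [Program.maxCost]; omega, hQ⟩
    · obtain ⟨τ, t, he, ht, hQ⟩ := ihq (h.2 hb)
      exact ⟨τ, _, .cond_false hb he, by simp only [Program.maxCost]; omega, hQ⟩
  | loop b p _ => exact h.elim

/-- The rule for an initialization followed by a loop. -/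
theorem Runs.init_loop {init body : Program} {b : Test} {σ : Memory} {c : ℕ} {Q : Memory → Prop}
    (k : ℕ) (μ : Memory → ℕ) (I : Memory → Prop)
    (h₀ : init.wp (fun τ => I τ ∧ μ τ ≤ k) σ)
    (hs : ∀ τ, Agree (.seq init (.loop b body)) σ τ → I τ → b.Holds τ →
      Runs body τ c (fun υ => I υ ∧ μ υ < μ τ))
    (hQ : ∀ τ, Agree (.seq init (.loop b body)) σ τ → I τ → ¬ b.Holds τ → Q τ) :
    Runs (.seq init (.loop b body)) σ
      (init.maxCost + (k * (b.cost + c + 1) + (b.cost + 1))) Q := by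
  have hA : ∀ {τ υ}, Agree init σ τ → Agree (.loop b body) τ υ →
      Agree (.seq init (.loop b body)) σ υ := fun h h' =>
    ⟨fun x hx => by
        simp only [Program.writesI, Bool.or_eq_false_iff] at hx
        rw [h'.ivar x hx.2, h.ivar x hx.1],
      fun x hx => by
        simp only [Program.writesR, Bool.or_eq_false_iff] at hx
        rw [h'.rvar x hx.2, h.rvar x hx.1],
      fun x hx => by
        simp only [Program.writesIArr, Bool.or_eq_false_iff] at hx
        rw [h'.iarr x hx.2, h.iarr x hx.1],
      fun x hx => by
        simp only [Program.writesRArr, Bool.or_eq_false_iff] at hx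
        rw [h'.rarr x hx.2, h.rarr x hx.1]⟩
  refine Runs.mono (Runs.seq (Runs.of_wp h₀) fun τ hτ h => Runs.loop (c := c) k μ I h.1 h.2
    fun υ hυ => hs υ (hA hτ ⟨hυ.ivar, hυ.rvar, hυ.iarr, hυ.rarr⟩)) le_rfl
    fun τ hτ h => hQ τ hτ h.1 h.2

section Cells

variable (σ : Memory) (x y a a' i j i' j' v : ℕ) (r : ℝ)

@[simp] theorem setI_ivar : (σ.setI x v).ivar y = if y = x then v else σ.ivar y := by
  simp [Memory.setI, Function.update_apply]

@[simp] theorem setI_rvar : (σ.setI x v).rvar = σ.rvar := rfl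

@[simp] theorem setI_iarr : (σ.setI x v).iarr = σ.iarr := rfl

@[simp] theorem setI_rarr : (σ.setI x v).rarr = σ.rarr := rfl

@[simp] theorem setR_rvar : (σ.setR x r).rvar y = if y = x then r else σ.rvar y := by
  simp [Memory.setR, Function.update_apply]

@[simp] theorem setR_ivar : (σ.setR x r).ivar = σ.ivar := rfl

@[simp] theorem setR_iarr : (σ.setR x r).iarr = σ.iarr := rfl

@[simp] theorem setR_rarr : (σ.setR x r).rarr = σ.rarr := rfl

@[simp] theorem storeI_iarr : (σ.storeI a i j v).iarr a' i' j' =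
    if a' = a ∧ i' = i ∧ j' = j then v else σ.iarr a' i' j' := rfl

@[simp] theorem storeI_ivar : (σ.storeI a i j v).ivar = σ.ivar := rfl

@[simp] theorem storeI_rvar : (σ.storeI a i j v).rvar = σ.rvar := rfl

@[simp] theorem storeI_rarr : (σ.storeI a i j v).rarr = σ.rarr := rfl

@[simp] theorem storeR_rarr : (σ.storeR a i j r).rarr a' i' j' =
    if a' = a ∧ i' = i ∧ j' = j then r else σ.rarr a' i' j' := rfl

@[simp] theorem storeR_ivar : (σ.storeR a i j r).ivar = σ.ivar := rfl

@[simp] theorem storeR_rvar : (σ.storeR a i j r).rvar = σ.rvar := rfl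

@[simp] theorem storeR_iarr : (σ.storeR a i j r).iarr = σ.iarr := rfl

end Cells

attribute [simp] IExp.eval RExp.eval Test.Holds Program.wp

/-! ### The upper envelope of the agent's actions -/

/-- The three standing assumptions on an agent. -/
structure Agent.Admissible {n : ℕ} (a : Agent n) : Prop extends a.Valid where
  noDominated : a.NoDominated
  safetyFeasible : a.SafetyFeasible

/-- The utility from the safe action `i`, up to `κS`, when the agent keeps the share `y`. -/
def Agent.line {n : ℕ} (a : Agent n) (y : ℝ) (i : Fin n) : ℝ := y * a.R i - a.c i

/-- The upper envelope of the lines. -/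
noncomputable def Agent.env {n : ℕ} (a : Agent n) (y : ℝ) : ℝ := ⨆ i, a.line y i

/-- The line of the action `i` attains the envelope at `y`. -/
def Agent.IsBest {n : ℕ} (a : Agent n) (y : ℝ) (i : Fin n) : Prop := ∀ j, a.line y j ≤ a.line y i

/-- The largest expected reward. -/
noncomputable def Agent.topReward {n : ℕ} (a : Agent n) : ℝ := ⨆ i, a.R i

/-- The Lipschitz constant of the principal's optimal utility in the probability of inspection. -/
noncomputable def Agent.lip {n : ℕ} (a : Agent n) : ℝ := a.topReward ^ 2 / a.κS

namespace Agent

variable {n : ℕ} {a : Agent n}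

theorem line_le_env (a : Agent n) (y : ℝ) (i : Fin n) : a.line y i ≤ a.env y :=
  le_ciSup (Set.finite_range _).bddAbove i

theorem IsBest.env_eq {y : ℝ} {i : Fin n} (h : a.IsBest y i) : a.env y = a.line y i :=
  have : Nonempty (Fin n) := ⟨i⟩
  le_antisymm (ciSup_le h) (a.line_le_env y i)

theorem exists_isBest [Nonempty (Fin n)] (a : Agent n) (y : ℝ) : ∃ i, a.IsBest y i :=
  Finite.exists_max (a.line y)

theorem R_le_topReward (a : Agent n) (i : Fin n) : a.R i ≤ a.topReward :=
  le_ciSup (Set.finite_range _).bddAbove i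

/-- The slope of a best line is a subgradient of the envelope. -/
theorem IsBest.env_ge {x : ℝ} {i : Fin n} (h : a.IsBest x i) (y : ℝ) :
    a.env x + (y - x) * a.R i ≤ a.env y := by
  have h₁ := h.env_eq
  have h₂ := a.line_le_env y i
  simp only [line] at h₁ h₂
  linarith

theorem IsBest.R_le {x y : ℝ} {i j : Fin n} (hi : a.IsBest x i) (hj : a.IsBest y j)
    (hxy : x < y) : a.R i ≤ a.R j := by
  have h₁ := hi j
  have h₂ := hj i
  simp only [line] at h₁ h₂
  by_contra! h
  nlinarith [mul_pos (sub_pos.2 hxy) (sub_pos.2 h)]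

theorem Admissible.nonempty (h : a.Admissible) : Nonempty (Fin n) := ⟨h.safetyFeasible.choose⟩

theorem Admissible.κS_lt_topReward (h : a.Admissible) : a.κS < a.topReward := by
  obtain ⟨i, hi⟩ := h.safetyFeasible
  linarith [h.c_nonneg i, a.R_le_topReward i]

theorem Admissible.topReward_pos (h : a.Admissible) : 0 < a.topReward :=
  h.κS_nonneg.trans_lt h.κS_lt_topReward

theorem Admissible.κS_lt_env_one (h : a.Admissible) : a.κS < a.env 1 := by
  obtain ⟨i, hi⟩ := h.safetyFeasible
  have := a.line_le_env 1 i
  simp only [line] at this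
  linarith

theorem Admissible.env_mono (h : a.Admissible) : Monotone a.env := by
  intro x y hxy
  have := h.nonempty
  obtain ⟨i, hi⟩ := a.exists_isBest x
  have := hi.env_ge y
  nlinarith [mul_nonneg (sub_nonneg.2 hxy) (h.R_nonneg i)]

theorem Admissible.env_sub_le (h : a.Admissible) {x y : ℝ} (hxy : x ≤ y) :
    a.env y - a.env x ≤ a.topReward * (y - x) := by
  have := h.nonempty
  obtain ⟨i, hi⟩ := a.exists_isBest y
  have := hi.env_ge x
  nlinarith [mul_le_mul_of_nonneg_left (a.R_le_topReward i) (sub_nonneg.2 hxy)]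

/-- Convexity of the envelope: increments over intervals of equal length grow to the right. -/
theorem env_increment_mono [Nonempty (Fin n)] (a : Agent n) {x y d : ℝ} (hxy : x ≤ y)
    (hd : 0 ≤ d) : a.env (x + d) - a.env x ≤ a.env (y + d) - a.env y := by
  obtain ⟨i, hi⟩ := a.exists_isBest (x + d)
  obtain ⟨j, hj⟩ := a.exists_isBest y
  rw [hi.env_eq, hj.env_eq]
  rcases le_total (a.R i) (a.R j) with h | h
  · have h₁ := a.line_le_env x i
    have h₂ := a.line_le_env (y + d) j
    simp only [line] at *
    nlinarith
  · have h₁ := a.line_le_env x j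
    have h₂ := a.line_le_env (y + d) i
    simp only [line] at *
    nlinarith [mul_le_mul_of_nonneg_left h (sub_nonneg.2 hxy)]

/-! ### Implementable safe actions -/

/-- The share that an unsafe agent keeps in expectation. -/
def unsafeShare (a : Agent n) (γ β : ℝ) : ℝ := (1 - β) * (1 - a.α) * γ

theorem implements_iff {γ β : ℝ} {i : Fin n} :
    a.Implements γ β i true ↔ γ ∈ Set.Icc (0 : ℝ) 1 ∧ β ∈ Set.Icc (0 : ℝ) 1 ∧ a.IsBest γ i ∧
      a.env (a.unsafeShare γ β) + a.κS ≤ a.env γ ∧ a.κS ≤ a.env γ := by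
  have : Nonempty (Fin n) := ⟨i⟩
  constructor
  · rintro ⟨h₁, h₂, h₃, h₄⟩
    have hb : a.IsBest γ i := fun j => by
      have := h₃ j true
      simp only [agentUtility, line] at *
      linarith
    simp only [agentUtility] at h₄
    refine ⟨h₁, h₂, hb, ?_, ?_⟩
    · obtain ⟨j, hj⟩ := a.exists_isBest (a.unsafeShare γ β)
      have := h₃ j false
      rw [hj.env_eq, hb.env_eq]
      simp only [agentUtility, line, unsafeShare] at *
      linarith
    · rw [hb.env_eq]
      simp only [line]
      linarith
  · rintro ⟨h₁, h₂, h₃, h₄, h₅⟩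
    rw [h₃.env_eq] at h₄ h₅
    refine ⟨h₁, h₂, ?_, ?_⟩
    · rintro j (_ | _)
      · have := a.line_le_env (a.unsafeShare γ β) j
        simp only [agentUtility, line, unsafeShare] at *
        linarith
      · have := h₃ j
        simp only [agentUtility, line] at *
        linarith
    · simp only [agentUtility, line] at *
      linarith

theorem Admissible.unsafeFactor_mem (h : a.Admissible) {β : ℝ} (hβ : β ∈ Set.Icc (0 : ℝ) 1) :
    (1 - β) * (1 - a.α) ∈ Set.Icc (0 : ℝ) 1 := by
  have h₁ := h.α_pos
  have h₂ := h.α_le_one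
  obtain ⟨h₃, h₄⟩ := hβ
  exact ⟨mul_nonneg (by linarith) (by linarith), mul_le_one₀ (by linarith) (by linarith)
    (by linarith)⟩

/-- Safe actions stay implementable when the whole reward is paid to the agent. -/
theorem Admissible.implements_one (h : a.Admissible) {γ β : ℝ} {i j : Fin n}
    (hi : a.Implements γ β i true) (hj : a.IsBest 1 j) : a.Implements 1 β j true := by
  have := h.nonempty
  obtain ⟨⟨h₁, h₂⟩, h₃, -, h₅, -⟩ := implements_iff.1 hi
  obtain ⟨ht₀, ht₁⟩ := h.unsafeFactor_mem h₃
  refine implements_iff.2 ⟨by simp, h₃, hj, ?_, h.κS_lt_env_one.le⟩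
  simp only [unsafeShare] at *
  generalize (1 - β) * (1 - a.α) = t at *
  have hx : t * γ ≤ 1 - t * (1 - γ) := by linarith
  have h₆ := a.env_increment_mono hx (mul_nonneg ht₀ (sub_nonneg.2 h₂))
  have h₇ : a.env γ ≤ a.env (1 - t * (1 - γ)) := h.env_mono (by nlinarith)
  rw [show t * γ + t * (1 - γ) = t * 1 by ring, sub_add_cancel] at h₆
  linarith

/-- The characterization of `betaMin` by the actions `j` that bind when the whole reward is paid
to the agent. -/
theorem Admissible.betaMin_isLeast (h : a.Admissible) {β : ℝ} (hβ : β ∈ Set.Icc (0 : ℝ) 1)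
    (hle : ∀ j, (1 - β) * ((1 - a.α) * a.R j) ≤ a.env 1 - a.κS + a.c j)
    (heq : β = 0 ∨ ∃ j, 0 < (1 - a.α) * a.R j ∧
      a.env 1 - a.κS + a.c j ≤ (1 - β) * ((1 - a.α) * a.R j)) :
    IsLeast {β : ℝ | ∃ γ i, a.Implements γ β i true} β := by
  have := h.nonempty
  obtain ⟨i, hi⟩ := a.exists_isBest 1
  refine ⟨⟨1, i, implements_iff.2 ⟨by simp, hβ, hi, ?_, h.κS_lt_env_one.le⟩⟩, ?_⟩
  · have : a.env (a.unsafeShare 1 β) ≤ a.env 1 - a.κS := ciSup_le fun j => by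
      have := hle j
      simp only [line, unsafeShare]
      linarith
    linarith
  · rintro β' ⟨γ, k, hk⟩
    rcases heq with rfl | ⟨j, hj₀, hj⟩
    · exact hk.prob_mem.1
    · have h₁ := (implements_iff.1 (h.implements_one hk hi)).2.2.2.1
      have h₂ := a.line_le_env (a.unsafeShare 1 β') j
      simp only [line, unsafeShare] at h₁ h₂
      by_contra! hlt
      nlinarith [mul_pos (sub_pos.2 hlt) hj₀]

theorem principalUtility_le_topReward {γ β : ℝ} {i : Fin n} (h : a.Admissible)
    (hi : a.Implements γ β i true) : a.principalUtility γ β i ≤ a.topReward - β * a.κI := by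
  have h₁ := a.R_le_topReward i
  have h₂ := mul_nonneg hi.share_mem.1 (h.R_nonneg i)
  simp only [principalUtility]
  linarith

theorem Admissible.le_bestUtility (h : a.Admissible) {γ β b : ℝ} {i : Fin n}
    (hi : a.Implements γ β i true) (hb : β ≤ b) : a.principalUtility γ β i ≤ a.bestUtility b := by
  refine le_csSup ⟨a.topReward, ?_⟩ ⟨γ, β, i, hi, hb, rfl⟩
  rintro _ ⟨γ', β', j, hj, -, rfl⟩
  have := principalUtility_le_topReward h hj
  have := mul_nonneg hj.prob_mem.1 h.κI_nonneg
  linarith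

theorem Admissible.implements_mono (h : a.Admissible) {γ β β' : ℝ} {i : Fin n}
    (hi : a.Implements γ β i true) (hβ : β ≤ β') (h1 : β' ≤ 1) : a.Implements γ β' i true := by
  obtain ⟨h₁, h₂, h₃, h₄, h₅⟩ := implements_iff.1 hi
  refine implements_iff.2 ⟨h₁, ⟨h₂.1.trans hβ, h1⟩, h₃, ?_, h₅⟩
  have := h.α_le_one
  have : a.unsafeShare γ β' ≤ a.unsafeShare γ β :=
    mul_le_mul_of_nonneg_right (mul_le_mul_of_nonneg_right (by linarith) (by linarith)) h₁.1
  linarith [h.env_mono this]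

/-- The infimum in the definition of `betaMin` is attained. -/
theorem Admissible.betaMin_spec (h : a.Admissible) :
    IsLeast {β : ℝ | ∃ γ i, a.Implements γ β i true} a.betaMin := by
  have := h.nonempty
  -- The least `β` is the largest of `0` and the thresholds of the actions that can bind.
  let g : Fin n → ℝ := fun j =>
    if a.env 1 - a.κS + a.c j < (1 - a.α) * a.R j
      then 1 - (a.env 1 - a.κS + a.c j) / ((1 - a.α) * a.R j) else 0
  obtain ⟨i, hi⟩ := Finite.exists_max g
  have hD : ∀ j, 0 < a.env 1 - a.κS + a.c j := fun j => by
    linarith [h.κS_lt_env_one, h.c_nonneg j]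
  have hg0 : ∀ j, g j ∈ Set.Icc (0 : ℝ) 1 := fun j => by
    simp only [g]
    split_ifs with hj
    · have := (div_le_one ((hD j).trans hj)).2 hj.le
      have := div_pos (hD j) ((hD j).trans hj)
      constructor <;> linarith
    · simp
  have hl : IsLeast {β : ℝ | ∃ γ i, a.Implements γ β i true} (g i) := by
    refine h.betaMin_isLeast (hg0 i) (fun j => ?_) ?_
    · by_cases hj : a.env 1 - a.κS + a.c j < (1 - a.α) * a.R j
      · have h₁ := hi j
        have h₂ : (1 - g j) * ((1 - a.α) * a.R j) = a.env 1 - a.κS + a.c j := by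
          simp only [g, if_pos hj]
          rw [sub_sub_cancel, div_mul_cancel₀ _ ((hD j).trans hj).ne']
        have h₃ := (hD j).trans hj
        nlinarith
      · have h₁ := (hg0 i).1
        have h₂ := mul_nonneg (sub_nonneg.2 h.α_le_one) (h.R_nonneg j)
        nlinarith
    · by_cases hj : a.env 1 - a.κS + a.c i < (1 - a.α) * a.R i
      · refine .inr ⟨i, (hD i).trans hj, le_of_eq ?_⟩
        simp only [g, if_pos hj]
        have := ((hD i).trans hj).ne'
        rw [sub_sub_cancel, div_mul_cancel₀ _ this]
      · exact .inl (by simp only [g, if_neg hj])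
  rwa [betaMin, hl.csInf_eq]

theorem Admissible.betaMin_mem (h : a.Admissible) : a.betaMin ∈ Set.Icc (0 : ℝ) 1 := by
  obtain ⟨γ, i, hi⟩ := h.betaMin_spec.1
  exact hi.prob_mem

theorem Admissible.implements_of_betaMin_le (h : a.Admissible) {b : ℝ}
    (hb : b ∈ Set.Icc a.betaMin 1) {i : Fin n} (hi : a.IsBest 1 i) : a.Implements 1 b i true := by
  obtain ⟨γ, j, hj⟩ := h.betaMin_spec.1
  exact h.implements_mono (h.implements_one hj hi) hb.1 hb.2

/-- Paying the whole reward to the agent costs the principal only the inspections. -/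
theorem Admissible.neg_le_bestUtility (h : a.Admissible) {b : ℝ} (hb : b ∈ Set.Icc a.betaMin 1) :
    -(b * a.κI) ≤ a.bestUtility b := by
  have := h.nonempty
  obtain ⟨i, hi⟩ := a.exists_isBest 1
  have := h.le_bestUtility (h.implements_of_betaMin_le hb hi) le_rfl
  simp only [principalUtility] at this
  linarith

/-! ### Discretization -/

/-- The `k`-th probability of inspection in the grid of mesh `1 / N` above `betaMin`. -/
noncomputable def gridProb (a : Agent n) (N k : ℕ) : ℝ := min 1 (a.betaMin + k / N)

theorem Admissible.gridProb_mem (h : a.Admissible) (N k : ℕ) :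
    a.gridProb N k ∈ Set.Icc a.betaMin 1 :=
  ⟨le_min h.betaMin_mem.2 (le_add_of_nonneg_right (by positivity)), min_le_left _ _⟩

/-- The number of the least grid point `q / N` above the share that an unsafe agent keeps under
the contract with the share `j / N` and the `k`-th probability of inspection. -/
noncomputable def ceilShare (a : Agent n) (N k j : ℕ) : ℕ :=
  ⌈(1 - a.gridProb N k) * (1 - a.α) * j⌉₊

/-- A sufficient condition, in terms of the values of the envelope at the points `j / N`, for the
grid contract to implement a safe action. -/
def GridFeasible (a : Agent n) (N k j : ℕ) : Prop :=
  a.env ((a.ceilShare N k j : ℕ) / (N : ℝ)) + a.κS ≤ a.env (j / (N : ℝ)) ∧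
    a.κS ≤ a.env (j / (N : ℝ))

theorem GridFeasible.le_bestUtility (h : a.Admissible) {N k j : ℕ} (hj : j ≤ N)
    (hf : a.GridFeasible N k j) {i : Fin n} (hi : a.IsBest (j / (N : ℝ)) i) :
    (1 - j / N) * a.R i - a.gridProb N k * a.κI ≤ a.bestUtility (a.gridProb N k) := by
  have hb := h.gridProb_mem N k
  have hN : (j : ℝ) ≤ N := by exact_mod_cast hj
  have hb' : a.gridProb N k ∈ Set.Icc (0 : ℝ) 1 := ⟨h.betaMin_mem.1.trans hb.1, hb.2⟩
  have hq : a.unsafeShare (j / N) (a.gridProb N k) ≤ (a.ceilShare N k j : ℕ) / (N : ℝ) := by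
    rw [unsafeShare, ← mul_div_assoc]
    exact div_le_div_of_nonneg_right (Nat.le_ceil _) (Nat.cast_nonneg _)
  have hi' : a.Implements (j / N) (a.gridProb N k) i true :=
    implements_iff.2 ⟨⟨by positivity, div_le_one_of_le₀ hN (Nat.cast_nonneg _)⟩, hb', hi,
      by linarith [h.env_mono hq, hf.1], hf.2⟩
  have := h.le_bestUtility hi' le_rfl
  simp only [principalUtility] at this
  linarith

/-- The error of the discretization for one agent. For `N = 0` the grid consists of `betaMin` alone,
and `max N 1` bounds the error of that. -/
noncomputable def gridError (a : Agent n) (N : ℕ) : ℝ := 4 * a.lip / (max N 1 : ℕ)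

/-- The effect of raising the agent's share from `γ` to `x` when the unsafe agent keeps the fraction
`t` of it rather than `s`, rounded up by at most `δ`: if `δ` is small, then a gain of
`3 * lip * δ` for the safe agent preserves incentive compatibility. -/
theorem Admissible.env_add_le (h : a.Admissible) (hκ : 0 < a.κS) {γ x s t δ : ℝ} {i : Fin n}
    (hγ0 : 0 ≤ γ) (hγ1 : γ ≤ 1) (hxγ : γ ≤ x) (hbest : a.IsBest γ i) (hs1 : s ≤ 1) (ht0 : 0 ≤ t)
    (ht1 : t ≤ 1) (hst : s ≤ t) (hts : t - s ≤ δ) (hδ : 0 < δ)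
    (hic : a.env (s * γ) + a.κS ≤ a.env γ) (hfine : 4 * δ * a.topReward ≤ a.κS)
    (hgain : 3 * (a.lip * δ) ≤ (x - γ) * a.R i) :
    a.env (t * x + δ) + a.κS ≤ a.env x := by
  have hne := h.nonempty
  have hr := h.topReward_pos
  have hl : a.lip * a.κS = a.topReward ^ 2 := div_mul_cancel₀ _ hκ.ne'
  have hlip : 0 ≤ a.lip := div_nonneg (sq_nonneg _) hκ.le
  have hgap : a.κS ≤ a.topReward * ((1 - s) * γ) := by
    have h₁ := h.env_sub_le (x := s * γ) (y := γ) (mul_le_of_le_one_left hγ0 hs1)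
    linarith
  have hgap' : 4 * δ ≤ (1 - s) * γ := by
    refine le_of_mul_le_mul_left ?_ hr
    linarith
  have htγ : t * γ ≤ s * γ + δ := by
    have : (t - s) * γ ≤ δ * 1 := mul_le_mul hts hγ1 hγ0 hδ.le
    linarith
  have h₁ : a.env (t * γ + δ) - a.env (s * γ) ≤ a.topReward * (2 * δ) := by
    have h₂ : s * γ ≤ t * γ := mul_le_mul_of_nonneg_right hst hγ0
    exact (h.env_sub_le (x := s * γ) (y := t * γ + δ) (by linarith)).trans
      (mul_le_mul_of_nonneg_left (by linarith) hr.le)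
  have hd : 0 ≤ t * (x - γ) := mul_nonneg ht0 (by linarith)
  have hd' : 0 ≤ (1 - t) * (x - γ) := mul_nonneg (by linarith) (by linarith)
  have h₂ := a.env_increment_mono (x := t * γ + δ) (y := x - t * (x - γ)) (d := t * (x - γ))
    (by linarith) hd
  rw [sub_add_cancel, show t * γ + δ + t * (x - γ) = t * x + δ by ring] at h₂
  have h₃ := hbest.env_ge (x - t * (x - γ))
  -- The safe agent gains at least `2 * topReward * δ` on the unsafe one.
  have h₄ : a.topReward * (2 * δ) ≤ (x - t * (x - γ) - γ) * a.R i := by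
    have hg : 3 / 4 * a.κS ≤ a.topReward * (1 - t) := by
      have h₅ : (1 - t) * γ ≤ 1 - t := mul_le_of_le_one_right (by linarith) hγ1
      have h₆ : a.topReward * ((1 - s) * γ - δ) ≤ a.topReward * (1 - t) :=
        mul_le_mul_of_nonneg_left (by linarith) hr.le
      linarith
    have h₅ : (1 - t) * (3 * (a.lip * δ)) ≤ (x - t * (x - γ) - γ) * a.R i := by
      have := mul_le_mul_of_nonneg_left hgain (sub_nonneg.2 ht1)
      linarith
    refine le_trans ?_ h₅
    have h₆ : 3 / 4 * a.κS * (3 * (a.lip * δ)) ≤ a.topReward * (1 - t) * (3 * (a.lip * δ)) :=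
      mul_le_mul_of_nonneg_right hg (by positivity)
    have h₇ : 3 / 4 * a.κS * (3 * (a.lip * δ)) = a.topReward * (9 / 4 * (δ * a.topReward)) := by
      linear_combination (9 / 4 * δ) * hl
    have h₈ : 9 / 4 * (δ * a.topReward) ≤ (1 - t) * (3 * (a.lip * δ)) :=
      le_of_mul_le_mul_left (by linarith) hr
    linarith [mul_pos hδ hr]
  linarith

/-- Every contract is approximated by a contract of the grid with no larger probability of
inspection. Rounding the probability down to the grid makes the unsafe actions more attractive by
at most `topReward / N`, and rounding the share of the unsafe agent up by as much again; raising
the share of the agent by `O(topReward / (κS * N))` makes up for it, because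
the gap between the share of the safe and of the unsafe agent is at least `κS / topReward`. -/
theorem Admissible.exists_grid (h : a.Admissible) (hκ : 0 < a.κS) (N : ℕ) {γ β : ℝ} {i : Fin n}
    (hi : a.Implements γ β i true) :
    ∃ k ≤ N, a.betaMin + k / N ≤ β ∧
      (a.principalUtility γ β i - a.gridError N ≤ -(a.gridProb N k * a.κI) ∨
        ∃ j ≤ N, a.GridFeasible N k j ∧ ∀ i', a.IsBest (j / (N : ℝ)) i' →
          a.principalUtility γ β i - a.gridError N
            ≤ (1 - j / N) * a.R i' - a.gridProb N k * a.κI) := by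
  have hne := h.nonempty
  have hβ : a.betaMin ≤ β := h.betaMin_spec.2 ⟨γ, i, hi⟩
  have hr := h.topReward_pos
  have hU := principalUtility_le_topReward h hi
  have hlip : a.topReward ≤ a.lip := by
    rw [lip, le_div_iff₀ hκ, sq]
    exact mul_le_mul_of_nonneg_left h.κS_lt_topReward.le hr.le
  rcases Nat.eq_zero_or_pos N with rfl | hN
  · refine ⟨0, le_rfl, by simpa using hβ, .inl ?_⟩
    have : a.gridProb 0 0 = a.betaMin := by simp [gridProb, h.betaMin_mem.2]
    rw [this]
    have := mul_le_mul_of_nonneg_right hβ h.κI_nonneg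
    simp only [gridError]
    norm_num
    linarith
  have hN' : (0 : ℝ) < N := by exact_mod_cast hN
  have hN1 : (1 : ℝ) ≤ N := by exact_mod_cast hN
  obtain ⟨⟨hγ0, hγ1⟩, ⟨hβ0, hβ1⟩, hbest, hic, hir⟩ := implements_iff.1 hi
  set k := ⌊(β - a.betaMin) * N⌋₊ with hk
  have hk1 : (k : ℝ) ≤ (β - a.betaMin) * N :=
    Nat.floor_le (mul_nonneg (sub_nonneg.2 hβ) hN'.le)
  have hk2 : (β - a.betaMin) * N < k + 1 := Nat.lt_floor_add_one _
  have hkN : k ≤ N := by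
    have : (k : ℝ) ≤ N := hk1.trans (mul_le_of_le_one_left hN'.le (by linarith [h.betaMin_mem.1]))
    exact_mod_cast this
  have hkβ : a.betaMin + k / N ≤ β := by
    have := (div_le_iff₀ hN').2 hk1
    linarith
  have hb : a.gridProb N k = a.betaMin + k / N := min_eq_right (hkβ.trans hβ1)
  have hbβ : β - a.gridProb N k ≤ 1 / N := by
    rw [hb, le_div_iff₀ hN', sub_mul, add_mul, div_mul_cancel₀ _ hN'.ne']
    linarith
  refine ⟨k, hkN, hkβ, ?_⟩
  have herr : a.gridError N = 4 * (a.lip / N) := by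
    simp only [gridError, max_eq_left (show 1 ≤ N from hN)]
    ring
  rw [herr]
  rw [← hb] at hkβ
  set b := a.gridProb N k with hbdef
  have hbκ := mul_le_mul_of_nonneg_right hkβ h.κI_nonneg
  have hlipN : a.topReward / N ≤ a.lip / N := div_le_div_of_nonneg_right hlip hN'.le
  -- If the mesh is too coarse, then the error bound exceeds every possible gain.
  by_cases hcoarse : N * a.κS < 4 * a.topReward
  · left
    have : a.topReward ≤ 4 * (a.lip / N) := by
      rw [lip, div_div, ← mul_div_assoc, le_div_iff₀ (by positivity)]
      nlinarith
    linarith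
  have hRi := h.R_nonneg i
  have hU' : a.principalUtility γ β i ≤ (1 - γ) * a.R i - b * a.κI := by
    simp only [principalUtility]
    linarith
  rcases hRi.eq_or_lt with hR0 | hRpos
  · left
    rw [← hR0, mul_zero] at hU'
    have : 0 ≤ a.lip / N := div_nonneg (hr.le.trans hlip) hN'.le
    linarith
  set D := 3 * (a.lip / N) / a.R i with hD
  have hDR : D * a.R i = 3 * (a.lip / N) := div_mul_cancel₀ _ hRpos.ne'
  have hD0 : 0 < D := by
    have : 0 < a.lip := hr.trans_le hlip
    positivity
  set j := ⌈(γ + D) * N⌉₊ with hj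
  have hj1 : (γ + D) * N ≤ j := Nat.le_ceil _
  have hj2 : (j : ℝ) < (γ + D) * N + 1 := Nat.ceil_lt_add_one (by positivity)
  have hx1 : γ + D ≤ j / N := (le_div_iff₀ hN').2 hj1
  have hx2 : j / N ≤ γ + D + 1 / N := by
    rw [div_le_iff₀ hN', add_mul, div_mul_cancel₀ _ hN'.ne']
    exact hj2.le
  have hxR : (j / N - γ) * a.R i ≤ 4 * (a.lip / N) := by
    have h₁ : (j / N - γ) * a.R i ≤ (D + 1 / N) * a.R i :=
      mul_le_mul_of_nonneg_right (by linarith) hRi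
    have h₂ : 1 / N * a.R i ≤ a.topReward / N := by
      rw [one_div_mul_eq_div]
      exact div_le_div_of_nonneg_right (a.R_le_topReward i) hN'.le
    linarith
  by_cases hjN : N < j
  · left
    have : 1 ≤ (j : ℝ) / N := (one_le_div hN').2 (by exact_mod_cast hjN.le)
    have : (1 - γ) * a.R i ≤ (j / N - γ) * a.R i :=
      mul_le_mul_of_nonneg_right (by linarith) hRi
    linarith
  right
  push Not at hjN
  set x : ℝ := j / N with hx
  have hxγ : γ < x := by linarith
  refine ⟨j, hjN, ⟨?_, hir.trans (h.env_mono hxγ.le)⟩, fun i' hi' => ?_⟩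
  swap
  · have h₁ := hbest.R_le hi' hxγ
    have h₂ : x ≤ 1 := div_le_one_of_le₀ (by exact_mod_cast hjN) hN'.le
    have h₃ : (1 - x) * a.R i ≤ (1 - x) * a.R i' :=
      mul_le_mul_of_nonneg_left h₁ (by linarith)
    linarith
  -- The main case: the envelope grows enough between `γ` and `x`.
  have hbmem : b ∈ Set.Icc (0 : ℝ) 1 :=
    ⟨h.betaMin_mem.1.trans (h.gridProb_mem N k).1, (h.gridProb_mem N k).2⟩
  obtain ⟨hs0, hs1⟩ := h.unsafeFactor_mem (β := β) ⟨hβ0, hβ1⟩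
  obtain ⟨ht0, ht1⟩ := h.unsafeFactor_mem hbmem
  have hst : (1 - β) * (1 - a.α) ≤ (1 - b) * (1 - a.α) :=
    mul_le_mul_of_nonneg_right (by linarith) (by linarith [h.α_le_one])
  have hts : (1 - b) * (1 - a.α) - (1 - β) * (1 - a.α) ≤ 1 / N := by
    rw [← sub_mul]
    have : (1 - b - (1 - β)) * (1 - a.α) ≤ (1 - b - (1 - β)) * 1 :=
      mul_le_mul_of_nonneg_left (by linarith [h.α_pos]) (by linarith)
    linarith
  have hq : (a.ceilShare N k j : ℝ) / N ≤ (1 - b) * (1 - a.α) * x + 1 / N := by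
    have : (a.ceilShare N k j : ℝ) < (1 - b) * (1 - a.α) * j + 1 :=
      Nat.ceil_lt_add_one (mul_nonneg ht0 (Nat.cast_nonneg _))
    rw [hx, ← mul_div_assoc, ← add_div]
    exact div_le_div_of_nonneg_right this.le hN'.le
  have henv := h.env_mono hq
  simp only [unsafeShare] at hic
  generalize (1 - β) * (1 - a.α) = s at *
  generalize (1 - b) * (1 - a.α) = t at *
  have hN0 : (0 : ℝ) < 1 / N := by positivity
  have hfine : 4 * (1 / N) * a.topReward ≤ a.κS := by
    push Not at hcoarse
    rw [mul_one_div, div_mul_eq_mul_div, div_le_iff₀ hN']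
    linarith
  have hgain : 3 * (a.lip * (1 / N)) ≤ (x - γ) * a.R i := by
    rw [mul_one_div, ← hDR]
    exact mul_le_mul_of_nonneg_right (by linarith) hRi
  linarith [h.env_add_le hκ hγ0 hγ1 hxγ.le hbest hs1 ht0 ht1 hst hts hN0 hic hfine hgain]

end Agent

/-! ### The hull of the lines -/

/-- The value at `y` of the `i`-th line of a table of slopes and costs. -/
def tableLine (R c : ℕ → ℝ) (y : ℝ) (i : ℕ) : ℝ := y * R i - c i

/-- The state of the scan that computes the upper envelope of the first `n` lines of a table: the
lines below `i` have been read, and `st 0, …, st (h - 1)` is the stack of those among them that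
may still contribute. Consecutive lines of the stack cross at increasing points
(`convex`, with the denominators cleared), and the lines on the stack and the unread ones have the
same envelope as all `n` lines (`dominates`). -/
structure HullStack (R c : ℕ → ℝ) (n i h : ℕ) (st : ℕ → ℕ) : Prop where
  lt : ∀ p < h, st p < i
  mono : ∀ p, p + 1 < h → st p < st (p + 1)
  convex : ∀ p, p + 2 < h →
    (c (st (p + 1)) - c (st p)) * (R (st (p + 2)) - R (st (p + 1)))
      < (c (st (p + 2)) - c (st (p + 1))) * (R (st (p + 1)) - R (st p))
  dominates : ∀ y, ∀ j < n, ∃ q, ((∃ p < h, q = st p) ∨ (i ≤ q ∧ q < n)) ∧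
    tableLine R c y j ≤ tableLine R c y q

namespace HullStack

variable {R c : ℕ → ℝ} {n i h : ℕ} {st st' : ℕ → ℕ}

theorem init (R c : ℕ → ℝ) (n : ℕ) (st : ℕ → ℕ) : HullStack R c n 0 0 st where
  lt p hp := by omega
  mono p hp := by omega
  convex p hp := by omega
  dominates y j hj := ⟨j, .inr ⟨by omega, hj⟩, le_rfl⟩

theorem push (H : HullStack R c n i h st) (hst : ∀ p < h, st' p = st p) (hi : st' h = i)
    (hconv : 1 < h → (c (st (h - 1)) - c (st (h - 2))) * (R i - R (st (h - 1)))
      < (c i - c (st (h - 1))) * (R (st (h - 1)) - R (st (h - 2)))) :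
    HullStack R c n (i + 1) (h + 1) st' where
  lt p hp := by
    rcases Nat.lt_succ_iff_lt_or_eq.1 hp with hp | rfl
    · rw [hst p hp]
      have := H.lt p hp
      omega
    · omega
  mono p hp := by
    rw [hst p (by omega)]
    rcases Nat.lt_succ_iff_lt_or_eq.1 hp with hp | rfl
    · rw [hst _ hp]
      exact H.mono p hp
    · rw [hi]
      exact H.lt p (by omega)
  convex p hp := by
    rw [hst p (by omega), hst (p + 1) (by omega)]
    rcases Nat.lt_succ_iff_lt_or_eq.1 hp with hp | rfl
    · rw [hst _ hp]
      exact H.convex p hp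
    · rw [hi]
      exact hconv (by omega)
  dominates y j hj := by
    obtain ⟨q, ⟨p, hp, rfl⟩ | ⟨hq, hq'⟩, hle⟩ := H.dominates y j hj
    · exact ⟨st p, .inl ⟨p, by omega, (hst p hp).symm⟩, hle⟩
    · rcases hq.eq_or_lt with rfl | hq
      · exact ⟨i, .inl ⟨h, by omega, hi.symm⟩, hle⟩
      · exact ⟨q, .inr ⟨hq, hq'⟩, hle⟩

theorem pop (hR : ∀ i j, i < j → j < n → R i < R j) (H : HullStack R c n i h st) (hin : i < n)
    (hh : 1 < h) (hred : (c i - c (st (h - 1))) * (R (st (h - 1)) - R (st (h - 2)))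
      ≤ (c (st (h - 1)) - c (st (h - 2))) * (R i - R (st (h - 1)))) :
    HullStack R c n i (h - 1) st where
  lt p hp := H.lt p (by omega)
  mono p hp := H.mono p (by omega)
  convex p hp := H.convex p (by omega)
  dominates y j hj := by
    obtain ⟨q, ⟨p, hp, rfl⟩ | hq, hle⟩ := H.dominates y j hj
    · by_cases hp' : p < h - 1
      · exact ⟨st p, .inl ⟨p, hp', rfl⟩, hle⟩
      obtain rfl : p = h - 1 := by omega
      have h₁ : st (h - 2) < st (h - 1) := by
        have := H.mono (h - 2) (by omega)
        rwa [show h - 2 + 1 = h - 1 by omega] at this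
      have h₂ := H.lt (h - 1) hp
      have h₃ := hR _ _ h₁ (by omega)
      have h₄ := hR _ _ h₂ hin
      -- The popped line lies below the maximum of its two neighbours.
      rcases le_or_gt (y * (R (st (h - 1)) - R (st (h - 2)))) (c (st (h - 1)) - c (st (h - 2)))
        with hy | hy
      · refine ⟨st (h - 2), .inl ⟨h - 2, by omega, rfl⟩, hle.trans ?_⟩
        simp only [tableLine]
        linarith
      · refine ⟨i, .inr ⟨le_rfl, hin⟩, hle.trans ?_⟩
        have h₅ := mul_lt_mul_of_pos_right hy (sub_pos.2 h₄)
        have h₆ : c i - c (st (h - 1)) < y * (R i - R (st (h - 1))) := by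
          refine lt_of_mul_lt_mul_right ?_ (sub_pos.2 h₃).le
          linarith
        simp only [tableLine]
        linarith
    · exact ⟨q, .inr hq, hle⟩

theorem R_lt (hR : ∀ i j, i < j → j < n → R i < R j) (H : HullStack R c n n h st) {p : ℕ}
    (hp : p + 1 < h) : R (st p) < R (st (p + 1)) :=
  hR _ _ (H.mono p hp) (H.lt _ hp)

theorem R_le (hR : ∀ i j, i < j → j < n → R i < R j) (H : HullStack R c n n h st) {p p' : ℕ}
    (hpp' : p ≤ p') (hp : p' < h) : R (st p) ≤ R (st p') := by
  induction p', hpp' using Nat.le_induction with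
  | base => rfl
  | succ k hk ih => exact (ih (by omega)).trans (H.R_lt hR hp).le

/-- Once a line of the stack beats its successor, it beats all later ones. -/
theorem line_le_of_succ_le (hR : ∀ i j, i < j → j < n → R i < R j) (H : HullStack R c n n h st)
    {y : ℝ} {p q : ℕ}
    (hp : p + 1 < h → tableLine R c y (st (p + 1)) ≤ tableLine R c y (st p))
    (hpq : p ≤ q) (hq : q < h) : tableLine R c y (st q) ≤ tableLine R c y (st p) := by
  suffices hs : ∀ q, p ≤ q → q + 1 < h →
      tableLine R c y (st (q + 1)) ≤ tableLine R c y (st q) by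
    induction q, hpq using Nat.le_induction with
    | base => rfl
    | succ k hk ih => exact (hs k hk hq).trans (ih (by omega))
  intro q hpq
  induction q, hpq using Nat.le_induction with
  | base => exact hp
  | succ k hk ih =>
    intro hlt
    have h₁ := ih (by omega)
    have h₂ := H.convex k hlt
    have h₃ := H.R_lt hR (p := k) (by omega)
    have h₄ := H.R_lt hR hlt
    simp only [tableLine] at *
    have h₅ : (y * (R (st (k + 1)) - R (st k))) * (R (st (k + 2)) - R (st (k + 1)))
        ≤ (c (st (k + 1)) - c (st k)) * (R (st (k + 2)) - R (st (k + 1))) :=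
      mul_le_mul_of_nonneg_right (by linarith) (sub_pos.2 h₄).le
    have h₆ : y * (R (st (k + 2)) - R (st (k + 1))) < c (st (k + 2)) - c (st (k + 1)) := by
      refine lt_of_mul_lt_mul_right ?_ (sub_pos.2 h₃).le
      linarith
    rw [show k + 1 + 1 = k + 2 by omega]
    linarith

/-- Once a line of the stack beats its predecessor, it beats all earlier ones. -/
theorem line_le_of_pred_le (hR : ∀ i j, i < j → j < n → R i < R j) (H : HullStack R c n n h st)
    {y : ℝ} {p q : ℕ} (hph : p < h)
    (hp : 0 < p → tableLine R c y (st (p - 1)) ≤ tableLine R c y (st p))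
    (hqp : q ≤ p) : tableLine R c y (st q) ≤ tableLine R c y (st p) := by
  induction p generalizing q with
  | zero =>
    obtain rfl : q = 0 := by omega
    rfl
  | succ k ih =>
    rcases hqp.eq_or_lt with rfl | hqk
    · rfl
    have h₁ := hp (by omega)
    rw [Nat.add_sub_cancel] at h₁
    refine (ih (by omega) (fun hk => ?_) (by omega)).trans h₁
    have h₂ := H.convex (k - 1) (by omega)
    have h₃ := H.R_lt hR (p := k - 1) (by omega)
    have h₄ := H.R_lt hR hph
    rw [show k - 1 + 1 = k by omega, show k - 1 + 2 = k + 1 by omega] at h₂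
    rw [show k - 1 + 1 = k by omega] at h₃
    simp only [tableLine] at *
    have h₅ : (c (st (k + 1)) - c (st k)) * (R (st k) - R (st (k - 1)))
        ≤ (y * (R (st (k + 1)) - R (st k))) * (R (st k) - R (st (k - 1))) :=
      mul_le_mul_of_nonneg_right (by linarith) (sub_pos.2 h₃).le
    have h₆ : c (st k) - c (st (k - 1)) < y * (R (st k) - R (st (k - 1))) := by
      refine lt_of_mul_lt_mul_right ?_ (sub_pos.2 h₄).le
      linarith
    linarith

/-- A line of the final stack that beats its two neighbours at `y` attains the envelope there. -/
theorem line_le (hR : ∀ i j, i < j → j < n → R i < R j) (H : HullStack R c n n h st)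
    {y : ℝ} {p : ℕ} (hph : p < h)
    (hpred : 0 < p → tableLine R c y (st (p - 1)) ≤ tableLine R c y (st p))
    (hsucc : p + 1 < h → tableLine R c y (st (p + 1)) ≤ tableLine R c y (st p))
    {j : ℕ} (hj : j < n) : tableLine R c y j ≤ tableLine R c y (st p) := by
  obtain ⟨q, ⟨p', hp', rfl⟩ | hq, hle⟩ := H.dominates y j hj
  · refine hle.trans ?_
    rcases le_total p p' with hpp | hpp
    · exact H.line_le_of_succ_le hR hsucc hpp hp'
    · exact H.line_le_of_pred_le hR hph hpred hpp
  · omega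

theorem exists_best (H : HullStack R c n n h st) (hn : 0 < n) (y : ℝ) :
    ∃ p < h, ∀ j < n, tableLine R c y j ≤ tableLine R c y (st p) := by
  obtain ⟨m, hm, hmax⟩ := Finset.exists_max_image (Finset.range n) (tableLine R c y)
    ⟨0, Finset.mem_range.2 hn⟩
  obtain ⟨q, ⟨p, hp, rfl⟩ | hq, hle⟩ := H.dominates y m (Finset.mem_range.1 hm)
  · exact ⟨p, hp, fun j hj => (hmax j (Finset.mem_range.2 hj)).trans hle⟩
  · omega

theorem size_pos (H : HullStack R c n n h st) (hn : 0 < n) : 0 < h := by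
  obtain ⟨p, hp, -⟩ := H.exists_best hn 0
  omega

end HullStack

/-- The table holds the data of the agent's actions. -/
structure IsTable {n : ℕ} (a : Agent n) (R c : ℕ → ℝ) : Prop where
  R_eq : ∀ i : Fin n, R i = a.R i
  c_eq : ∀ i : Fin n, c i = a.c i

namespace IsTable

variable {n h : ℕ} {a : Agent n} {R c : ℕ → ℝ} {st : ℕ → ℕ}

theorem line_eq (T : IsTable a R c) (y : ℝ) (i : Fin n) : tableLine R c y i = a.line y i := by
  rw [tableLine, T.R_eq, T.c_eq, Agent.line]

theorem strictMono (T : IsTable a R c) (ha : a.Admissible) :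
    ∀ i j, i < j → j < n → R i < R j := by
  intro i j hij hj
  have : a.R ⟨i, hij.trans hj⟩ < a.R ⟨j, hj⟩ := ha.noDominated.2 (Fin.mk_lt_mk.2 hij)
  rwa [← T.R_eq, ← T.R_eq] at this

theorem isBest (T : IsTable a R c) {y : ℝ} {i : ℕ} (hi : i < n)
    (hb : ∀ j < n, tableLine R c y j ≤ tableLine R c y i) : a.IsBest y ⟨i, hi⟩ := fun j => by
  rw [← T.line_eq, ← T.line_eq]
  exact hb j j.2

end IsTable

/-! ### Agents without a cost of compliance -/

/-- For an agent without a cost of compliance, no inspection is needed, and the cheapest contract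
for the `p`-th action of the hull pays the share at which this action becomes best or breaks even,
whichever is larger. This is the principal's utility from it. -/
noncomputable def hullUtility (R c : ℕ → ℝ) (st : ℕ → ℕ) (p : ℕ) : ℝ :=
  if p = 0 then R (st p) - c (st p)
  else min (R (st p) - R (st p) * ((c (st p) - c (st (p - 1))) / (R (st p) - R (st (p - 1)))))
    (R (st p) - c (st p))

namespace Agent

variable {n : ℕ} {a : Agent n}

theorem Admissible.betaMin_eq_zero (h : a.Admissible) (hκ : a.κS = 0) : a.betaMin = 0 := by
  have := h.nonempty
  obtain ⟨i, hi⟩ := a.exists_isBest 1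
  refine le_antisymm (h.betaMin_spec.2 ⟨1, i, implements_iff.2 ⟨by simp, by simp, hi, ?_,
    h.κS_lt_env_one.le⟩⟩) h.betaMin_mem.1
  rw [hκ, add_zero]
  refine h.env_mono ?_
  simp only [unsafeShare]
  linarith [h.α_pos]

theorem Admissible.nonneg_le_bestUtility (h : a.Admissible) (hκ : a.κS = 0) {b : ℝ}
    (hb : 0 ≤ b) : 0 ≤ a.bestUtility b := by
  have := h.nonempty
  obtain ⟨i, hi⟩ := a.exists_isBest 1
  have h₁ := h.implements_of_betaMin_le (b := 0) ⟨(h.betaMin_eq_zero hκ).le, zero_le_one⟩ hi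
  have := h.le_bestUtility h₁ hb
  simp only [principalUtility] at this
  linarith

theorem Admissible.hullUtility_le_bestUtility (ha : a.Admissible) (hκ : a.κS = 0)
    {R c : ℕ → ℝ} (T : IsTable a R c) {h : ℕ} {st : ℕ → ℕ} (H : HullStack R c n n h st) {p : ℕ}
    (hp : p < h) {b : ℝ} (hb : 0 ≤ b) : hullUtility R c st p ≤ a.bestUtility b := by
  rcases le_or_gt (hullUtility R c st p) 0 with hle | hpos
  · exact hle.trans (ha.nonneg_le_bestUtility hκ hb)
  have hR := T.strictMono ha
  have hpn := H.lt p hp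
  have hn : 0 < n := by omega
  have hRp : R (st p) = a.R ⟨st p, hpn⟩ := T.R_eq ⟨st p, hpn⟩
  have hcp : c (st p) = a.c ⟨st p, hpn⟩ := T.c_eq ⟨st p, hpn⟩
  have hR0 : 0 ≤ R (st p) := hRp ▸ ha.R_nonneg _
  have hc0 : 0 ≤ c (st p) := hcp ▸ ha.c_nonneg _
  -- The share of the contract: the utility is `(1 - γ) * R`.
  have hw : hullUtility R c st p ≤ R (st p) - c (st p) := by
    unfold hullUtility
    split_ifs
    · rfl
    · exact min_le_right _ _
  have hRpos : 0 < R (st p) := by linarith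
  set γ := 1 - hullUtility R c st p / R (st p) with hγ
  have hγR : γ * R (st p) = R (st p) - hullUtility R c st p := by
    rw [hγ, sub_mul, one_mul, div_mul_cancel₀ _ hRpos.ne']
  have hγ1 : γ ≤ 1 := by
    have := div_pos hpos hRpos
    linarith
  have hγ0 : 0 ≤ γ := by
    by_contra! hc
    nlinarith
  have hpred : 0 < p → tableLine R c γ (st (p - 1)) ≤ tableLine R c γ (st p) := by
    intro hp0
    have h₁ := H.R_lt hR (p := p - 1) (by omega)
    rw [show p - 1 + 1 = p by omega] at h₁
    have h₂ : hullUtility R c st p ≤ R (st p) - R (st p) *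
        ((c (st p) - c (st (p - 1))) / (R (st p) - R (st (p - 1)))) := by
      unfold hullUtility
      rw [if_neg (by omega)]
      exact min_le_left _ _
    have h₃ : (c (st p) - c (st (p - 1))) / (R (st p) - R (st (p - 1))) ≤ γ := by
      refine le_of_mul_le_mul_left ?_ hRpos
      linarith
    rw [div_le_iff₀ (sub_pos.2 h₁)] at h₃
    simp only [tableLine]
    linarith
  obtain ⟨p', hp', hbest⟩ := H.exists_best hn γ
  -- Some best action has a reward at least as large.
  have hex : ∃ i, a.IsBest γ i ∧ R (st p) ≤ a.R i := by
    rcases le_total p p' with hpp | hpp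
    · exact ⟨⟨st p', H.lt p' hp'⟩, T.isBest _ hbest,
        (T.R_eq ⟨st p', H.lt p' hp'⟩) ▸ H.R_le hR hpp hp'⟩
    · exact ⟨⟨st p, hpn⟩, T.isBest _ fun j hj =>
        (hbest j hj).trans (H.line_le_of_pred_le hR hp hpred hpp), hRp.le⟩
  obtain ⟨i, hi, hRi⟩ := hex
  have henv : 0 ≤ a.env γ := by
    have := a.line_le_env γ ⟨st p, hpn⟩
    rw [← T.line_eq] at this
    simp only [tableLine] at this
    linarith
  have himp : a.Implements γ 0 i true := by
    refine implements_iff.2 ⟨⟨hγ0, hγ1⟩, by simp, hi, ?_, by rwa [hκ]⟩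
    rw [hκ, add_zero]
    refine ha.env_mono ?_
    simp only [unsafeShare]
    nlinarith [ha.α_pos]
  have h₁ := ha.le_bestUtility himp hb
  simp only [principalUtility] at h₁
  have h₂ := mul_le_mul_of_nonneg_left hRi (sub_nonneg.2 hγ1)
  linarith

/-- The utilities from the lines of the hull are optimal. A tie between several best actions is
avoided by an arbitrarily small increase of the share. -/
theorem Admissible.principalUtility_le_of_hull (ha : a.Admissible) (hκ : a.κS = 0)
    {R c : ℕ → ℝ} (T : IsTable a R c) {h : ℕ} {st : ℕ → ℕ} (H : HullStack R c n n h st) {V : ℝ}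
    (hV0 : 0 ≤ V) (hV : ∀ p < h, hullUtility R c st p ≤ V) {γ β : ℝ} {i : Fin n}
    (hi : a.Implements γ β i true) : a.principalUtility γ β i ≤ V := by
  have hR := T.strictMono ha
  obtain ⟨⟨hγ0, hγ1⟩, hβ, hbest, -, hir⟩ := implements_iff.1 hi
  have hle : a.principalUtility γ β i ≤ (1 - γ) * a.R i := by
    have := mul_nonneg hβ.1 ha.κI_nonneg
    simp only [principalUtility]
    linarith
  refine hle.trans (le_of_forall_pos_le_add fun ε hε => ?_)
  have hRi := ha.R_nonneg i
  set δ := ε / (a.R i + 1) with hδ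
  have hδ0 : 0 < δ := by positivity
  have hδR : δ * a.R i ≤ ε := by
    have : δ * (a.R i + 1) = ε := div_mul_cancel₀ _ (by positivity)
    linarith
  suffices hs : (1 - (γ + δ)) * a.R i ≤ V by linarith
  rcases le_or_gt 1 (γ + δ) with h1 | h1
  · exact (mul_nonpos_of_nonpos_of_nonneg (by linarith) hRi).trans hV0
  obtain ⟨p, hp, hpb⟩ := H.exists_best (Fin.pos i) (γ + δ)
  have hpn := H.lt p hp
  have hb := T.isBest hpn hpb
  have h₁ : a.R i ≤ R (st p) := by
    rw [T.R_eq ⟨st p, hpn⟩]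
    exact hbest.R_le hb (by linarith)
  have hRp : 0 ≤ R (st p) := hRi.trans h₁
  have h₂ : 0 ≤ tableLine R c (γ + δ) (st p) := by
    rw [T.line_eq _ ⟨st p, hpn⟩, ← hb.env_eq, ← hκ]
    exact hir.trans (ha.env_mono (by linarith))
  have h₃ : (1 - (γ + δ)) * R (st p) ≤ R (st p) - c (st p) := by
    simp only [tableLine] at h₂
    linarith
  refine (mul_le_mul_of_nonneg_left h₁ (by linarith)).trans (le_trans ?_ (hV p hp))
  unfold hullUtility
  split_ifs with hp0
  · exact h₃
  · refine le_min ?_ h₃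
    have h₄ := H.R_lt hR (p := p - 1) (by omega)
    rw [show p - 1 + 1 = p by omega] at h₄
    have h₅ := hpb (st (p - 1)) (H.lt _ (by omega))
    have h₆ : (c (st p) - c (st (p - 1))) / (R (st p) - R (st (p - 1))) ≤ γ + δ := by
      rw [div_le_iff₀ (sub_pos.2 h₄)]
      simp only [tableLine] at h₅
      linarith
    have := mul_le_mul_of_nonneg_left h₆ hRp
    linarith

end Agent

/-! ### The layout of the memory -/

/-! The names of the variables and arrays of the programs: `ι` for integer variables, `ρ` for real
variables, `τ` for arrays. The input occupies `ιm`, `ιn`, `ιB`, `ρε` and `τR`, …, `τα`, and the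
output is `τout`.

* `ιN` is the fineness of the grid, `ιK` the number of grid steps in the budget, `ιl` the current
  agent, `ιh` the height of the stack of the hull; `ιi`, `ιj`, `ιk`, `ιq` are counters.
* `ρΛ` is `lipBound`, `ρΣ` the sum of the `betaMin`, `ρf` the value of the envelope at `1`, `ρβ` the
  current `betaMin`, `ρV` the utility from the hull, `ρW` the value of the solution; `ρb`, `ρt`,
  `ρu`, `ρv` are temporary.
* `τD` and `τch` are the tables of the dynamic program, `τu` and `τb` the utilities and
  probabilities on the grid, `τF` the envelope and the rewards on the grid, `τst` the stack. The
  last two are reused for each agent. -/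

notation "ιm" => (0 : ℕ)
notation "ιn" => (1 : ℕ)
notation "ιB" => (2 : ℕ)
notation "ιN" => (3 : ℕ)
notation "ιl" => (4 : ℕ)
notation "ιi" => (5 : ℕ)
notation "ιh" => (6 : ℕ)
notation "ιj" => (7 : ℕ)
notation "ιq" => (8 : ℕ)
notation "ιk" => (9 : ℕ)
notation "ιK" => (10 : ℕ)

notation "ρε" => (0 : ℕ)
notation "ρΛ" => (1 : ℕ)
notation "ρΣ" => (2 : ℕ)
notation "ρf" => (3 : ℕ)
notation "ρβ" => (4 : ℕ)
notation "ρV" => (5 : ℕ)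
notation "ρb" => (6 : ℕ)
notation "ρt" => (7 : ℕ)
notation "ρu" => (8 : ℕ)
notation "ρv" => (9 : ℕ)
notation "ρW" => (10 : ℕ)

notation "τR" => (0 : ℕ)
notation "τc" => (1 : ℕ)
notation "τκS" => (2 : ℕ)
notation "τκI" => (3 : ℕ)
notation "τα" => (4 : ℕ)
notation "τout" => (5 : ℕ)
notation "τD" => (6 : ℕ)
notation "τu" => (7 : ℕ)
notation "τb" => (8 : ℕ)
notation "τF" => (9 : ℕ)
notation "τst" => (0 : ℕ)
notation "τch" => (1 : ℕ)

infixr:50 " ;; " => Program.seq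

/-! ### The program for one agent -/

attribute [simp] IExp.cost RExp.cost Test.cost Program.maxCost

/-- The entry of a table in the row of the current agent. -/
@[simp] def RExp.row (a : ℕ) (e : IExp) : RExp := .arr a (.var ιl) e

/-- The integer constants `0` and `1` as real expressions. -/
@[simp] def RExp.one : RExp := .ofInt (.lit 1)

@[simp] def RExp.zero : RExp := .ofInt (.lit 0)

@[simp] def Program.incr (x : ℕ) : Program := .iset x (.add (.var x) (.lit 1))

/-- `max x e` is assigned to the real variable `x`. -/
@[simp] def Program.raise (x : ℕ) (e : RExp) : Program := .cond (.rlt (.var x) e) (.rset x e) .skip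

/-- The memory holds the data of the agent `a` in the row of the current agent, and the fineness `N`
of the grid. -/
structure HoldsAgent {n : ℕ} (a : Agent n) (N : ℕ) (σ : Memory) : Prop where
  n_eq : σ.ivar ιn = n
  N_eq : σ.ivar ιN = N
  table : IsTable a (σ.rarr τR (σ.ivar ιl)) (σ.rarr τc (σ.ivar ιl))
  κS_eq : σ.rarr τκS (σ.ivar ιl) 0 = a.κS
  κI_eq : σ.rarr τκI (σ.ivar ιl) 0 = a.κI
  α_eq : σ.rarr τα (σ.ivar ιl) 0 = a.α

/-- The program leaves the data of the current agent as they are. -/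
def Program.keepsAgent (p : Program) : Bool :=
  !p.writesI ιn && !p.writesI ιN && !p.writesI ιl && !p.writesRArr τR && !p.writesRArr τc &&
    !p.writesRArr τκS && !p.writesRArr τκI && !p.writesRArr τα

theorem HoldsAgent.of_agree {n N : ℕ} {a : Agent n} {σ τ : Memory} {p : Program}
    (h : HoldsAgent a N σ) (hA : Agree p σ τ) (hp : p.keepsAgent = true) : HoldsAgent a N τ := by
  simp only [Program.keepsAgent, Bool.and_eq_true, Bool.not_eq_true'] at hp
  obtain ⟨⟨⟨⟨⟨⟨⟨h₁, h₂⟩, h₃⟩, h₄⟩, h₅⟩, h₆⟩, h₇⟩, h₈⟩ := hp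
  refine ⟨?_, ?_, ?_, ?_, ?_, ?_⟩ <;>
    simp only [hA.ivar _ h₁, hA.ivar _ h₂, hA.ivar _ h₃, hA.rarr _ h₄, hA.rarr _ h₅, hA.rarr _ h₆,
      hA.rarr _ h₇, hA.rarr _ h₈]
  exacts [h.n_eq, h.N_eq, h.table, h.κS_eq, h.κI_eq, h.α_eq]

/-- `max_i (R_i - c_i)`. -/
def computeTop : Program :=
  (.rset ρf .zero ;; .iset ιi (.lit 0)) ;; .loop (.ilt (.var ιi) (.var ιn))
    (.raise ρf (.sub (.row τR (.var ιi)) (.row τc (.var ιi))) ;; .incr ιi)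

theorem runs_computeTop {n N : ℕ} {a : Agent n} (ha : a.Admissible) {σ : Memory}
    (hσ : HoldsAgent a N σ) :
    Runs computeTop σ (50 * (n + 1)) fun τ => τ.rvar ρf = a.env 1 := by
  have hne := ha.nonempty
  refine Runs.mono (Runs.init_loop n (fun τ => n - τ.ivar ιi)
    (fun τ => τ.ivar ιi ≤ n ∧ 0 ≤ τ.rvar ρf ∧ τ.rvar ρf ≤ a.env 1 ∧
      ∀ i : Fin n, i < τ.ivar ιi → a.line 1 i ≤ τ.rvar ρf)
    ?_ (fun τ hA hI hb => Runs.of_wp ?_) fun τ hA hI hb => ?_) ?_ fun _ _ h => h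
  · have := ha.κS_lt_env_one
    have := ha.κS_nonneg
    simp
    linarith
  · have H := hσ.of_agree hA rfl
    obtain ⟨h₁, h₂, h₃, h₄⟩ := hI
    simp only [Test.Holds, IExp.eval, H.n_eq] at hb
    have hl := H.table.line_eq 1 ⟨_, hb⟩
    have hl' := a.line_le_env 1 ⟨_, hb⟩
    simp only [tableLine, one_mul] at hl
    have key : ∀ f : ℝ, τ.rvar ρf ≤ f → a.line 1 ⟨_, hb⟩ ≤ f →
        ∀ i : Fin n, (i : ℕ) ≤ τ.ivar ιi → a.line 1 i ≤ f := by
      intro f hf hf' i hi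
      rcases hi.lt_or_eq with hi | hi
      · exact (h₄ i hi).trans hf
      · rwa [show i = ⟨_, hb⟩ from Fin.ext hi]
    simp [hl]
    constructor
    · intro hlt
      exact ⟨⟨by omega, by linarith, hl', key _ hlt.le le_rfl⟩, by omega⟩
    · intro hle
      exact ⟨⟨by omega, h₂, h₃, key _ le_rfl hle⟩, by omega⟩
  · have H := hσ.of_agree hA rfl
    obtain ⟨h₁, h₂, h₃, h₄⟩ := hI
    simp only [Test.Holds, IExp.eval, H.n_eq] at hb
    exact le_antisymm h₃ (ciSup_le fun i => h₄ i (by omega))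
  · simp
    omega

/-- The bound `env 1 - κS + c_i` on the share of the reward that an unsafe agent may keep from the
action `i`. -/
@[simp] def slackExp : RExp :=
  .add (.sub (.var ρf) (.row τκS (.lit 0))) (.row τc (.var ιi))

@[simp] def unsafeRewardExp : RExp :=
  .mul (.sub .one (.row τα (.lit 0))) (.row τR (.var ιi))

/-- `betaMin`. -/
def computeBeta : Program :=
  (.rset ρβ .zero ;; .iset ιi (.lit 0)) ;; .loop (.ilt (.var ιi) (.var ιn))
    (.cond (.rlt slackExp unsafeRewardExp)
      (.raise ρβ (.sub .one (.div slackExp unsafeRewardExp))) .skip ;; .incr ιi)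

theorem runs_computeBeta {n N : ℕ} {a : Agent n} (ha : a.Admissible) {σ : Memory}
    (hσ : HoldsAgent a N σ) (hf : σ.rvar ρf = a.env 1) :
    Runs computeBeta σ (100 * (n + 1)) fun τ => τ.rvar ρβ = a.betaMin := by
  have hne := ha.nonempty
  refine Runs.mono (Runs.init_loop n (fun τ => n - τ.ivar ιi)
    (fun τ => τ.ivar ιi ≤ n ∧ τ.rvar ρβ ∈ Set.Icc (0 : ℝ) 1 ∧
      (∀ j : Fin n, j < τ.ivar ιi →
        (1 - τ.rvar ρβ) * ((1 - a.α) * a.R j) ≤ a.env 1 - a.κS + a.c j) ∧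
      (τ.rvar ρβ = 0 ∨ ∃ j, 0 < (1 - a.α) * a.R j ∧
        a.env 1 - a.κS + a.c j ≤ (1 - τ.rvar ρβ) * ((1 - a.α) * a.R j)))
    ?_ (fun τ hA hI hb => Runs.of_wp ?_) fun τ hA hI hb => ?_) ?_ fun _ _ h => h
  · simp
  · have H := hσ.of_agree hA rfl
    rw [← hA.rvar ρf rfl] at hf
    obtain ⟨h₁, h₂, h₃, h₄⟩ := hI
    simp only [Test.Holds, IExp.eval, H.n_eq] at hb
    set i : Fin n := ⟨_, hb⟩ with hi
    have hR : τ.rarr τR (τ.ivar ιl) (τ.ivar ιi) = a.R i := H.table.R_eq i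
    have hc : τ.rarr τc (τ.ivar ιl) (τ.ivar ιi) = a.c i := H.table.c_eq i
    have hX : ∀ j, 0 ≤ (1 - a.α) * a.R j := fun j =>
      mul_nonneg (sub_nonneg.2 ha.α_le_one) (ha.R_nonneg j)
    have hD : 0 < a.env 1 - a.κS + a.c i := by
      linarith [ha.κS_lt_env_one, ha.c_nonneg i]
    have key : ∀ β : ℝ, τ.rvar ρβ ≤ β →
        (1 - β) * ((1 - a.α) * a.R i) ≤ a.env 1 - a.κS + a.c i →
        ∀ j : Fin n, (j : ℕ) ≤ τ.ivar ιi →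
          (1 - β) * ((1 - a.α) * a.R j) ≤ a.env 1 - a.κS + a.c j := by
      intro β hβ hβ' j hj
      rcases hj.lt_or_eq with hj | hj
      · exact (mul_le_mul_of_nonneg_right (by linarith) (hX j)).trans (h₃ j hj)
      · rwa [show j = i from Fin.ext hj]
    simp [hR, hc, H.κS_eq, H.α_eq, hf]
    refine ⟨fun hlt => ⟨fun hlt' => ?_, fun hle => ?_⟩, fun hle => ?_⟩
    · have hpos := hD.trans hlt
      have heq := div_mul_cancel₀ (a.env 1 - a.κS + a.c i) hpos.ne'
      have hk := key (1 - (a.env 1 - a.κS + a.c i) / ((1 - a.α) * a.R i)) hlt'.le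
      rw [sub_sub_cancel] at hk
      exact ⟨⟨by omega, ⟨by linarith [h₂.1], (div_pos hD hpos).le⟩, hk heq.le,
        .inr ⟨i, hpos, heq.ge⟩⟩, by omega⟩
    · have hpos := hD.trans hlt
      have h₅ : 1 - τ.rvar ρβ ≤ (a.env 1 - a.κS + a.c i) / ((1 - a.α) * a.R i) := by linarith
      rw [le_div_iff₀ hpos] at h₅
      exact ⟨⟨by omega, h₂, key _ le_rfl h₅, h₄⟩, by omega⟩
    · refine ⟨⟨by omega, h₂, key _ le_rfl (le_trans ?_ hle), h₄⟩, by omega⟩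
      exact mul_le_of_le_one_left (hX i) (by linarith [h₂.1])
  · have H := hσ.of_agree hA rfl
    obtain ⟨h₁, h₂, h₃, h₄⟩ := hI
    simp only [Test.Holds, IExp.eval, H.n_eq] at hb
    exact (ha.betaMin_isLeast h₂ (fun j => h₃ j (by omega)) h₄).unique ha.betaMin_spec
  · simp
    omega

/-- The index of the line in the stack at the height that `e` stands for. -/
@[simp] def stackExp (e : IExp) : IExp := .arr τst (.lit 0) e

/-- The stack of lines of the hull, and its height. -/
def computeHull : Program :=
  (.iset ιi (.lit 0) ;; .iset ιh (.lit 0)) ;; .loop (.ilt (.var ιi) (.var ιn))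
    (.cond
      (.and (.ilt (.lit 1) (.var ιh)) (.not (.rlt
        (.mul
          (.sub (.row τc (stackExp (.sub (.var ιh) (.lit 1))))
            (.row τc (stackExp (.sub (.var ιh) (.lit 2)))))
          (.sub (.row τR (.var ιi)) (.row τR (stackExp (.sub (.var ιh) (.lit 1))))))
        (.mul
          (.sub (.row τc (.var ιi)) (.row τc (stackExp (.sub (.var ιh) (.lit 1)))))
          (.sub (.row τR (stackExp (.sub (.var ιh) (.lit 1))))
            (.row τR (stackExp (.sub (.var ιh) (.lit 2)))))))))
      (.iset ιh (.sub (.var ιh) (.lit 1)))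
      (.istore τst (.lit 0) (.var ιh) (.var ιi) ;; .incr ιh ;; .incr ιi))

theorem runs_computeHull {n N : ℕ} {a : Agent n} (ha : a.Admissible) {σ : Memory}
    (hσ : HoldsAgent a N σ) :
    Runs computeHull σ (300 * (n + 1)) fun τ =>
      HullStack (τ.rarr τR (τ.ivar ιl)) (τ.rarr τc (τ.ivar ιl)) n n (τ.ivar ιh) (τ.iarr τst 0) ∧
        τ.ivar ιh ≤ n := by
  have hR := hσ.table.strictMono ha
  refine Runs.mono (Runs.init_loop (2 * n) (fun τ => 2 * (n - τ.ivar ιi) + τ.ivar ιh)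
    (fun τ => τ.ivar ιh ≤ τ.ivar ιi ∧ τ.ivar ιi ≤ n ∧
      HullStack (σ.rarr τR (σ.ivar ιl)) (σ.rarr τc (σ.ivar ιl)) n (τ.ivar ιi) (τ.ivar ιh)
        (τ.iarr τst 0))
    ?_ (fun τ hA hI hb => Runs.of_wp ?_) fun τ hA hI hb => ?_) ?_ fun _ _ h => h
  · simpa using HullStack.init _ _ _ _
  · have hl := hA.ivar ιl rfl
    have h1 := hA.ivar ιn rfl
    have hr := hA.rarr τR rfl
    have hc := hA.rarr τc rfl
    obtain ⟨h₁, h₂, h₃⟩ := hI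
    simp only [Test.Holds, IExp.eval, h1, hσ.n_eq] at hb
    simp [hl, hr, hc]
    refine ⟨fun hh hred => ⟨⟨by omega, h₂, h₃.pop hR hb hh hred⟩, by omega⟩,
      fun hred => ⟨⟨by omega, by omega, h₃.push (fun p hp => ?_) ?_ hred⟩, by omega⟩⟩
    · rw [storeI_iarr, if_neg (by omega)]
    · simp
  · obtain ⟨h₁, h₂, h₃⟩ := hI
    simp only [Test.Holds, IExp.eval, hA.ivar ιn rfl, hσ.n_eq] at hb
    rw [show τ.ivar ιi = n by omega] at h₃
    rw [hA.ivar ιl rfl, hA.rarr τR rfl, hA.rarr τc rfl]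
    exact ⟨h₃, by omega⟩
  · simp
    omega

/-- The line of the current agent in the stack at the height that `e` stands for. -/
@[simp] def hullLineExp (y : RExp) (e : IExp) : RExp :=
  .sub (.mul y (.row τR (stackExp e))) (.row τc (stackExp e))

/-- The principal's utility from the current line of the stack when the agent receives the share
at which this line crosses its predecessor. -/
@[simp] def crossingExp : RExp :=
  .sub (.row τR (stackExp (.var ιi))) (.mul (.row τR (stackExp (.var ιi))) (.div
    (.sub (.row τc (stackExp (.var ιi))) (.row τc (stackExp (.sub (.var ιi) (.lit 1)))))
    (.sub (.row τR (stackExp (.var ιi))) (.row τR (stackExp (.sub (.var ιi) (.lit 1)))))))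

/-- The principal's optimal utility from an agent without a cost of compliance, and `0` for the
other agents. -/
def computeBase : Program :=
  (.rset ρV .zero ;; .iset ιi (.lit 0)) ;;
    .loop (.and (.ilt (.var ιi) (.var ιh)) (.not (.rlt .zero (.row τκS (.lit 0)))))
      (.rset ρv (.sub (.row τR (stackExp (.var ιi))) (.row τc (stackExp (.var ιi)))) ;;
        .cond (.ilt (.lit 0) (.var ιi))
          (.cond (.rlt crossingExp (.var ρv)) (.rset ρv crossingExp) .skip) .skip ;;
        .raise ρV (.var ρv) ;; .incr ιi)

/-- What `computeBase` provides for the agent: for an agent that needs no inspection the optimal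
utility, for the others a utility that any probability of inspection above `betaMin` permits. -/
structure IsBase {n : ℕ} (a : Agent n) (V : ℝ) : Prop where
  nonneg : 0 ≤ V
  sound : ∀ b ∈ Set.Icc a.betaMin 1, V - b * a.κI ≤ a.bestUtility b
  optimal : a.κS = 0 → ∀ γ β i, a.Implements γ β i true → a.principalUtility γ β i ≤ V

theorem runs_computeBase {n N : ℕ} {a : Agent n} (ha : a.Admissible) {σ : Memory}
    (hσ : HoldsAgent a N σ) (hh : σ.ivar ιh ≤ n)
    (H : HullStack (σ.rarr τR (σ.ivar ιl)) (σ.rarr τc (σ.ivar ιl)) n n (σ.ivar ιh)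
      (σ.iarr τst 0)) :
    Runs computeBase σ (300 * (n + 1)) fun τ => IsBase a (τ.rvar ρV) := by
  refine Runs.mono (Runs.init_loop n (fun τ => n - τ.ivar ιi)
    (fun τ => τ.ivar ιi ≤ n ∧ 0 ≤ τ.rvar ρV ∧ (0 < a.κS → τ.rvar ρV = 0) ∧
      (∀ p < τ.ivar ιi, hullUtility (σ.rarr τR (σ.ivar ιl)) (σ.rarr τc (σ.ivar ιl))
        (σ.iarr τst 0) p ≤ τ.rvar ρV) ∧
      (a.κS = 0 → ∀ b, 0 ≤ b → τ.rvar ρV ≤ a.bestUtility b))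
    ?_ (fun τ hA hI hb => Runs.of_wp ?_) fun τ hA hI hb => ?_) ?_ fun _ _ h => h
  · simpa using fun h0 b hb => ha.nonneg_le_bestUtility h0 hb
  · obtain ⟨h₁, h₂, h₃, h₄, h₅⟩ := hI
    have hl := hA.ivar ιl rfl
    have hr := hA.rarr τR rfl
    have hc := hA.rarr τc rfl
    have hs := hA.iarr τst rfl
    simp [hA.ivar ιh rfl, hl, hA.rarr τκS rfl, hσ.κS_eq] at hb
    have hκ : a.κS = 0 := le_antisymm hb.2 ha.κS_nonneg
    have hu := fun b hb' => ha.hullUtility_le_bestUtility hκ hσ.table H hb.1 (b := b) hb'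
    generalize hw : hullUtility (σ.rarr τR (σ.ivar ιl)) (σ.rarr τc (σ.ivar ιl))
        (σ.iarr τst 0) (τ.ivar ιi) = w at *
    have key : ∀ V, τ.rvar ρV ≤ V → w ≤ V → ∀ p ≤ τ.ivar ιi,
        hullUtility (σ.rarr τR (σ.ivar ιl)) (σ.rarr τc (σ.ivar ιl)) (σ.iarr τst 0) p ≤ V := by
      intro V hV hwV p hp
      rcases hp.lt_or_eq with hp | rfl
      · exact (h₄ p hp).trans hV
      · rwa [hw]
    have fin₁ : ∀ V, V = w → τ.rvar ρV < V → (τ.ivar ιi < n ∧ 0 ≤ V ∧ (0 < a.κS → V = 0) ∧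
        (∀ p ≤ τ.ivar ιi, hullUtility (σ.rarr τR (σ.ivar ιl)) (σ.rarr τc (σ.ivar ιl))
          (σ.iarr τst 0) p ≤ V) ∧ (a.κS = 0 → ∀ b, 0 ≤ b → V ≤ a.bestUtility b)) ∧
        n - (τ.ivar ιi + 1) < n - τ.ivar ιi := by
      rintro V rfl hV
      exact ⟨⟨by omega, by linarith, fun h => by linarith, key _ hV.le le_rfl, fun _ => hu⟩,
        by omega⟩
    have fin₂ : ∀ V, V = w → V ≤ τ.rvar ρV → (τ.ivar ιi < n ∧ 0 ≤ τ.rvar ρV ∧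
        (0 < a.κS → τ.rvar ρV = 0) ∧
        (∀ p ≤ τ.ivar ιi, hullUtility (σ.rarr τR (σ.ivar ιl)) (σ.rarr τc (σ.ivar ιl))
          (σ.iarr τst 0) p ≤ τ.rvar ρV) ∧
        (a.κS = 0 → ∀ b, 0 ≤ b → τ.rvar ρV ≤ a.bestUtility b)) ∧
        n - (τ.ivar ιi + 1) < n - τ.ivar ιi := by
      rintro V rfl hV
      exact ⟨⟨by omega, h₂, h₃, key _ le_rfl hV, h₅⟩, by omega⟩
    simp [-tsub_le_iff_right, -sub_nonneg, hl, hr, hc, hs]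
    refine ⟨fun hp => ⟨fun hlt => ?_, fun hle => ?_⟩, fun hp => ?_⟩
    · refine ⟨fin₁ _ ?_, fin₂ _ ?_⟩ <;>
      rw [← hw, hullUtility, if_neg (by omega), min_eq_left (sub_le_sub_left hlt.le _)]
    · refine ⟨fin₁ _ ?_, fin₂ _ ?_⟩ <;>
      rw [← hw, hullUtility, if_neg (by omega), min_eq_right (sub_le_sub_left hle _)]
    · refine ⟨fin₁ _ ?_, fin₂ _ ?_⟩ <;> rw [← hw, hullUtility, if_pos hp]
  · obtain ⟨h₁, h₂, h₃, h₄, h₅⟩ := hI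
    simp [hA.ivar ιh rfl, hA.ivar ιl rfl, hA.rarr τκS rfl, hσ.κS_eq] at hb
    refine ⟨h₂, fun b hb' => ?_, fun hκ γ β i hi => ?_⟩
    · have hb0 : 0 ≤ b := ha.betaMin_mem.1.trans hb'.1
      rcases ha.κS_nonneg.eq_or_lt with hκ | hκ
      · linarith [h₅ hκ.symm b hb0, mul_nonneg hb0 ha.κI_nonneg]
      · rw [h₃ hκ, zero_sub]
        exact ha.neg_le_bestUtility hb'
    · refine ha.principalUtility_le_of_hull hκ hσ.table H h₂ (fun p hp => h₄ p ?_) hi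
      by_contra! hlt
      linarith [hb (by omega)]
  · simp
    omega

/-- The share `j / N` that the integer variable `x` stands for. The denominator is `max N 1`, so
that there is no division by zero when the grid consists of the single share `0`. -/
def shareExp (x : ℕ) : RExp :=
  .div (.ofInt (.var x)) (.ofInt (.add (.var ιN) (.sub (.lit 1) (.var ιN))))

@[simp] theorem shareExp_cost (x : ℕ) : (shareExp x).cost = 9 := rfl

theorem shareExp_eval {σ : Memory} {N x : ℕ} (hN : σ.ivar ιN = N) (hx : σ.ivar x ≤ N) :
    (shareExp x).eval σ = σ.ivar x / (N : ℝ) := by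
  rcases Nat.eq_zero_or_pos N with rfl | h
  · simp [shareExp, Nat.le_zero.1 hx]
  · simp [shareExp, hN, Nat.sub_eq_zero_of_le h]

/-- The values of the envelope at the points `j / N`, and the rewards of the best actions there. -/
def computeEnvelope : Program :=
  (.iset ιi (.lit 0) ;; .iset ιj (.lit 0)) ;;
    .loop (.ilt (.var ιj) (.add (.var ιN) (.lit 1)))
      (.cond
        (.and (.ilt (.add (.var ιi) (.lit 1)) (.var ιh)) (.not (.rlt
          (hullLineExp (shareExp ιj) (.add (.var ιi) (.lit 1)))
          (hullLineExp (shareExp ιj) (.var ιi)))))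
        (.incr ιi)
        (.rstore τF (.lit 0) (.var ιj) (hullLineExp (shareExp ιj) (.var ιi)) ;;
          .rstore τF (.lit 1) (.var ιj) (.row τR (stackExp (.var ιi))) ;; .incr ιj))

/-- The tables hold the values of the envelope at the points `j / N` and the rewards of best
actions there. -/
def IsEnvelope {n : ℕ} (a : Agent n) (N : ℕ) (F S : ℕ → ℝ) : Prop :=
  ∀ j ≤ N, ∃ i, a.IsBest (j / (N : ℝ)) i ∧ F j = a.env (j / (N : ℝ)) ∧ S j = a.R i

theorem runs_computeEnvelope {n N : ℕ} {a : Agent n} (ha : a.Admissible) {σ : Memory}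
    (hσ : HoldsAgent a N σ) (hh : σ.ivar ιh ≤ n)
    (H : HullStack (σ.rarr τR (σ.ivar ιl)) (σ.rarr τc (σ.ivar ιl)) n n (σ.ivar ιh)
      (σ.iarr τst 0)) :
    Runs computeEnvelope σ (150 * (n + N + 1)) fun τ =>
      IsEnvelope a N (τ.rarr τF 0) (τ.rarr τF 1) := by
  have hR := hσ.table.strictMono ha
  have hn : 0 < n := Fin.pos_iff_nonempty.2 ha.nonempty
  have hpos := H.size_pos hn
  refine Runs.mono (Runs.init_loop (n + N + 1) (fun τ => (n - τ.ivar ιi) + (N + 1 - τ.ivar ιj))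
    (fun τ => τ.ivar ιi < σ.ivar ιh ∧ τ.ivar ιj ≤ N + 1 ∧
      (0 < τ.ivar ιi → tableLine (σ.rarr τR (σ.ivar ιl)) (σ.rarr τc (σ.ivar ιl))
          (τ.ivar ιj / (N : ℝ)) (σ.iarr τst 0 (τ.ivar ιi - 1))
        ≤ tableLine (σ.rarr τR (σ.ivar ιl)) (σ.rarr τc (σ.ivar ιl))
          (τ.ivar ιj / (N : ℝ)) (σ.iarr τst 0 (τ.ivar ιi))) ∧
      ∀ j < τ.ivar ιj, ∃ i, a.IsBest (j / (N : ℝ)) i ∧ τ.rarr τF 0 j = a.env (j / (N : ℝ)) ∧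
        τ.rarr τF 1 j = a.R i)
    ?_ (fun τ hA hI hb => Runs.of_wp ?_) fun τ hA hI hb => ?_) ?_ fun _ _ h => h
  · simp
    omega
  · obtain ⟨h₁, h₂, h₃, h₄⟩ := hI
    have hl := hA.ivar ιl rfl
    have hr := hA.rarr τR rfl
    have hc := hA.rarr τc rfl
    have hs := hA.iarr τst rfl
    have hN := (hA.ivar ιN rfl).trans hσ.N_eq
    have hh' := hA.ivar ιh rfl
    simp only [Test.Holds, IExp.eval, hN] at hb
    simp [hl, hr, hc, hs, hh', shareExp_eval hN (Nat.lt_succ_iff.1 hb)]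
    refine ⟨fun hp hle => ⟨⟨hp, h₂, ?_, h₄⟩, by omega⟩, fun hlt => ⟨⟨h₁, by omega, fun hp => ?_,
      fun j hj => ?_⟩, by omega⟩⟩
    · simp only [tableLine]
      linarith
    · have h₅ := H.R_lt hR (p := τ.ivar ιi - 1) (by omega)
      rw [show τ.ivar ιi - 1 + 1 = τ.ivar ιi by omega] at h₅
      have h₆ := h₃ hp
      have h₇ : (τ.ivar ιj : ℝ) / N ≤ (τ.ivar ιj + 1) / N :=
        div_le_div_of_nonneg_right (by linarith) (Nat.cast_nonneg _)
      have h₈ := mul_le_mul_of_nonneg_right h₇ (sub_pos.2 h₅).le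
      simp only [tableLine] at h₆ ⊢
      linarith
    · rcases hj.lt_or_eq with hj | rfl
      · obtain ⟨i, hi, hF, hS⟩ := h₄ j hj
        refine ⟨i, hi, ?_, ?_⟩
        · rw [if_neg (by omega)]
          exact hF
        · rw [if_neg (by omega)]
          exact hS
      · have hbest := hσ.table.isBest (H.lt _ h₁) fun j hj => H.line_le hR h₁ h₃
          (fun hp => by simp only [tableLine]; linarith [hlt hp]) hj
        refine ⟨_, hbest, ?_, ?_⟩
        · rw [if_pos rfl, hbest.env_eq, ← hσ.table.line_eq, tableLine]
        · rw [if_pos rfl, ← hσ.table.R_eq]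
  · obtain ⟨h₁, h₂, h₃, h₄⟩ := hI
    simp only [Test.Holds, IExp.eval, (hA.ivar ιN rfl).trans hσ.N_eq] at hb
    exact fun j hj => h₄ j (by omega)
  · simp
    omega

/-! ### The utilities of one agent on the grid -/

/-- The utilities in the row `u`, which belong to the probabilities of inspection in the row `b`,
are attainable, and every contract is approximated by one of them with no larger probability of
inspection. -/
structure IsProfile {n : ℕ} (a : Agent n) (N : ℕ) (b u : ℕ → ℝ) : Prop where
  prob : ∀ k ≤ N, b k = a.gridProb N k
  sound : ∀ k ≤ N, u k ≤ a.bestUtility (a.gridProb N k)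
  complete : ∀ γ β i, a.Implements γ β i true →
    ∃ k ≤ N, a.betaMin + k / N ≤ β ∧ a.principalUtility γ β i - a.gridError N ≤ u k

theorem IsProfile.of_grid {n N : ℕ} {a : Agent n} (ha : a.Admissible) {b u F S : ℕ → ℝ} {V : ℝ}
    (hV : IsBase a V) (hE : IsEnvelope a N F S) (hb : ∀ k ≤ N, b k = a.gridProb N k)
    (hu : ∀ k ≤ N, u k ≤ a.bestUtility (a.gridProb N k) ∧ V - a.gridProb N k * a.κI ≤ u k ∧
      ∀ j ≤ N, a.GridFeasible N k j → (1 - j / N) * S j - a.gridProb N k * a.κI ≤ u k) :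
    IsProfile a N b u where
  prob := hb
  sound k hk := (hu k hk).1
  complete γ β i hi := by
    rcases ha.κS_nonneg.eq_or_lt with hκ | hκ
    · refine ⟨0, Nat.zero_le _, ?_, ?_⟩
      · simpa [ha.betaMin_eq_zero hκ.symm] using hi.prob_mem.1
      · have h₁ := (hu 0 (Nat.zero_le _)).2.1
        have h₂ : a.gridProb N 0 = 0 := by simp [Agent.gridProb, ha.betaMin_eq_zero hκ.symm]
        have h₃ := hV.optimal hκ.symm _ _ _ hi
        have h₄ : a.gridError N = 0 := by simp [Agent.gridError, Agent.lip, ← hκ]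
        rw [h₂] at h₁
        linarith
    · obtain ⟨k, hk, hkβ, h | ⟨j, hj, hf, h⟩⟩ := ha.exists_grid hκ N hi
      · refine ⟨k, hk, hkβ, h.trans (le_trans ?_ (hu k hk).2.1)⟩
        linarith [hV.nonneg]
      · obtain ⟨i', hi', -, hS⟩ := hE j hj
        refine ⟨k, hk, hkβ, (h i' hi').trans ?_⟩
        rw [← hS]
        exact (hu k hk).2.2 j hj hf

/-- The condition `GridFeasible` for the `k`-th probability of inspection and the share `j / N`,
where the variable `ιq` holds `ceilShare`. -/
@[simp] def feasibleTest : Test :=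
  .and
    (.not (.rlt (.arr τF (.lit 0) (.var ιj))
      (.add (.arr τF (.lit 0) (.var ιq)) (.row τκS (.lit 0)))))
    (.not (.rlt (.arr τF (.lit 0) (.var ιj)) (.row τκS (.lit 0))))

/-- The `k`-th probability of inspection `b`, the factor `t` by which it reduces the share of an
unsafe agent, and the base utility `u`. -/
def gridInit : Program :=
  .rset ρb (.add (.var ρβ) (shareExp ιk)) ;;
    .cond (.rlt .one (.var ρb)) (.rset ρb .one) .skip ;;
    .rset ρt (.mul (.sub .one (.var ρb)) (.sub .one (.row τα (.lit 0)))) ;;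
    .rset ρu (.sub (.var ρV) (.mul (.var ρb) (.row τκI (.lit 0)))) ;;
    .iset ιj (.lit 0) ;; .iset ιq (.lit 0)

/-- The best utility over the shares `j / N` at the `k`-th probability of inspection. -/
def computeUtility : Program :=
  gridInit ;;
    .loop (.ilt (.var ιj) (.add (.var ιN) (.lit 1)))
      (.cond (.rlt (.ofInt (.var ιq)) (.mul (.var ρt) (.ofInt (.var ιj))))
        (.incr ιq)
        (.cond feasibleTest
          (.raise ρu (.sub (.mul (.sub .one (shareExp ιj)) (.arr τF (.lit 1) (.var ιj)))
            (.mul (.var ρb) (.row τκI (.lit 0))))) .skip ;;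
          .incr ιj))

theorem runs_computeUtility {n N k : ℕ} {a : Agent n} (ha : a.Admissible) {σ : Memory}
    (hσ : HoldsAgent a N σ) (hβ : σ.rvar ρβ = a.betaMin) (hV : IsBase a (σ.rvar ρV))
    (hE : IsEnvelope a N (σ.rarr τF 0) (σ.rarr τF 1)) (hk : σ.ivar ιk = k) (hkN : k ≤ N) :
    Runs computeUtility σ (300 * (N + 1)) fun τ => τ.rvar ρb = a.gridProb N k ∧
      τ.rvar ρu ≤ a.bestUtility (a.gridProb N k) ∧
      σ.rvar ρV - a.gridProb N k * a.κI ≤ τ.rvar ρu ∧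
      ∀ j ≤ N, a.GridFeasible N k j →
        (1 - j / N) * σ.rarr τF 1 j - a.gridProb N k * a.κI ≤ τ.rvar ρu := by
  have hb := ha.gridProb_mem N k
  have ht := ha.unsafeFactor_mem (β := a.gridProb N k) ⟨ha.betaMin_mem.1.trans hb.1, hb.2⟩
  refine Runs.mono (Runs.init_loop (2 * (N + 1))
    (fun τ => 2 * (N + 1) - (τ.ivar ιj + τ.ivar ιq))
    (fun τ => τ.rvar ρb = a.gridProb N k ∧
      τ.rvar ρt = (1 - a.gridProb N k) * (1 - a.α) ∧
      τ.rvar ρu ≤ a.bestUtility (a.gridProb N k) ∧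
      σ.rvar ρV - a.gridProb N k * a.κI ≤ τ.rvar ρu ∧
      τ.ivar ιj ≤ N + 1 ∧ τ.ivar ιq ≤ a.ceilShare N k (τ.ivar ιj) ∧
      ∀ j < τ.ivar ιj, a.GridFeasible N k j →
        (1 - j / N) * σ.rarr τF 1 j - a.gridProb N k * a.κI ≤ τ.rvar ρu)
    ?_ (fun τ hA hI hb => Runs.of_wp ?_) fun τ hA hI hb => ?_) ?_ fun _ _ h => h
  · have := hV.sound _ hb
    simp [gridInit, hβ, hk, hσ.α_eq, hσ.κI_eq, shareExp_eval hσ.N_eq (hk.trans_le hkN)]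
    refine ⟨fun hlt => ?_, fun hle => ?_⟩
    · have h1 : a.gridProb N k = 1 := min_eq_left hlt.le
      rw [h1] at this ⊢
      exact ⟨rfl, .inl (sub_self _), by linarith, by linarith⟩
    · have h1 : a.gridProb N k = a.betaMin + k / N := min_eq_right hle
      simp [← h1]
      linarith
  · obtain ⟨h₁, h₂, h₃, h₄, h₅, h₆, h₇⟩ := hI
    have hl := hA.ivar ιl rfl
    have hN := (hA.ivar ιN rfl).trans hσ.N_eq
    have hF := hA.rarr τF rfl
    have H := hσ.of_agree hA rfl
    have hκS := H.κS_eq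
    have hκI := H.κI_eq
    rw [hl] at hκS hκI
    simp only [Test.Holds, IExp.eval, hN] at hb
    have hceil : a.ceilShare N k (τ.ivar ιj) ≤ τ.ivar ιj := by
      refine Nat.ceil_le.2 (mul_le_of_le_one_left (Nat.cast_nonneg _) ht.2)
    simp [-tsub_le_iff_right, hl, hF, hκS, hκI, h₁, h₂, shareExp_eval hN (Nat.lt_succ_iff.1 hb)]
    obtain ⟨i, hi, hFj, hS⟩ := hE (τ.ivar ιj) (by omega)
    have hnext : a.ceilShare N k (τ.ivar ιj) ≤ a.ceilShare N k (τ.ivar ιj + 1) :=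
      Nat.ceil_mono (mul_le_mul_of_nonneg_left (by push_cast; linarith) ht.1)
    have fin : ∀ u, τ.rvar ρu ≤ u → u ≤ a.bestUtility (a.gridProb N k) →
        (a.GridFeasible N k (τ.ivar ιj) →
          (1 - (τ.ivar ιj : ℝ) / N) * σ.rarr τF 1 (τ.ivar ιj) - a.gridProb N k * a.κI ≤ u) →
        (u ≤ a.bestUtility (a.gridProb N k) ∧ σ.rvar ρV - a.gridProb N k * a.κI ≤ u ∧
          τ.ivar ιj ≤ N ∧ τ.ivar ιq ≤ a.ceilShare N k (τ.ivar ιj + 1) ∧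
          ∀ j ≤ τ.ivar ιj, a.GridFeasible N k j →
            (1 - (j : ℝ) / N) * σ.rarr τF 1 j - a.gridProb N k * a.κI ≤ u) ∧
        2 * (N + 1) - (τ.ivar ιj + 1 + τ.ivar ιq) < 2 * (N + 1) - (τ.ivar ιj + τ.ivar ιq) := by
      intro u hu hu' hf
      refine ⟨⟨hu', h₄.trans hu, by omega, h₆.trans hnext, fun j hj hj' => ?_⟩, by omega⟩
      rcases hj.lt_or_eq with hj | rfl
      · exact (h₇ j hj hj').trans hu
      · exact hf hj'
    refine ⟨fun hlt => ?_, fun hle => ?_⟩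
    · have := Nat.lt_ceil.2 hlt
      exact ⟨⟨h₃, h₄, h₅, this, h₇⟩, by change _ < a.ceilShare N k _ at this; omega⟩
    · have hq : τ.ivar ιq = a.ceilShare N k (τ.ivar ιj) := le_antisymm h₆ (Nat.ceil_le.2 hle)
      obtain ⟨-, -, hFq, -⟩ := hE (τ.ivar ιq) (by omega)
      have hiff : a.GridFeasible N k (τ.ivar ιj) ↔
          σ.rarr τF 0 (τ.ivar ιq) + a.κS ≤ σ.rarr τF 0 (τ.ivar ιj) ∧
            a.κS ≤ σ.rarr τF 0 (τ.ivar ιj) := by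
        rw [hFq, hFj, hq]
        rfl
      refine ⟨fun hf hf' => ⟨fun hlt => ?_, fun hle => ?_⟩, fun hf => ?_⟩
      · refine fin _ hlt.le ?_ fun _ => le_rfl
        rw [hS]
        exact (hiff.2 ⟨hf, hf'⟩).le_bestUtility ha (by omega) hi
      · exact fin _ le_rfl h₃ fun _ => hle
      · refine fin _ le_rfl h₃ fun hg => ?_
        have := hiff.1 hg
        exact absurd (hf this.1) this.2.not_gt
  · obtain ⟨h₁, h₂, h₃, h₄, h₅, h₆, h₇⟩ := hI
    simp only [Test.Holds, IExp.eval, (hA.ivar ιN rfl).trans hσ.N_eq] at hb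
    exact ⟨h₁, h₃, h₄, fun j hj => h₇ j (by omega)⟩
  · simp [gridInit]
    omega

/-- The rows of the current agent in the tables of probabilities and utilities. -/
def computeProfile : Program :=
  .iset ιk (.lit 0) ;; .loop (.ilt (.var ιk) (.add (.var ιN) (.lit 1)))
    (computeUtility ;;
      .rstore τb (.var ιl) (.var ιk) (.var ρb) ;; .rstore τu (.var ιl) (.var ιk) (.var ρu) ;;
      .incr ιk)

theorem runs_computeProfile {n N : ℕ} {a : Agent n} (ha : a.Admissible) {σ : Memory}
    (hσ : HoldsAgent a N σ) (hβ : σ.rvar ρβ = a.betaMin) (hV : IsBase a (σ.rvar ρV))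
    (hE : IsEnvelope a N (σ.rarr τF 0) (σ.rarr τF 1)) :
    Runs computeProfile σ (400 * ((N + 1) * (N + 1))) fun τ =>
      IsProfile a N (τ.rarr τb (σ.ivar ιl)) (τ.rarr τu (σ.ivar ιl)) ∧
        ∀ l ≠ σ.ivar ιl, τ.rarr τb l = σ.rarr τb l ∧ τ.rarr τu l = σ.rarr τu l := by
  refine Runs.mono (Runs.init_loop (N + 1) (fun τ => (N + 1) - τ.ivar ιk)
    (fun τ => τ.ivar ιk ≤ N + 1 ∧
      (∀ l ≠ σ.ivar ιl, τ.rarr τb l = σ.rarr τb l ∧ τ.rarr τu l = σ.rarr τu l) ∧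
      ∀ k < τ.ivar ιk, τ.rarr τb (σ.ivar ιl) k = a.gridProb N k ∧
        τ.rarr τu (σ.ivar ιl) k ≤ a.bestUtility (a.gridProb N k) ∧
        σ.rvar ρV - a.gridProb N k * a.κI ≤ τ.rarr τu (σ.ivar ιl) k ∧
        ∀ j ≤ N, a.GridFeasible N k j →
          (1 - j / N) * σ.rarr τF 1 j - a.gridProb N k * a.κI ≤ τ.rarr τu (σ.ivar ιl) k)
    ?_ (fun τ hA hI hb => Runs.seq (runs_computeUtility ha (hσ.of_agree hA rfl)
      ((hA.rvar ρβ rfl).trans hβ) ((hA.rvar ρV rfl).symm ▸ hV)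
      ((hA.rarr τF rfl).symm ▸ hE) rfl (Nat.lt_succ_iff.1 (by
        simpa only [Test.Holds, IExp.eval, (hA.ivar ιN rfl).trans hσ.N_eq] using hb)))
      fun υ hA' hQ => Runs.of_wp ?_) fun τ hA hI hb => ?_) ?_
    fun _ _ h => h
  · simp
  · obtain ⟨h₁, h₂, h₃⟩ := hI
    obtain ⟨h₄, h₅⟩ := hQ
    have hl := (hA'.ivar ιl rfl).trans (hA.ivar ιl rfl)
    have hk := hA'.ivar ιk rfl
    have hu := hA'.rarr τu rfl
    have hb' := hA'.rarr τb rfl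
    rw [hA.rvar ρV rfl, hA.rarr τF rfl] at h₅
    simp only [Test.Holds, IExp.eval, (hA.ivar ιN rfl).trans hσ.N_eq] at hb
    simp [-tsub_le_iff_right, hl, hk]
    refine ⟨⟨by omega, fun l hll => ⟨?_, ?_⟩, fun k hk => ?_⟩, by omega⟩
    · funext j
      simp [hll, hb', (h₂ l hll).1]
    · funext j
      simp [hll, hu, (h₂ l hll).2]
    · rcases hk.lt_or_eq with hk | rfl
      · simpa [hk.ne, hu, hb', -tsub_le_iff_right] using h₃ k hk
      · simpa [h₄, -tsub_le_iff_right] using h₅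
  · obtain ⟨h₁, h₂, h₃⟩ := hI
    simp only [Test.Holds, IExp.eval, (hA.ivar ιN rfl).trans hσ.N_eq] at hb
    exact ⟨.of_grid ha hV hE (fun k hk => (h₃ k (by omega)).1) fun k hk => (h₃ k (by omega)).2, h₂⟩
  · simp
    linarith [Nat.zero_le (N * N), Nat.zero_le N]

/-- The account of the agent: its row in the tables, its share of `∑ betaMin` and of the largest
Lipschitz constant. -/
def processAgent : Program :=
  computeTop ;; computeBeta ;; computeHull ;; computeBase ;; computeEnvelope ;; computeProfile ;;
    .rset ρΣ (.add (.var ρΣ) (.var ρβ)) ;;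
    .cond (.rlt .zero (.row τκS (.lit 0)))
      (.raise ρΛ (.div
        (.mul (.row τR (.sub (.var ιn) (.lit 1))) (.row τR (.sub (.var ιn) (.lit 1))))
        (.row τκS (.lit 0))))
      .skip

theorem Agent.Admissible.topReward_eq {n : ℕ} {a : Agent n} (ha : a.Admissible) (hn : n - 1 < n) :
    a.topReward = a.R ⟨n - 1, hn⟩ := by
  have := ha.nonempty
  refine le_antisymm (ciSup_le fun i => ha.noDominated.2.monotone ?_) (a.R_le_topReward _)
  exact Fin.mk_le_mk.2 (by omega)

theorem runs_processAgent {n N : ℕ} {a : Agent n} (ha : a.Admissible) {σ : Memory}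
    (hσ : HoldsAgent a N σ) :
    Runs processAgent σ (2000 * (n + (N + 1) * (N + 1))) fun τ =>
      IsProfile a N (τ.rarr τb (σ.ivar ιl)) (τ.rarr τu (σ.ivar ιl)) ∧
      (∀ l ≠ σ.ivar ιl, τ.rarr τb l = σ.rarr τb l ∧ τ.rarr τu l = σ.rarr τu l) ∧
      τ.rvar ρΣ = σ.rvar ρΣ + a.betaMin ∧ (0 ≤ σ.rvar ρΛ → τ.rvar ρΛ = max (σ.rvar ρΛ) a.lip) := by
  have hn : 0 < n := Fin.pos_iff_nonempty.2 ha.nonempty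
  refine Runs.mono (Runs.seq (runs_computeTop ha hσ) fun τ₁ A₁ h₁ =>
    have H₁ := hσ.of_agree A₁ rfl
    Runs.seq (runs_computeBeta ha H₁ h₁) fun τ₂ A₂ h₂ =>
    have H₂ := H₁.of_agree A₂ rfl
    Runs.seq (runs_computeHull ha H₂) fun τ₃ A₃ h₃ =>
    have H₃ := H₂.of_agree A₃ rfl
    Runs.seq (runs_computeBase ha H₃ h₃.2 h₃.1) fun τ₄ A₄ h₄ =>
    have H₄ := H₃.of_agree A₄ rfl
    Runs.seq (runs_computeEnvelope ha H₄ (by rw [A₄.ivar ιh rfl]; exact h₃.2)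
      (by rw [A₄.ivar ιl rfl, A₄.rarr τR rfl, A₄.rarr τc rfl, A₄.ivar ιh rfl, A₄.iarr τst rfl]
          exact h₃.1)) fun τ₅ A₅ h₅ =>
    have H₅ := H₄.of_agree A₅ rfl
    have hl₅ : τ₅.ivar ιl = σ.ivar ιl := by
      rw [A₅.ivar ιl rfl, A₄.ivar ιl rfl, A₃.ivar ιl rfl, A₂.ivar ιl rfl, A₁.ivar ιl rfl]
    have hβ₅ : τ₅.rvar ρβ = a.betaMin := by
      rw [A₅.rvar ρβ rfl, A₄.rvar ρβ rfl, A₃.rvar ρβ rfl, h₂]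
    Runs.seq (runs_computeProfile ha H₅ hβ₅ (by rw [A₅.rvar ρV rfl]; exact h₄) h₅)
      fun τ₆ A₆ h₆ => Runs.of_wp ?_) ?_ fun _ _ h => h
  · have H₆ := H₅.of_agree A₆ rfl
    have hl : τ₆.ivar ιl = σ.ivar ιl := (A₆.ivar ιl rfl).trans hl₅
    have hβ : τ₆.rvar ρβ = a.betaMin := (A₆.rvar ρβ rfl).trans hβ₅
    have hS : τ₆.rvar ρΣ = σ.rvar ρΣ := by
      rw [A₆.rvar ρΣ rfl, A₅.rvar ρΣ rfl, A₄.rvar ρΣ rfl, A₃.rvar ρΣ rfl, A₂.rvar ρΣ rfl,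
        A₁.rvar ρΣ rfl]
    have hΛ : τ₆.rvar ρΛ = σ.rvar ρΛ := by
      rw [A₆.rvar ρΛ rfl, A₅.rvar ρΛ rfl, A₄.rvar ρΛ rfl, A₃.rvar ρΛ rfl, A₂.rvar ρΛ rfl,
        A₁.rvar ρΛ rfl]
    have hb : τ₅.rarr τb = σ.rarr τb := by
      rw [A₅.rarr τb rfl, A₄.rarr τb rfl, A₃.rarr τb rfl, A₂.rarr τb rfl, A₁.rarr τb rfl]
    have hu : τ₅.rarr τu = σ.rarr τu := by
      rw [A₅.rarr τu rfl, A₄.rarr τu rfl, A₃.rarr τu rfl, A₂.rarr τu rfl, A₁.rarr τu rfl]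
    have hR : τ₆.rarr τR (σ.ivar ιl) (n - 1) = a.topReward := by
      rw [ha.topReward_eq (by omega), ← hl]
      exact H₆.table.R_eq ⟨n - 1, by omega⟩
    have hκ := H₆.κS_eq
    rw [hl] at hκ
    rw [hl₅, hb, hu] at h₆
    simp [hl, hβ, hS, hΛ, H₆.n_eq, hR, hκ]
    rw [show a.topReward * a.topReward / a.κS = a.lip by rw [Agent.lip, sq]]
    refine ⟨fun _ => ⟨fun h => ⟨h₆.1, h₆.2, fun _ => (max_eq_right h.le).symm⟩,
      fun h => ⟨h₆.1, h₆.2, fun _ => h⟩⟩, fun h => ⟨h₆.1, h₆.2, fun h0 => ?_⟩⟩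
    -- An agent with `κS = 0` contributes nothing.
    simpa [Agent.lip, le_antisymm h ha.κS_nonneg] using h0
  · simp
    nlinarith

/-! ### Processing all agents -/

/-- The memory holds the instance and the accuracy. -/
structure HoldsInput {m n : ℕ} (A : Fin m → Agent n) (B : ℕ) (ε : ℝ) (σ : Memory) : Prop where
  m_eq : σ.ivar ιm = m
  n_eq : σ.ivar ιn = n
  B_eq : σ.ivar ιB = B
  ε_eq : σ.rvar ρε = ε
  table : ∀ l : Fin m, IsTable (A l) (σ.rarr τR l) (σ.rarr τc l)
  κS_eq : ∀ l : Fin m, σ.rarr τκS l 0 = (A l).κS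
  κI_eq : ∀ l : Fin m, σ.rarr τκI l 0 = (A l).κI
  α_eq : ∀ l : Fin m, σ.rarr τα l 0 = (A l).α

/-- The program leaves the instance and the accuracy as they are. -/
def Program.keepsInput (p : Program) : Bool :=
  !p.writesI ιm && !p.writesI ιn && !p.writesI ιB && !p.writesR ρε && !p.writesRArr τR &&
    !p.writesRArr τc && !p.writesRArr τκS && !p.writesRArr τκI && !p.writesRArr τα

theorem HoldsInput.of_agree {m n B : ℕ} {A : Fin m → Agent n} {ε : ℝ} {σ τ : Memory} {p : Program}
    (h : HoldsInput A B ε σ) (hA : Agree p σ τ) (hp : p.keepsInput = true) :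
    HoldsInput A B ε τ := by
  simp only [Program.keepsInput, Bool.and_eq_true, Bool.not_eq_true'] at hp
  obtain ⟨⟨⟨⟨⟨⟨⟨⟨h₁, h₂⟩, h₃⟩, h₄⟩, h₅⟩, h₆⟩, h₇⟩, h₈⟩, h₉⟩ := hp
  refine ⟨?_, ?_, ?_, ?_, ?_, ?_, ?_, ?_⟩ <;>
    simp only [hA.ivar _ h₁, hA.ivar _ h₂, hA.ivar _ h₃, hA.rvar _ h₄, hA.rarr _ h₅, hA.rarr _ h₆,
      hA.rarr _ h₇, hA.rarr _ h₈, hA.rarr _ h₉]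
  exacts [h.m_eq, h.n_eq, h.B_eq, h.ε_eq, h.table, h.κS_eq, h.κI_eq, h.α_eq]

theorem HoldsInput.holdsAgent {m n B N : ℕ} {A : Fin m → Agent n} {ε : ℝ} {σ : Memory}
    (h : HoldsInput A B ε σ) (hN : σ.ivar ιN = N) (hl : σ.ivar ιl < m) :
    HoldsAgent (A ⟨σ.ivar ιl, hl⟩) N σ :=
  ⟨h.n_eq, hN, h.table ⟨_, hl⟩, h.κS_eq ⟨_, hl⟩, h.κI_eq ⟨_, hl⟩, h.α_eq ⟨_, hl⟩⟩

theorem Agent.Admissible.lip_nonneg {n : ℕ} {a : Agent n} (ha : a.Admissible) : 0 ≤ a.lip :=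
  div_nonneg (sq_nonneg _) ha.κS_nonneg

theorem lip_le_lipBound {m n : ℕ} (A : Fin m → Agent n) (l : Fin m) : (A l).lip ≤ lipBound A :=
  le_ciSup (f := fun l => (A l).lip) (Set.finite_range _).bddAbove l

/-- All agents are processed in turn. -/
def processAll : Program :=
  (.iset ιl (.lit 0) ;; .rset ρΣ .zero ;; .rset ρΛ .zero) ;;
    .loop (.ilt (.var ιl) (.var ιm)) (processAgent ;; .incr ιl)

theorem runs_processAll {m n B N : ℕ} {A : Fin m → Agent n} {ε : ℝ}
    (hA : ∀ l, (A l).Admissible) (hm : 0 < m) {σ : Memory} (hσ : HoldsInput A B ε σ)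
    (hN : σ.ivar ιN = N) :
    Runs processAll σ (3000 * (m * (n + (N + 1) * (N + 1)))) fun τ =>
      (∀ l : Fin m, IsProfile (A l) N (τ.rarr τb l) (τ.rarr τu l)) ∧
        τ.rvar ρΣ = ∑ l, (A l).betaMin ∧ τ.rvar ρΛ = lipBound A := by
  have hne : Nonempty (Fin m) := ⟨⟨0, hm⟩⟩
  set f : ℕ → ℝ := fun l => if hl : l < m then (A ⟨l, hl⟩).betaMin else 0 with hf
  refine Runs.mono (Runs.init_loop m (fun τ => m - τ.ivar ιl)
    (fun τ => τ.ivar ιl ≤ m ∧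
      (∀ l : Fin m, l < τ.ivar ιl → IsProfile (A l) N (τ.rarr τb l) (τ.rarr τu l)) ∧
      τ.rvar ρΣ = ∑ l ∈ Finset.range (τ.ivar ιl), f l ∧ 0 ≤ τ.rvar ρΛ ∧
      (∀ l : Fin m, l < τ.ivar ιl → (A l).lip ≤ τ.rvar ρΛ) ∧ τ.rvar ρΛ ≤ lipBound A)
    ?_ (fun τ hAg hI hb =>
      have hb' : τ.ivar ιl < m := by
        simpa only [Test.Holds, IExp.eval, (hAg.ivar ιm rfl).trans hσ.m_eq] using hb
      Runs.seq (runs_processAgent (hA _) ((hσ.of_agree hAg rfl).holdsAgent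
        ((hAg.ivar ιN rfl).trans hN) hb')) fun υ hAg' hQ => Runs.of_wp ?_)
    fun τ hAg hI hb => ?_) ?_ fun _ _ h => h
  · simpa using (hA ⟨0, hm⟩).lip_nonneg.trans (lip_le_lipBound A _)
  · obtain ⟨h₁, h₂, h₃, h₄, h₅, h₆⟩ := hI
    obtain ⟨h₇, h₈, h₉, h₁₀⟩ := hQ
    replace h₁₀ := h₁₀ h₄
    have hl := hAg'.ivar ιl rfl
    simp only [Program.wp, Program.incr, IExp.eval, setI_ivar, setI_rvar, setI_rarr, if_pos, hl]
    refine ⟨⟨hb', fun l hl => ?_, ?_, ?_, fun l hl => ?_, ?_⟩, by omega⟩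
    · rcases (Nat.lt_succ_iff.1 hl).lt_or_eq with hl | hl
      · rw [(h₈ l hl.ne).1, (h₈ l hl.ne).2]
        exact h₂ l hl
      · obtain rfl : l = ⟨_, hb'⟩ := Fin.ext hl
        exact h₇
    · rw [h₉, h₃, Finset.sum_range_succ, hf]
      simp [hb']
    · rw [h₁₀]
      exact h₄.trans (le_max_left _ _)
    · rw [h₁₀]
      rcases (Nat.lt_succ_iff.1 hl).lt_or_eq with hl | hl
      · exact (h₅ l hl).trans (le_max_left _ _)
      · obtain rfl : l = ⟨_, hb'⟩ := Fin.ext hl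
        exact le_max_right _ _
    · rw [h₁₀]
      exact max_le h₆ (lip_le_lipBound A _)
  · obtain ⟨h₁, h₂, h₃, h₄, h₅, h₆⟩ := hI
    simp only [Test.Holds, IExp.eval, (hAg.ivar ιm rfl).trans hσ.m_eq] at hb
    have hl : τ.ivar ιl = m := by omega
    refine ⟨fun l => h₂ l (by omega), ?_, le_antisymm h₆ (ciSup_le fun l => h₅ l (by omega))⟩
    rw [h₃, hl, Finset.sum_range]
    exact Finset.sum_congr rfl fun l _ => by simp [hf]
  · have : 1 ≤ m * (n + (N + 1) * (N + 1)) := Nat.mul_pos hm (by positivity)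
    have : m ≤ m * (n + (N + 1) * (N + 1)) := Nat.le_mul_of_pos_right _ (by positivity)
    simp
    linarith

/-- The number of steps of length `1 / N` in the budget that remains above `∑ betaMin`. -/
def countBudget : Program :=
  .iset ιK (.lit 0) ;; .loop
    (.not (.rlt (.mul (.sub (.ofInt (.var ιB)) (.var ρΣ)) (.ofInt (.var ιN)))
      (.ofInt (.add (.var ιK) (.lit 1))))) (.incr ιK)

theorem runs_countBudget {B N : ℕ} {s : ℝ} {σ : Memory} (hB : σ.ivar ιB = B)
    (hN : σ.ivar ιN = N) (hs : σ.rvar ρΣ = s) (hs0 : 0 ≤ s) (hsB : s ≤ B) :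
    Runs countBudget σ (50 * (B * N + 1)) fun τ => τ.ivar ιK ≤ B * N ∧
      (τ.ivar ιK : ℝ) ≤ (B - s) * N ∧ (B - s) * N < τ.ivar ιK + 1 := by
  have hle : ∀ k : ℕ, (k : ℝ) ≤ (B - s) * N → k ≤ B * N := by
    intro k hk
    have : (k : ℝ) ≤ B * N :=
      hk.trans (mul_le_mul_of_nonneg_right (by linarith) (Nat.cast_nonneg _))
    exact_mod_cast this
  refine Runs.mono (Runs.init_loop (B * N) (fun τ => B * N - τ.ivar ιK)
    (fun τ => (τ.ivar ιK : ℝ) ≤ (B - s) * N)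
    ?_ (fun τ hA hI hb => Runs.of_wp ?_) fun τ hA hI hb => ?_) ?_ fun _ _ h => h
  · simpa using mul_nonneg (sub_nonneg.2 hsB) (Nat.cast_nonneg N)
  · simp [hA.ivar ιB rfl, hA.ivar ιN rfl, hA.rvar ρΣ rfl, hB, hN, hs] at hb
    have := hle (τ.ivar ιK + 1) (by exact_mod_cast hb)
    simp
    exact ⟨hb, by omega⟩
  · simp [hA.ivar ιB rfl, hA.ivar ιN rfl, hA.rvar ρΣ rfl, hB, hN, hs] at hb
    exact ⟨hle _ hI, hI, hb⟩
  · simp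
    omega

/-! ### The dynamic program -/

/-- The `l`-th step of the dynamic program: `D (l + 1) j` is the largest value that the first
`l + 1` agents can reach with `j` steps of the budget, and `ch l j` is the number of steps that
agent `l` receives in an optimal solution. -/
structure IsBellman (u D : ℕ → ℕ → ℝ) (ch : ℕ → ℕ → ℕ) (N K l : ℕ) : Prop where
  le_N : ∀ j ≤ K, ch l j ≤ N
  le_self : ∀ j ≤ K, ch l j ≤ j
  eq : ∀ j ≤ K, D (l + 1) j = D l (j - ch l j) + u l (ch l j)
  ge : ∀ j ≤ K, ∀ k ≤ N, k ≤ j → D l (j - k) + u l k ≤ D (l + 1) j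

theorem IsBellman.sum_le {u D : ℕ → ℕ → ℝ} {ch : ℕ → ℕ → ℕ} {N K m : ℕ}
    (h₀ : ∀ j, D 0 j = 0) (h : ∀ l < m, IsBellman u D ch N K l) {κ : ℕ → ℕ}
    (hκ : ∀ l < m, κ l ≤ N) :
    ∀ l ≤ m, ∀ j ≤ K, ∑ i ∈ Finset.range l, κ i ≤ j →
      ∑ i ∈ Finset.range l, u i (κ i) ≤ D l j := by
  intro l
  induction l with
  | zero => simp [h₀]
  | succ l ih =>
    intro hl j hj hs
    rw [Finset.sum_range_succ] at hs ⊢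
    have := ih (by omega) (j - κ l) (by omega) (by omega)
    linarith [(h l hl).ge j hj (κ l) (hκ l hl) (by omega)]

@[simp] def bellmanExp (k : IExp) : RExp :=
  .add (.arr τD (.var ιl) (.sub (.var ιj) k)) (.arr τu (.var ιl) k)

/-- The best number of steps for the current agent when `j` steps are left for it and its
predecessors. -/
def computeCell : Program :=
  (.rset ρv (bellmanExp (.lit 0)) ;; .iset ιq (.lit 0) ;; .iset ιk (.lit 0)) ;;
    .loop (.and (.ilt (.var ιk) (.add (.var ιN) (.lit 1)))
        (.ilt (.var ιk) (.add (.var ιj) (.lit 1))))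
      (.cond (.rlt (.var ρv) (bellmanExp (.var ιk)))
        (.rset ρv (bellmanExp (.var ιk)) ;; .iset ιq (.var ιk)) .skip ;; .incr ιk)

theorem runs_computeCell {N : ℕ} {σ : Memory} (hN : σ.ivar ιN = N) :
    Runs computeCell σ (100 * (N + 1)) fun τ => τ.ivar ιq ≤ N ∧ τ.ivar ιq ≤ σ.ivar ιj ∧
      τ.rvar ρv = σ.rarr τD (σ.ivar ιl) (σ.ivar ιj - τ.ivar ιq)
        + σ.rarr τu (σ.ivar ιl) (τ.ivar ιq) ∧
      ∀ k ≤ N, k ≤ σ.ivar ιj →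
        σ.rarr τD (σ.ivar ιl) (σ.ivar ιj - k) + σ.rarr τu (σ.ivar ιl) k ≤ τ.rvar ρv := by
  refine Runs.mono (Runs.init_loop (N + 1) (fun τ => N + 1 - τ.ivar ιk)
    (fun τ => τ.ivar ιq ≤ N ∧ τ.ivar ιq ≤ σ.ivar ιj ∧
      τ.rvar ρv = σ.rarr τD (σ.ivar ιl) (σ.ivar ιj - τ.ivar ιq)
        + σ.rarr τu (σ.ivar ιl) (τ.ivar ιq) ∧
      ∀ k < τ.ivar ιk,
        σ.rarr τD (σ.ivar ιl) (σ.ivar ιj - k) + σ.rarr τu (σ.ivar ιl) k ≤ τ.rvar ρv)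
    ?_ (fun τ hA hI hb => Runs.of_wp ?_) fun τ hA hI hb => ?_) ?_ fun _ _ h => h
  · simp
  · obtain ⟨h₁, h₂, h₃, h₄⟩ := hI
    have hl := hA.ivar ιl rfl
    have hj := hA.ivar ιj rfl
    have hD := hA.rarr τD rfl
    have hu := hA.rarr τu rfl
    simp [hj, (hA.ivar ιN rfl).trans hN] at hb
    simp [hl, hj, hD, hu]
    refine ⟨fun hlt => ⟨⟨by omega, hb.2, fun k hk => ?_⟩, by omega⟩,
      fun hle => ⟨⟨h₁, h₂, h₃, fun k hk => ?_⟩, by omega⟩⟩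
    · rcases hk.lt_or_eq with hk | rfl
      · exact (h₄ k hk).trans hlt.le
      · rfl
    · rcases hk.lt_or_eq with hk | rfl
      · exact h₄ k hk
      · exact hle
  · obtain ⟨h₁, h₂, h₃, h₄⟩ := hI
    simp [hA.ivar ιj rfl, (hA.ivar ιN rfl).trans hN] at hb
    exact ⟨h₁, h₂, h₃, fun k hk hk' => h₄ k (by omega)⟩
  · simp
    linarith

/-- One step of the dynamic program. -/
def computeRow : Program :=
  .iset ιj (.lit 0) ;; .loop (.ilt (.var ιj) (.add (.var ιK) (.lit 1)))
    (computeCell ;;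
      .rstore τD (.add (.var ιl) (.lit 1)) (.var ιj) (.var ρv) ;;
      .istore τch (.var ιl) (.var ιj) (.var ιq) ;; .incr ιj)

theorem runs_computeRow {N K l : ℕ} {σ : Memory} (hN : σ.ivar ιN = N) (hK : σ.ivar ιK = K)
    (hl : σ.ivar ιl = l) :
    Runs computeRow σ (200 * ((K + 1) * (N + 1))) fun τ =>
      IsBellman (τ.rarr τu) (τ.rarr τD) (τ.iarr τch) N K l ∧
        (∀ i ≤ l, τ.rarr τD i = σ.rarr τD i) ∧ ∀ i < l, τ.iarr τch i = σ.iarr τch i := by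
  refine Runs.mono (Runs.init_loop (K + 1) (fun τ => K + 1 - τ.ivar ιj)
    (fun τ => (∀ i ≤ l, τ.rarr τD i = σ.rarr τD i) ∧ (∀ i < l, τ.iarr τch i = σ.iarr τch i) ∧
      ∀ j < τ.ivar ιj, τ.iarr τch l j ≤ N ∧ τ.iarr τch l j ≤ j ∧
        τ.rarr τD (l + 1) j = σ.rarr τD l (j - τ.iarr τch l j)
          + σ.rarr τu l (τ.iarr τch l j) ∧
        ∀ k ≤ N, k ≤ j → σ.rarr τD l (j - k) + σ.rarr τu l k ≤ τ.rarr τD (l + 1) j)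
    ?_ (fun τ hA hI hb => Runs.seq (runs_computeCell ((hA.ivar ιN rfl).trans hN))
      fun υ hA' hQ => Runs.of_wp ?_) fun τ hA hI hb => ?_) ?_ fun _ _ h => h
  · simp
  · obtain ⟨h₁, h₂, h₃⟩ := hI
    have hlτ := (hA.ivar ιl rfl).trans hl
    have hlυ := (hA'.ivar ιl rfl).trans hlτ
    have hj := hA'.ivar ιj rfl
    have hD := hA'.rarr τD rfl
    have hch := hA'.iarr τch rfl
    rw [hlτ, h₁ l le_rfl, hA.rarr τu rfl] at hQ
    simp only [Test.Holds, IExp.eval, (hA.ivar ιK rfl).trans hK] at hb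
    simp [hlυ, hj]
    refine ⟨⟨fun i hi => ?_, fun i hi => ?_, fun j hj => ?_⟩, by omega⟩
    · funext j
      simp [show i ≠ l + 1 by omega, hD, h₁ i hi]
    · funext j
      simp [hi.ne, hch, h₂ i hi]
    · rcases hj.lt_or_eq with hj | rfl
      · simpa [hj.ne, hD, hch] using h₃ j hj
      · simpa using hQ
  · obtain ⟨h₁, h₂, h₃⟩ := hI
    simp only [Test.Holds, IExp.eval, (hA.ivar ιK rfl).trans hK] at hb
    refine ⟨⟨fun j hj => (h₃ j (by omega)).1, fun j hj => (h₃ j (by omega)).2.1,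
      fun j hj => ?_, fun j hj => ?_⟩, h₁, h₂⟩
    · rw [h₁ l le_rfl, hA.rarr τu rfl]
      exact (h₃ j (by omega)).2.2.1
    · rw [h₁ l le_rfl, hA.rarr τu rfl]
      exact (h₃ j (by omega)).2.2.2
  · simp
    nlinarith

/-- The whole dynamic program. -/
def computeTable : Program :=
  .iset ιl (.lit 0) ;; .loop (.ilt (.var ιl) (.var ιm)) (computeRow ;; .incr ιl)

theorem runs_computeTable {m N K : ℕ} {σ : Memory} (hm : σ.ivar ιm = m) (hN : σ.ivar ιN = N)
    (hK : σ.ivar ιK = K) (h₀ : ∀ j, σ.rarr τD 0 j = 0) :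
    Runs computeTable σ (300 * (m * ((K + 1) * (N + 1)) + 1)) fun τ =>
      (∀ j, τ.rarr τD 0 j = 0) ∧
        ∀ l < m, IsBellman (τ.rarr τu) (τ.rarr τD) (τ.iarr τch) N K l := by
  refine Runs.mono (Runs.init_loop m (fun τ => m - τ.ivar ιl)
    (fun τ => τ.ivar ιl ≤ m ∧ (∀ j, τ.rarr τD 0 j = 0) ∧
      ∀ l < τ.ivar ιl, IsBellman (τ.rarr τu) (τ.rarr τD) (τ.iarr τch) N K l)
    ?_ (fun τ hA hI hb => Runs.seq (runs_computeRow ((hA.ivar ιN rfl).trans hN)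
      ((hA.ivar ιK rfl).trans hK) rfl)
      fun υ hA' hQ => Runs.of_wp ?_) fun τ hA hI hb => ?_) ?_ fun _ _ h => h
  · simpa using h₀
  · obtain ⟨h₁, h₂, h₃⟩ := hI
    obtain ⟨h₄, h₅, h₆⟩ := hQ
    simp only [Test.Holds, IExp.eval, (hA.ivar ιm rfl).trans hm] at hb
    simp [hA'.ivar ιl rfl]
    refine ⟨⟨hb, fun j => ?_, fun l hl => ?_⟩, by omega⟩
    · rw [h₅ 0 (Nat.zero_le _), h₂]
    · rcases hl.lt_or_eq with hl | rfl
      · obtain ⟨b₁, b₂, b₃, b₄⟩ := h₃ l hl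
        rw [← hA'.rarr τu rfl, ← h₅ l hl.le, ← h₅ (l + 1) hl, ← h₆ l hl] at *
        exact ⟨b₁, b₂, b₃, b₄⟩
      · exact h₄
  · obtain ⟨h₁, h₂, h₃⟩ := hI
    simp only [Test.Holds, IExp.eval, (hA.ivar ιm rfl).trans hm] at hb
    exact ⟨h₂, fun l hl => h₃ l (by omega)⟩
  · have : m ≤ m * ((K + 1) * (N + 1)) := Nat.le_mul_of_pos_right _ (by positivity)
    simp
    linarith

/-- The optimal solution of the dynamic program is read off, and the probabilities of inspection
that it stands for are written to the output. -/
def traceBack : Program :=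
  (.iset ιl (.var ιm) ;; .iset ιj (.var ιK)) ;; .loop (.ilt (.lit 0) (.var ιl))
    (.iset ιl (.sub (.var ιl) (.lit 1)) ;; .iset ιq (.arr τch (.var ιl) (.var ιj)) ;;
      .rstore τout (.var ιl) (.lit 0) (.arr τb (.var ιl) (.var ιq)) ;;
      .iset ιj (.sub (.var ιj) (.var ιq)))

theorem runs_traceBack {m N K : ℕ} {σ : Memory} (hm : σ.ivar ιm = m) (hK : σ.ivar ιK = K)
    (h₀ : ∀ j, σ.rarr τD 0 j = 0)
    (h : ∀ l < m, IsBellman (σ.rarr τu) (σ.rarr τD) (σ.iarr τch) N K l) :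
    Runs traceBack σ (50 * (m + 1)) fun τ => ∃ κ : ℕ → ℕ,
      (∀ l < m, κ l ≤ N ∧ τ.rarr τout l 0 = σ.rarr τb l (κ l)) ∧
        ∑ l ∈ Finset.range m, κ l ≤ K ∧
        σ.rarr τD m K = ∑ l ∈ Finset.range m, σ.rarr τu l (κ l) := by
  refine Runs.mono (Runs.init_loop m (fun τ => τ.ivar ιl)
    (fun τ => τ.ivar ιl ≤ m ∧ ∃ κ : ℕ → ℕ,
      (∀ l < m, τ.ivar ιl ≤ l → κ l ≤ N ∧ τ.rarr τout l 0 = σ.rarr τb l (κ l)) ∧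
        ∑ l ∈ Finset.Ico (τ.ivar ιl) m, κ l + τ.ivar ιj = K ∧
        σ.rarr τD m K = ∑ l ∈ Finset.Ico (τ.ivar ιl) m, σ.rarr τu l (κ l)
          + σ.rarr τD (τ.ivar ιl) (τ.ivar ιj))
    ?_ (fun τ hA hI hb => Runs.of_wp ?_) fun τ hA hI hb => ?_) ?_ fun _ _ h => h
  · simp [hm, hK]
    exact ⟨0, fun l hl hl' => by omega⟩
  · obtain ⟨h₁, κ, h₂, h₃, h₄⟩ := hI
    simp only [Test.Holds, IExp.eval] at hb
    obtain ⟨l, hl⟩ : ∃ l, τ.ivar ιl = l + 1 := ⟨τ.ivar ιl - 1, by omega⟩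
    rw [hl] at h₁ h₂ h₃ h₄
    have hbell := h l (by omega)
    have hj : τ.ivar ιj ≤ K := by omega
    have hch := hA.iarr τch rfl
    have hb' := hA.rarr τb rfl
    simp [hl, hch, hb']
    set κ' := Function.update κ l (σ.iarr τch l (τ.ivar ιj)) with hκ'
    have hself : κ' l = σ.iarr τch l (τ.ivar ιj) := Function.update_self ..
    have hne : ∀ i, l + 1 ≤ i → κ' i = κ i := fun i hi =>
      Function.update_of_ne (Nat.ne_of_gt hi) _ _
    refine ⟨by omega, κ', fun i hi hli => ?_, ?_, ?_⟩
    · rcases hli.eq_or_lt with rfl | hli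
      · simpa [hself] using hbell.le_N _ hj
      · simpa [hne i hli, Nat.ne_of_gt hli] using h₂ i hi hli
    · have : ∑ i ∈ Finset.Ico (l + 1) m, κ' i = ∑ i ∈ Finset.Ico (l + 1) m, κ i :=
        Finset.sum_congr rfl fun i hi => hne i (Finset.mem_Ico.1 hi).1
      rw [Finset.sum_eq_sum_Ico_succ_bot (by omega), hself, this]
      have := hbell.le_self _ hj
      omega
    · have : ∑ i ∈ Finset.Ico (l + 1) m, σ.rarr τu i (κ' i)
          = ∑ i ∈ Finset.Ico (l + 1) m, σ.rarr τu i (κ i) :=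
        Finset.sum_congr rfl fun i hi => by rw [hne i (Finset.mem_Ico.1 hi).1]
      rw [Finset.sum_eq_sum_Ico_succ_bot (by omega), h₄, hbell.eq _ hj, hself, this]
      ring
  · obtain ⟨h₁, κ, h₂, h₃, h₄⟩ := hI
    simp only [Test.Holds, IExp.eval, not_lt, Nat.le_zero] at hb
    rw [hb, Nat.Ico_zero_eq_range] at h₃ h₄
    rw [h₀, add_zero] at h₄
    exact ⟨κ, fun l hl => h₂ l hl (by omega), by omega, h₄⟩
  · simp
    omega

/-! ### Solutions for a fixed fineness of the grid -/

/-- What the solution for the fineness `N` provides: a feasible allocation of value at least `v`,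
where `v` is optimal up to the error of the discretization. -/
structure IsSolution {m n : ℕ} (A : Fin m → Agent n) (B N : ℕ) (b : Fin m → ℝ) (v : ℝ) : Prop where
  feasible : Feasible A B b
  le_total : v ≤ total A b
  total_le : ∀ b', Feasible A B b' → total A b' ≤ v + 4 * m * lipBound A / (max N 1 : ℕ)

/-- On the grid, an agent that receives the budget `b` can be served with `k` steps above
`betaMin`. -/
theorem IsProfile.exists_step {n N : ℕ} {a : Agent n} (ha : a.Admissible) {p u : ℕ → ℝ}
    (h : IsProfile a N p u) {b : ℝ} (hb : b ∈ Set.Icc a.betaMin 1) :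
    ∃ k ≤ N, a.betaMin + k / N ≤ b ∧ a.bestUtility b ≤ u k + a.gridError N := by
  have hne := ha.nonempty
  obtain ⟨i, hi⟩ := a.exists_isBest 1
  have himp := ha.implements_of_betaMin_le hb hi
  classical
  let s : Finset ℕ := (Finset.range (N + 1)).filter fun k => a.betaMin + (k : ℝ) / N ≤ b
  have hs : ∀ k, k ∈ s ↔ k ≤ N ∧ a.betaMin + (k : ℝ) / N ≤ b := by
    intro k
    simp [s]
  obtain ⟨k₀, hk₀, hk₀', -⟩ := h.complete _ _ _ himp
  obtain ⟨k, hk, hmax⟩ := s.exists_max_image u ⟨k₀, (hs k₀).2 ⟨hk₀, hk₀'⟩⟩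
  refine ⟨k, ((hs k).1 hk).1, ((hs k).1 hk).2, csSup_le ⟨_, 1, b, i, himp, le_rfl, rfl⟩ ?_⟩
  rintro _ ⟨γ, β, j, hj, hβ, rfl⟩
  obtain ⟨k', hk', hkβ, hu⟩ := h.complete _ _ _ hj
  have := hmax k' ((hs k').2 ⟨hk', hkβ.trans hβ⟩)
  linarith

/-- An optimal solution of the dynamic program solves the allocation problem up to the error of the
discretization. -/
theorem isSolution_of_bellman {m n B N K : ℕ} {A : Fin m → Agent n} (hA : ∀ l, (A l).Admissible)
    (hfeas : ∑ l, (A l).betaMin ≤ (B : ℝ)) {p u D : ℕ → ℕ → ℝ} {ch : ℕ → ℕ → ℕ}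
    (hp : ∀ l : Fin m, IsProfile (A l) N (p l) (u l))
    (hK : (K : ℝ) ≤ (B - ∑ l, (A l).betaMin) * N) (hK' : (B - ∑ l, (A l).betaMin) * N < K + 1)
    (h₀ : ∀ j, D 0 j = 0) (h : ∀ l < m, IsBellman u D ch N K l) {κ : ℕ → ℕ}
    (hκN : ∀ l < m, κ l ≤ N) (hκK : ∑ l ∈ Finset.range m, κ l ≤ K)
    (hD : D m K = ∑ l ∈ Finset.range m, u l (κ l)) :
    IsSolution A B N (fun l => p l (κ l)) (D m K) := by
  have hN0 : (0 : ℝ) ≤ N := Nat.cast_nonneg _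
  have hpκ : ∀ l : Fin m, p l (κ l) = (A l).gridProb N (κ l) := fun l =>
    (hp l).prob _ (hκN l l.2)
  refine ⟨⟨fun l => ?_, ?_⟩, ?_, fun b' hb' => ?_⟩
  · simp only [hpκ]
    exact (hA l).gridProb_mem _ _
  · have h₁ : ∑ l : Fin m, p l (κ l) ≤ ∑ l : Fin m, ((A l).betaMin + (κ l : ℝ) / N) :=
      Finset.sum_le_sum fun l _ => by
        rw [hpκ]
        exact min_le_right _ _
    have h₂ : ∑ l : Fin m, (κ l : ℝ) ≤ K := by
      rw [Finset.sum_range] at hκK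
      exact_mod_cast hκK
    have h₃ : (K : ℝ) / N ≤ B - ∑ l, (A l).betaMin :=
      div_le_of_le_mul₀ hN0 (sub_nonneg.2 hfeas) hK
    rw [Finset.sum_add_distrib, ← Finset.sum_div] at h₁
    have h₄ := div_le_div_of_nonneg_right h₂ hN0
    linarith
  · rw [hD, Finset.sum_range]
    refine Finset.sum_le_sum fun l _ => ?_
    simp only [hpκ]
    exact (hp l).sound _ (hκN l l.2)
  · choose k hkN hkb hku using fun l => (hp l).exists_step (hA l) (hb'.1 l)
    have hsum : ∑ l, (k l : ℝ) ≤ (B - ∑ l, (A l).betaMin) * N := by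
      have h₁ : ∀ l, (k l : ℝ) ≤ (b' l - (A l).betaMin) * N := fun l => by
        rcases Nat.eq_zero_or_pos N with rfl | hN
        · simpa using hkN l
        · rw [← div_le_iff₀ (by exact_mod_cast hN)]
          linarith [hkb l]
      refine (Finset.sum_le_sum fun l _ => h₁ l).trans ?_
      rw [← Finset.sum_mul, Finset.sum_sub_distrib]
      exact mul_le_mul_of_nonneg_right (sub_le_sub_right hb'.2 _) hN0
    have hkK : ∑ l, k l ≤ K := by
      have : ((∑ l, k l : ℕ) : ℝ) < K + 1 := by
        push_cast
        exact hsum.trans_lt hK'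
      exact Nat.lt_succ_iff.1 (by exact_mod_cast this)
    let k' : ℕ → ℕ := fun l => if hl : l < m then k ⟨l, hl⟩ else 0
    have hk' : ∀ l : Fin m, k' l = k l := fun l => by simp [k']
    have h₁ := IsBellman.sum_le h₀ h (κ := k') (fun l hl => (hk' ⟨l, hl⟩).symm ▸ hkN _) m le_rfl K
      le_rfl (by simpa only [Finset.sum_range, hk'] using hkK)
    simp only [Finset.sum_range, hk'] at h₁
    have h₂ : total A b' ≤ ∑ l : Fin m, (u l (k l) + (A l).gridError N) :=
      Finset.sum_le_sum fun l _ => hku l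
    have h₃ : ∑ l : Fin m, (A l).gridError N ≤ ∑ l : Fin m, 4 * lipBound A / (max N 1 : ℕ) :=
      Finset.sum_le_sum fun l _ => div_le_div_of_nonneg_right
        (by linarith [lip_le_lipBound A l]) (Nat.cast_nonneg _)
    rw [Finset.sum_const, Finset.card_univ, Fintype.card_fin, nsmul_eq_mul] at h₃
    rw [Finset.sum_add_distrib] at h₂
    have h₄ : (m : ℝ) * (4 * lipBound A / (max N 1 : ℕ))
        = 4 * m * lipBound A / (max N 1 : ℕ) := by ring
    linarith

/-- The best solution for the fineness `N` of the grid. -/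
def solve : Program :=
  processAll ;; countBudget ;; computeTable ;; traceBack ;;
    .rset ρW (.arr τD (.var ιm) (.var ιK))

theorem runs_solve {m n B N : ℕ} {A : Fin m → Agent n} {ε : ℝ}
    (hA : ∀ l, (A l).Admissible) (hm : 0 < m) (hfeas : ∑ l, (A l).betaMin ≤ (B : ℝ)) {σ : Memory}
    (hσ : HoldsInput A B ε σ) (hN : σ.ivar ιN = N) (h₀ : ∀ j, σ.rarr τD 0 j = 0) :
    Runs solve σ (4000 * (m * (n + (N + 1) * (N + 1) + (B * N + 1) * (N + 1)))) fun τ =>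
      (∀ j, τ.rarr τD 0 j = 0) ∧ τ.rvar ρΛ = lipBound A ∧
        IsSolution A B N (fun l => τ.rarr τout l 0) (τ.rvar ρW) := by
  refine Runs.mono (Runs.seq (runs_processAll hA hm hσ hN) fun τ₁ A₁ h₁ =>
    have H₁ := hσ.of_agree A₁ rfl
    have N₁ : τ₁.ivar ιN = N := (A₁.ivar ιN rfl).trans hN
    Runs.seq (runs_countBudget H₁.B_eq N₁ h₁.2.1
      (Finset.sum_nonneg fun l _ => (hA l).betaMin_mem.1) hfeas)
      (U := 300 * (m * ((B * N + 1) * (N + 1)) + 1) + (50 * (m + 1) + 5)) fun τ₂ A₂ h₂ =>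
    have H₂ := H₁.of_agree A₂ rfl
    Runs.mono (Runs.seq (runs_computeTable H₂.m_eq ((A₂.ivar ιN rfl).trans N₁) rfl (by
      rw [A₂.rarr τD rfl, A₁.rarr τD rfl]; exact h₀)) fun τ₃ A₃ h₃ =>
    have H₃ := H₂.of_agree A₃ rfl
    Runs.seq (runs_traceBack H₃.m_eq (A₃.ivar ιK rfl) h₃.1 h₃.2) fun τ₄ A₄ h₄ =>
      Runs.of_wp ?_) ?_ fun _ _ h => h) ?_ fun _ _ h => h
  · have H₄ := H₃.of_agree A₄ rfl
    obtain ⟨κ, hκ, hκK, hD⟩ := h₄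
    obtain ⟨h₅, h₆, h₇⟩ := h₁
    have hK : τ₄.ivar ιK = τ₂.ivar ιK := (A₄.ivar ιK rfl).trans (A₃.ivar ιK rfl)
    have hΛ : τ₄.rvar ρΛ = lipBound A := by
      rw [A₄.rvar ρΛ rfl, A₃.rvar ρΛ rfl, A₂.rvar ρΛ rfl, h₇]
    have hb : τ₃.rarr τb = τ₁.rarr τb := (A₃.rarr τb rfl).trans (A₂.rarr τb rfl)
    have hu : τ₃.rarr τu = τ₁.rarr τu := (A₃.rarr τu rfl).trans (A₂.rarr τu rfl)
    simp [H₄.m_eq, hK, A₄.rarr τD rfl, h₃.1, hΛ]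
    have hsol := isSolution_of_bellman hA hfeas (fun l => hb.symm ▸ hu.symm ▸ h₅ l) h₂.2.1 h₂.2.2
      h₃.1 h₃.2 (fun l hl => (hκ l hl).1) hκK hD
    convert hsol using 2 with l
    exact (hκ l l.2).2
  · have : (τ₂.ivar ιK + 1) * (N + 1) ≤ (B * N + 1) * (N + 1) :=
      Nat.mul_le_mul_right _ (by omega)
    have := Nat.mul_le_mul_left m this
    simp
    linarith
  · have h₁ : B * N + 1 ≤ (B * N + 1) * (N + 1) := Nat.le_mul_of_pos_right _ (by omega)
    have h₂ : (B * N + 1) * (N + 1) ≤ m * ((B * N + 1) * (N + 1)) := Nat.le_mul_of_pos_left _ hm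
    have h₃ : m ≤ m * ((B * N + 1) * (N + 1)) := Nat.le_mul_of_pos_right _ (by positivity)
    have h₄ : ∀ X Y, m * (n + X + Y) = m * n + m * X + m * Y := fun X Y => by ring
    have h₅ : ∀ X, m * (n + X) = m * n + m * X := fun X => by ring
    rw [h₄, h₅]
    omega

/-! ### Refinement of the grid -/

/-- Refines the grid until the error of the discretization is at most `θ`; both sides of this test
are multiplied by `max N 1`. The first round takes place at the fineness `0`, where its cost does
not involve `B`: when `lipBound` is small, the bound on the running time leaves no room for more. -/
def refine (θ : RExp) : Program :=
  (.iset ιN (.lit 0) ;; solve) ;;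
    .loop (.rlt
      (.mul θ (.ofInt (.add (.var ιN) (.sub (.lit 1) (.var ιN)))))
      (.mul (.mul (.ofInt (.lit 4)) (.ofInt (.var ιm))) (.var ρΛ)))
      (.iset ιN (.add (.add (.var ιN) (.var ιN)) (.sub (.lit 1) (.var ιN))) ;; solve)

/-- The fineness of the grid in the `s`-th round: `0, 1, 2, 4, 8, …`. -/
def fineness (s : ℕ) : ℕ := if s = 0 then 0 else 2 ^ (s - 1)

theorem fineness_succ (s : ℕ) : fineness (s + 1) = 2 ^ s := by simp [fineness]

theorem fineness_double (s : ℕ) :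
    fineness s + fineness s + (1 - fineness s) = fineness (s + 1) := by
  rcases s with _ | s
  · simp [fineness]
  · have : 0 < 2 ^ s := by positivity
    rw [fineness_succ, fineness_succ, pow_succ]
    omega

theorem add_one_tsub_eq_max (N : ℕ) : N + (1 - N) = max N 1 := by omega

/-- The time that `solve` takes in the round with fineness `2 ^ s`, with the cost of the round
itself. -/
theorem round_cost_le {m n B : ℕ} (hm : 0 < m) (hB : 0 < B) (s : ℕ) :
    4000 * (m * (n + (2 ^ s + 1) * (2 ^ s + 1) + (B * 2 ^ s + 1) * (2 ^ s + 1))) + 100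
      ≤ 40000 * (m * (n + B * 4 ^ s)) := by
  have h1 : 1 ≤ 2 ^ s := Nat.one_le_two_pow
  have h4 : 4 ^ s = 2 ^ s * 2 ^ s := by rw [← Nat.mul_pow]
  rw [h4]
  generalize 2 ^ s = x at *
  have h₂ : x * x ≤ B * (x * x) := Nat.le_mul_of_pos_left _ hB
  have h₃ : (x + 1) * (x + 1) ≤ 4 * (B * (x * x)) := by nlinarith
  have h₄ : (B * x + 1) * (x + 1) ≤ 4 * (B * (x * x)) := by nlinarith
  have h₅ : m * (n + (x + 1) * (x + 1) + (B * x + 1) * (x + 1))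
      ≤ m * (n + 8 * (B * (x * x))) := Nat.mul_le_mul_left _ (by omega)
  have h₆ : 1 ≤ m * (B * (x * x)) := Nat.mul_pos hm (by positivity)
  have h₇ : m * (n + 8 * (B * (x * x))) = m * n + 8 * (m * (B * (x * x))) := by ring
  have h₈ : m * (n + B * (x * x)) = m * n + m * (B * (x * x)) := by ring
  omega

theorem sum_round_cost_le {m n B : ℕ} (r : ℕ) :
    ∑ s ∈ Finset.range r, 40000 * (m * (n + B * 4 ^ s))
      ≤ 40000 * (m * (n * r + B * (4 ^ r - 1))) := by
  induction r with
  | zero => simp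
  | succ r ih =>
    rw [Finset.sum_range_succ]
    refine (Nat.add_le_add_right ih _).trans ?_
    rw [← Nat.mul_add, ← Nat.mul_add]
    refine Nat.mul_le_mul_left _ (Nat.mul_le_mul_left _ ?_)
    have : B * (4 ^ r - 1) + B * 4 ^ r ≤ B * (4 ^ (r + 1) - 1) := by
      rw [← Nat.mul_add]
      refine Nat.mul_le_mul_left _ ?_
      have : 1 ≤ 4 ^ r := Nat.one_le_pow' _ _
      rw [pow_succ]
      omega
    rw [Nat.mul_succ]
    omega

/-- A round: the fineness is set to the value of `e`, and the problem is solved for it. -/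
theorem runs_round {m n B N : ℕ} {A : Fin m → Agent n} {ε : ℝ} (hA : ∀ l, (A l).Admissible)
    (hm : 0 < m) (hfeas : ∑ l, (A l).betaMin ≤ (B : ℝ)) {σ : Memory} (hσ : HoldsInput A B ε σ)
    {e : IExp} (hN : e.eval σ = N) (h₀ : ∀ j, σ.rarr τD 0 j = 0) :
    Runs (.iset ιN e ;; solve) σ
      (e.cost + 1 + 4000 * (m * (n + (N + 1) * (N + 1) + (B * N + 1) * (N + 1)))) fun τ =>
      HoldsInput A B ε τ ∧ τ.ivar ιN = N ∧ (∀ j, τ.rarr τD 0 j = 0) ∧ τ.rvar ρΛ = lipBound A ∧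
        IsSolution A B N (fun l => τ.rarr τout l 0) (τ.rvar ρW) := by
  refine Runs.seq (Runs.of_wp (Q := fun τ => τ.ivar ιN = N) (by simpa using hN)) fun τ hτ hN' =>
    have H := hσ.of_agree hτ rfl
    Runs.mono (runs_solve hA hm hfeas H hN' (by rwa [hτ.rarr τD rfl])) le_rfl fun υ hυ hQ =>
      ⟨H.of_agree hυ rfl, (hυ.ivar ιN rfl).trans hN', hQ⟩

/-- If all rounds from the `r`-th on meet the stopping criterion, then at most `r` rounds follow the
initial one. -/
theorem runs_refine {m n B : ℕ} {A : Fin m → Agent n} {ε : ℝ} (hA : ∀ l, (A l).Admissible)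
    (hm : 0 < m) (hB : 0 < B) (hfeas : ∑ l, (A l).betaMin ≤ (B : ℝ)) {θ : RExp} {g : ℝ → ℝ}
    (hθ : ∀ σ, σ.rvar ρε = ε → θ.eval σ = g (σ.rvar ρW)) (hc : θ.cost ≤ 10) {r : ℕ}
    (hr : ∀ s b v, IsSolution A B (fineness s) b v →
      g v * (max (fineness s) 1 : ℕ) < 4 * m * lipBound A → s < r)
    {σ : Memory} (hσ : HoldsInput A B ε σ) (h₀ : ∀ j, σ.rarr τD 0 j = 0) :
    Runs (refine θ) σ (40000 * (m * (n * (r + 1) + B * (4 ^ r - 1)))) fun τ => ∃ N,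
      IsSolution A B N (fun l => τ.rarr τout l 0) (τ.rvar ρW) ∧
        4 * m * lipBound A ≤ g (τ.rvar ρW) * (max N 1 : ℕ) := by
  have hn : 0 < n := Fin.pos_iff_nonempty.2 (hA ⟨0, hm⟩).nonempty
  let I : ℕ → Memory → Prop := fun s τ => HoldsInput A B ε τ ∧ τ.ivar ιN = fineness s ∧
    (∀ j, τ.rarr τD 0 j = 0) ∧ τ.rvar ρΛ = lipBound A ∧
    IsSolution A B (fineness s) (fun l => τ.rarr τout l 0) (τ.rvar ρW)
  have htest : ∀ s τ, I s τ → ((Test.rlt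
      (.mul θ (.ofInt (.add (.var ιN) (.sub (.lit 1) (.var ιN)))))
      (.mul (.mul (.ofInt (.lit 4)) (.ofInt (.var ιm))) (.var ρΛ))).Holds τ ↔
        g (τ.rvar ρW) * (max (fineness s) 1 : ℕ) < 4 * m * lipBound A) := by
    rintro s τ ⟨h₁, h₂, -, h₄, -⟩
    simp only [Test.Holds, RExp.eval, IExp.eval, h₂, h₄, h₁.m_eq, hθ τ h₁.ε_eq,
      add_one_tsub_eq_max, Nat.cast_ofNat]
  refine Runs.mono (Runs.seq (Q := I 0) (T := 12002 * (m * n))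
    (Runs.mono (runs_round hA hm hfeas hσ rfl h₀) ?_ fun _ _ h => h)
    fun τ _ hI => Runs.loop_indexed (r := r)
      (T := fun s => 8 + 4000 * (m * (n + (2 ^ s + 1) * (2 ^ s + 1)
        + (B * 2 ^ s + 1) * (2 ^ s + 1)))) I hI fun s υ hI' hb =>
      ⟨hr s _ _ hI'.2.2.2.2 ((htest s υ hI').1 hb), ?_⟩) ?_ ?_
  · have h₁ : m ≤ m * n := Nat.le_mul_of_pos_right _ hn
    have h₂ : m * (n + 1 + 1) = m * n + 2 * m := by ring
    simp only [IExp.eval, IExp.cost]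
    simp
    omega
  · obtain ⟨h₁, h₂, h₃, -, -⟩ := hI'
    exact (runs_round (N := fineness (s + 1)) hA hm hfeas h₁
      (by simp only [IExp.eval, h₂, fineness_double]) h₃).mono (by rw [fineness_succ]; rfl)
      fun _ _ h => h
  · have h₁ : 1 ≤ m * n := Nat.mul_pos hm hn
    have h₂ : m * (n * (r + 1) + B * (4 ^ r - 1)) = m * (n * r + B * (4 ^ r - 1)) + m * n := by ring
    have h₃ := (Finset.sum_le_sum fun s (_ : s ∈ Finset.range r) =>
      round_cost_le (n := n) hm hB s).trans (sum_round_cost_le (m := m) (n := n) (B := B) r)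
    rw [h₂]
    refine (Nat.add_le_add_left (Nat.add_le_add ((Finset.sum_le_sum fun s _ => ?_).trans h₃)
      (?_ : _ ≤ 100)) _).trans (by omega)
    all_goals
      simp only [Test.cost, RExp.cost, IExp.cost]
      omega
  · rintro υ - ⟨⟨s, hI'⟩, hb⟩
    rw [htest s υ hI', not_lt] at hb
    exact ⟨_, hI'.2.2.2.2, hb⟩

/-! ### The approximation guarantee -/

theorem IsSolution.opt_le {m n B N : ℕ} {A : Fin m → Agent n} {b : Fin m → ℝ} {v : ℝ}
    (h : IsSolution A B N b v) : opt A B ≤ v + 4 * m * lipBound A / (max N 1 : ℕ) := by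
  refine csSup_le ⟨_, b, h.feasible, rfl⟩ ?_
  rintro _ ⟨b', hb', rfl⟩
  exact h.total_le b' hb'

theorem IsSolution.le_opt {m n B N : ℕ} {A : Fin m → Agent n} {b : Fin m → ℝ} {v : ℝ}
    (h : IsSolution A B N b v) : v ≤ opt A B := by
  refine h.le_total.trans (le_csSup ⟨v + 4 * m * lipBound A / (max N 1 : ℕ), ?_⟩
    ⟨b, h.feasible, rfl⟩)
  rintro _ ⟨b', hb', rfl⟩
  exact h.total_le b' hb'

/-- The number of rounds until the fineness reaches `Y`, and the time they take. A round has a cost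
linear in `n` even while the grid is coarse; since `n * k ≤ n * log n + 4 ^ k`, the last round or
the factor `log n` pays for all of them. -/
theorem exists_rounds {n B : ℕ} (hn : 0 < n) (hB : 0 < B) (Y : ℝ) :
    ∃ r, (∀ s, ((max (fineness s) 1 : ℕ) : ℝ) < Y → s < r) ∧
      ((n * (r + 1) + B * (4 ^ r - 1) : ℕ) : ℝ)
        ≤ 34 * (n + B * Y ^ 2) * Real.log (max n 2 : ℕ) := by
  have hn' : (1 : ℝ) ≤ n := by exact_mod_cast hn
  have hB' : (1 : ℝ) ≤ B := by exact_mod_cast hB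
  have hL : Real.log n ≤ Real.log (max n 2 : ℕ) :=
    Real.log_le_log (by linarith) (by exact_mod_cast le_max_left n 2)
  have hL2 : 1 / 2 ≤ Real.log (max n 2 : ℕ) :=
    (by linarith [Real.log_two_gt_d9] : 1 / 2 ≤ Real.log 2).trans
      (Real.log_le_log two_pos (by exact_mod_cast le_max_right n 2))
  generalize Real.log (max n 2 : ℕ) = L at *
  have hBY : 0 ≤ B * Y ^ 2 := by positivity
  have hX : n + B * Y ^ 2 ≤ 2 * ((n + B * Y ^ 2) * L) := by nlinarith
  rcases lt_or_ge Y 1 with h | h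
  · refine ⟨0, fun s hs => ?_, ?_⟩
    · have : (1 : ℝ) ≤ (max (fineness s) 1 : ℕ) := by exact_mod_cast le_max_right _ _
      linarith
    · norm_num
      nlinarith
  · obtain ⟨k, hk, hk'⟩ := exists_nat_pow_near h one_lt_two
    -- In round `s` the fineness is `2 ^ (s - 1)`, which exceeds `Y` from `s = k + 2` on.
    refine ⟨k + 2, fun s hs => ?_, ?_⟩
    · rcases s with _ | s
      · omega
      · rw [fineness_succ, max_eq_left Nat.one_le_two_pow] at hs
        push_cast at hs
        have := (pow_lt_pow_iff_right₀ one_lt_two).1 (hs.trans hk')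
        omega
    · have h4 : (4 : ℝ) ^ k ≤ Y ^ 2 := by
        rw [show (4 : ℝ) = 2 ^ 2 by norm_num, ← pow_mul, mul_comm, pow_mul]
        exact pow_le_pow_left₀ (by positivity) hk 2
      have hlog : (k : ℝ) ≤ Real.log (4 ^ k) := by
        rw [Real.log_pow]
        refine le_mul_of_one_le_right (Nat.cast_nonneg _) ?_
        rw [show (4 : ℝ) = 2 ^ 2 by norm_num, Real.log_pow]
        push_cast
        linarith [Real.log_two_gt_d9]
      have hdiv := Real.log_le_sub_one_of_pos (x := 4 ^ k / n) (by positivity)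
      rw [Real.log_div (by positivity) (by positivity)] at hdiv
      have hnk : n * (k : ℝ) ≤ n * L + 4 ^ k := by
        have h₁ : (k : ℝ) ≤ L + 4 ^ k / n := by linarith
        have h₂ := mul_le_mul_of_nonneg_left h₁ (by linarith : (0 : ℝ) ≤ n)
        rwa [mul_add, mul_div_cancel₀ _ (by positivity)] at h₂
      have hle : ((n * (k + 2 + 1) + B * (4 ^ (k + 2) - 1) : ℕ) : ℝ)
          ≤ n * (k + 3) + B * (16 * 4 ^ k) := by
        have : n * (k + 2 + 1) + B * (4 ^ (k + 2) - 1) ≤ n * (k + 3) + B * (16 * 4 ^ k) := by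
          refine Nat.add_le_add_left (Nat.mul_le_mul_left _ ?_) _
          rw [pow_add]
          omega
        exact_mod_cast this
      have h₁ := mul_le_mul_of_nonneg_left h4 (by linarith : (0 : ℝ) ≤ B)
      have h₂ : (4 : ℝ) ^ k ≤ B * Y ^ 2 := h4.trans (le_mul_of_one_le_left (by positivity) hB')
      have h₃ : n * L ≤ (n + B * Y ^ 2) * L := by nlinarith
      nlinarith

/-- The running time of the refinement if every solution that misses the stopping criterion belongs
to a fineness below `8 * m * lipBound A / δ`. -/
theorem runs_refine_of_lt {m n B : ℕ} {A : Fin m → Agent n} {ε δ : ℝ}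
    (hA : ∀ l, (A l).Admissible) (hm : 0 < m) (hB : 0 < B)
    (hfeas : ∑ l, (A l).betaMin ≤ (B : ℝ)) {θ : RExp} {g : ℝ → ℝ}
    (hθ : ∀ σ, σ.rvar ρε = ε → θ.eval σ = g (σ.rvar ρW)) (hc : θ.cost ≤ 10)
    (hg : ∀ N b v, IsSolution A B N b v → g v * (max N 1 : ℕ) < 4 * m * lipBound A →
      ((max N 1 : ℕ) : ℝ) < 8 * m * lipBound A / δ) :
    ∃ (τ : Memory) (t : ℕ) (N : ℕ), Exec (refine θ) (inputMemory A B ε) τ t ∧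
      (t : ℝ) ≤ 87040000 * (m * n + lipBound A ^ 2 * (m ^ 3 * B / δ ^ 2))
        * Real.log (max n 2 : ℕ) ∧
      IsSolution A B N (fun l => τ.rarr τout l 0) (τ.rvar ρW) ∧
      4 * m * lipBound A ≤ g (τ.rvar ρW) * (max N 1 : ℕ) := by
  have hn : 0 < n := Fin.pos_iff_nonempty.2 (hA ⟨0, hm⟩).nonempty
  have hΛ : 0 ≤ lipBound A := (hA ⟨0, hm⟩).lip_nonneg.trans (lip_le_lipBound A _)
  have hσ : HoldsInput A B ε (inputMemory A B ε) := by
    refine ⟨?_, ?_, ?_, ?_, fun l => ⟨?_, ?_⟩, ?_, ?_, ?_⟩ <;> simp [inputMemory]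
  obtain ⟨r, hr, hT⟩ := exists_rounds hn hB (8 * m * lipBound A / δ)
  obtain ⟨τ, t, he, ht, N, h₁, h₂⟩ := runs_refine hA hm hB hfeas hθ hc (r := r)
    (fun s b v h hlt => hr s (hg _ b v h hlt)) hσ fun j => by simp [inputMemory]
  refine ⟨τ, t, N, he, ?_, h₁, h₂⟩
  calc (t : ℝ) ≤ (40000 * (m * (n * (r + 1) + B * (4 ^ r - 1))) : ℕ) := by exact_mod_cast ht
    _ = 40000 * (m * ((n * (r + 1) + B * (4 ^ r - 1) : ℕ) : ℝ)) := by
      rw [Nat.cast_mul, Nat.cast_mul m]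
      norm_num
    _ ≤ 40000 * (m * (34 * (n + B * (8 * m * lipBound A / δ) ^ 2)
        * Real.log (max n 2 : ℕ))) := by gcongr
    _ = (1360000 * (m * n) + 87040000 * (lipBound A ^ 2 * (m ^ 3 * B / δ ^ 2)))
        * Real.log (max n 2 : ℕ) := by ring
    _ ≤ _ := by
      refine mul_le_mul_of_nonneg_right ?_ (Real.log_natCast_nonneg _)
      have : (0 : ℝ) ≤ m * n := by positivity
      linarith

end Inspection

theorem mainTheorem3 :
    ∃ (C : ℝ) (P Q : Inspection.Program),
      ∀ (m n B : ℕ) (A : Fin m → Inspection.Agent n),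
        0 < m → 0 < B →
        (∀ l, (A l).Valid) →
        (∀ l, (A l).NoDominated) →
        (∀ l, (A l).SafetyFeasible) →
        ∑ l, (A l).betaMin ≤ (B : ℝ) →
        -- absolute accuracy
        (∀ ε : ℝ, 0 < ε →
          ∃ b : Fin m → ℝ,
            Inspection.Outputs P A B ε b
              (C * ((m : ℝ) * n
                  + Inspection.lipBound A ^ 2 * ((m : ℝ) ^ 3 * B / ε ^ 2))
                * Real.log (max n 2 : ℕ)) ∧
            Inspection.Feasible A B b ∧
            Inspection.opt A B - ε ≤ Inspection.total A b) ∧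
        -- relative accuracy
        (0 < Inspection.opt A B →
          ∀ ε : ℝ, 0 < ε → ε ≤ 1 →
            ∃ b : Fin m → ℝ,
              Inspection.Outputs Q A B ε b
                (C * ((m : ℝ) * n
                    + (Inspection.lipBound A / Inspection.opt A B) ^ 2
                      * ((m : ℝ) ^ 3 * B / ε ^ 2))
                  * Real.log (max n 2 : ℕ)) ∧
              Inspection.Feasible A B b ∧
              (1 - ε) * Inspection.opt A B ≤ Inspection.total A b) := by
  refine ⟨87040000, Inspection.refine (.var ρε), Inspection.refine (.mul (.var ρε) (.var ρW)),
    fun m n B A hm hB hV hD hS hfeas => ?_⟩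
  have hA : ∀ l, (A l).Admissible := fun l => ⟨hV l, hD l, hS l⟩
  have hΛ : 0 ≤ Inspection.lipBound A :=
    (hA ⟨0, hm⟩).lip_nonneg.trans (Inspection.lip_le_lipBound A _)
  have hpos : ∀ N : ℕ, (0 : ℝ) < (max N 1 : ℕ) := fun N => by
    exact_mod_cast lt_max_of_lt_right one_pos
  refine ⟨fun ε hε => ?_, fun hopt ε hε hε1 => ?_⟩
  · obtain ⟨τ, t, N, he, ht, hsol, hle⟩ := Inspection.runs_refine_of_lt (g := fun _ => ε)
      (θ := .var ρε) hA hm hB hfeas (fun σ h => h) (by simp [Inspection.RExp.cost])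
      (δ := ε) fun N b v _ hlt => by
        rw [lt_div_iff₀ hε]
        have : 0 ≤ m * Inspection.lipBound A := by positivity
        linarith
    refine ⟨_, ⟨τ, t, he, ht, fun l => rfl⟩, hsol.feasible, ?_⟩
    have h₁ := (div_le_iff₀ (hpos N)).2 hle
    linarith [hsol.le_total, hsol.opt_le]
  · obtain ⟨τ, t, N, he, ht, hsol, hle⟩ := Inspection.runs_refine_of_lt (g := fun v => ε * v)
      (θ := .mul (.var ρε) (.var ρW)) (δ := ε * Inspection.opt A B) hA hm hB hfeas
      (fun σ (h : σ.rvar ρε = ε) => by simp [h]) (by simp [Inspection.RExp.cost])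
      fun N b v hsol hlt => by
        -- If the grid were finer, then `v` would be at least half of the optimum.
        by_contra! hle
        rw [div_le_iff₀ (by positivity)] at hle
        have h₁ : 4 * m * Inspection.lipBound A / (max N 1 : ℕ) ≤ Inspection.opt A B / 2 := by
          rw [div_le_iff₀ (hpos N)]
          nlinarith [mul_pos (hpos N) hopt]
        have h₂ : Inspection.opt A B / 2 ≤ v := by linarith [hsol.opt_le]
        have h₃ := mul_le_mul_of_nonneg_left h₂ (mul_pos hε (hpos N)).le
        linarith
    refine ⟨_, ⟨τ, t, he, ht.trans_eq (by ring), fun l => rfl⟩, hsol.feasible, ?_⟩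
    have h₁ := (div_le_iff₀ (hpos N)).2 hle
    have h₂ := mul_le_mul_of_nonneg_left hsol.le_opt hε.le
    linarith [hsol.le_total, hsol.opt_le]
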